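/- **Conventions.** All $n$-categories are strict and globular; $s_i,t_i$ are the $i$-source and $i$-target, $\star_i$ is composition along $i$-cells. For an $n$-category $\mathcal C$, a cellular extension $\Gamma$ of $\mathcal C$ is a set of formal $(n+1)$-cells, each with a source and a target that are parallel $n$-cells of $\mathcal C$ (any two $0$-cells are parallel). It has a free $(n+1)$-category $\mathcal C[\Gamma]$, a quotient $n$-category $\mathcal C/\Gamma$ (identify source and target of each element of $\Gamma$), and a track $(n+1)$-category $\mathcal C(\Gamma)=\mathcal C[\Gamma,\Gamma^-]/(\gamma\star_n\gamma^-= 1_{s(\gamma)},\ \gamma^-\star_n\gamma= 1_{t(\gamma)})$, whose $(n+1)$-cells are invertible. A $0$-polygraph is a set; for $n\ge 1$, an $n$-polygraph $\Sigma$ is an $(n-1)$-polygraph $\Sigma'$ (generating a free $(n-1)$-category $\Sigma'^*$) with a cellular extension $\Sigma_n$ of $\Sigma'^*$, whose elements are the generating $n$-cells of $\Sigma$. Put $\Sigma^*=\Sigma'^*[\Sigma_n]$, $\overline\Sigma=\Sigma'^*/\Sigma_n$ (the $(n-1)$-category presented by $\Sigma$) and $\Sigma^\top=\Sigma'^*(\Sigma_n)$.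 Two $n$-polygraphs are Tietze-equivalent when the $(n-1)$-categories they present are isomorphic. **Natural systems.** For an $m$-category $\mathcal C$, the category of contexts has the $m$-cells of $\mathcal C$ as objects; a morphism $f\to g$ is an $m$-cell $C=C[x]$, with exactly one occurrence of $x$, of the $m$-category obtained from $\mathcal C$ by freely adjoining an $m$-cell $x$ parallel to $f$, such that $C[f]=g$; composition is substitution. An abelian natural system $D$ on $\mathcal C$ is a functor from this category to abelian groups. It is finitely generated if there is a finite family of elements $b_1\in D_{f_1},\dots,b_k\in D_{f_k}$ such that, for every $m$-cell $g$, every element of $D_g$ is a $\mathbb Z$-linear combination of elements $D_C(b_j)$, with $1\le j\le k$ and $C$ a context from $f_j$ to $g$. **Identities among relations.** Let $n\ge 1$ and let $\mathcal T$ be a track $n$-category. Let $\overline{\mathcal T}$ be the quotient of the underlying $(n-1)$-category $\mathcal T_{n-1}$ by the $n$-cells of $\mathcal T$. Then $\Pi(\mathcal T)$ is the abelian natural system on $\overline{\mathcal T}$ such that $\Pi(\mathcal T)_u$ is the abelian group generated by the symbols $\lfloor f\rfloor$, for the $n$-cells $f:a\to a$ of $\mathcal T$ with $\overline a=u$, subject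 to $\lfloor f\star_{n-1}g\rfloor=\lfloor f\rfloor+\lfloor g\rfloor$ for $f,g:a\to a$ and $\lfloor f\star_{n-1}g\rfloor=\lfloor g\star_{n-1}f\rfloor$ for $f:a\to b$, $g:b\to a$, with $\overline a=\overline b=u$; a context $C$ of $\overline{\mathcal T}$ maps $\lfloor f\rfloor$ to $\lfloor B[f]\rfloor$, where $B$ is any context of $\mathcal T_{n-1}$ on the base point of $f$ that represents $C$. For an $n$-polygraph $\Sigma$, let $\Pi(\Sigma)=\Pi(\Sigma^\top_{\mathrm{ab}})$, where $\Sigma^\top_{\mathrm{ab}}$ is the quotient of $\Sigma^\top$ by the relations $f\star_{n-1}g=g\star_{n-1}f$ for all $n$-cells $f,g:a\to a$ with the same base point $a$. **Proposition.** Let $n\ge 1$ and let $\Sigma$ and $\Upsilon$ be two Tietze-equivalent $n$-polygraphs such that the sets $\Sigma_n$ and $\Upsilon_n$ of generating $n$-cells are finite. Then the natural system $\Pi(\Sigma)$ is finitely generated if and only if the natural system $\Pi(\Upsilon)$ is finitely generated. -/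

import Mathlib

open CategoryTheory

universe u v

/-! ### Strict `n`-categories -/

/-- A strict globular `n`-category, in the one-sorted presentation: `X` is the set of all cells, and
a cell of dimension `k ≤ n` is identified with the identity cells of higher dimension that it
generates. Thus the `k`-cells are the `x` with `s k x = x` (equivalently `t k x = x`), and every
element of `X` is an `n`-cell. `s i x` and `t i x` are the `i`-source and the `i`-target of `x`.
`comp i x y` is the composite `x ⋆ᵢ y` (in diagrammatic order); it is meaningful only if `i < n` and
`x`, `y` are `i`-composable, that is, `t i x = s i y`: no axiom says anything about its value
in the other cases, and nothing below depends on it. -/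
structure NCat (n : ℕ) : Type (u + 1) where
  X : Type u
  s : ℕ → X → X
  t : ℕ → X → X
  comp : ℕ → X → X → X
  s_s_lt : ∀ {i j : ℕ} (x : X), i < j → s i (s j x) = s i x
  s_t_lt : ∀ {i j : ℕ} (x : X), i < j → s i (t j x) = s i x
  t_s_lt : ∀ {i j : ℕ} (x : X), i < j → t i (s j x) = t i x
  t_t_lt : ∀ {i j : ℕ} (x : X), i < j → t i (t j x) = t i x
  s_s_le : ∀ {i j : ℕ} (x : X), j ≤ i → s i (s j x) = s j x
  s_t_le : ∀ {i j : ℕ} (x : X), j ≤ i → s i (t j x) = t j x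
  t_s_le : ∀ {i j : ℕ} (x : X), j ≤ i → t i (s j x) = s j x
  t_t_le : ∀ {i j : ℕ} (x : X), j ≤ i → t i (t j x) = t j x
  s_top : ∀ {i : ℕ} (x : X), n ≤ i → s i x = x
  t_top : ∀ {i : ℕ} (x : X), n ≤ i → t i x = x
  s_comp : ∀ {i : ℕ} {x y : X}, i < n → t i x = s i y → s i (comp i x y) = s i x
  t_comp : ∀ {i : ℕ} {x y : X}, i < n → t i x = s i y → t i (comp i x y) = t i y
  s_comp_lt : ∀ {i j : ℕ} {x y : X}, i < n → i < j → t i x = s i y →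
    s j (comp i x y) = comp i (s j x) (s j y)
  t_comp_lt : ∀ {i j : ℕ} {x y : X}, i < n → i < j → t i x = s i y →
    t j (comp i x y) = comp i (t j x) (t j y)
  id_comp : ∀ {i : ℕ} (x : X), i < n → comp i (s i x) x = x
  comp_id : ∀ {i : ℕ} (x : X), i < n → comp i x (t i x) = x
  assoc : ∀ {i : ℕ} {x y z : X}, i < n → t i x = s i y → t i y = s i z →
    comp i (comp i x y) z = comp i x (comp i y z)
  exchange : ∀ {i j : ℕ} {x y z w : X}, i < j → j < n → t j x = s j y → t j z = s j w →
    t i x = s i z → comp i (comp j x y) (comp j z w) = comp j (comp i x z) (comp i y w)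

/-- An `n`-functor between `n`-categories. -/
structure NFunctor {n : ℕ} (C : NCat.{u} n) (D : NCat.{v} n) where
  map : C.X → D.X
  map_s : ∀ (i : ℕ) (x : C.X), map (C.s i x) = D.s i (map x)
  map_t : ∀ (i : ℕ) (x : C.X), map (C.t i x) = D.t i (map x)
  map_comp : ∀ {i : ℕ} {x y : C.X}, i < n → C.t i x = C.s i y →
    map (C.comp i x y) = D.comp i (map x) (map y)

/-- Two `n`-categories are isomorphic when there are mutually inverse `n`-functors between them. -/
def NCat.Isomorphic {n : ℕ} (C : NCat.{u} n) (D : NCat.{v} n) : Prop :=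
  ∃ (F : NFunctor C D) (G : NFunctor D C),
    (∀ x, G.map (F.map x) = x) ∧ (∀ y, F.map (G.map y) = y)

namespace NCat

/-- A set seen as a `0`-category. -/
def discrete (A : Type u) : NCat.{u} 0 where
  X := A
  s _ x := x
  t _ x := x
  comp _ x _ := x
  s_s_lt _ _ := rfl
  s_t_lt _ _ := rfl
  t_s_lt _ _ := rfl
  t_t_lt _ _ := rfl
  s_s_le _ _ := rfl
  s_t_le _ _ := rfl
  t_s_le _ _ := rfl
  t_t_le _ _ := rfl
  s_top _ _ := rfl
  t_top _ _ := rfl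
  s_comp h := absurd h (Nat.not_lt_zero _)
  t_comp h := absurd h (Nat.not_lt_zero _)
  s_comp_lt h := absurd h (Nat.not_lt_zero _)
  t_comp_lt h := absurd h (Nat.not_lt_zero _)
  id_comp _ h := absurd h (Nat.not_lt_zero _)
  comp_id _ h := absurd h (Nat.not_lt_zero _)
  assoc h := absurd h (Nat.not_lt_zero _)
  exchange _ h := absurd h (Nat.not_lt_zero _)

/-- An `n`-category seen as an `(n + 1)`-category all of whose `(n + 1)`-cells are identities. -/
def promote {n : ℕ} (C : NCat.{u} n) : NCat.{u} (n + 1) where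
  X := C.X
  s := C.s
  t := C.t
  comp i x y := if i < n then C.comp i x y else x
  s_s_lt := C.s_s_lt
  s_t_lt := C.s_t_lt
  t_s_lt := C.t_s_lt
  t_t_lt := C.t_t_lt
  s_s_le := C.s_s_le
  s_t_le := C.s_t_le
  t_s_le := C.t_s_le
  t_t_le := C.t_t_le
  s_top x h := C.s_top x (by omega)
  t_top x h := C.t_top x (by omega)
  s_comp {i x y} hi h := by
    by_cases hn : i < n
    · simp only [hn, if_true]; exact C.s_comp hn h
    · simp only [hn, if_false]
  t_comp {i x y} hi h := by
    by_cases hn : i < n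
    · simp only [hn, if_true]; exact C.t_comp hn h
    · simp only [hn, if_false]
      rw [h, C.s_top y (by omega), C.t_top y (by omega)]
  s_comp_lt {i j x y} hi hij h := by
    by_cases hn : i < n
    · simp only [hn, if_true]; exact C.s_comp_lt hn hij h
    · simp only [hn, if_false]
  t_comp_lt {i j x y} hi hij h := by
    by_cases hn : i < n
    · simp only [hn, if_true]; exact C.t_comp_lt hn hij h
    · simp only [hn, if_false]
  id_comp {i} x hi := by
    by_cases hn : i < n
    · simp only [hn, if_true]; exact C.id_comp x hn
    · simp only [hn, if_false]; exact C.s_top x (by omega)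
  comp_id {i} x hi := by
    by_cases hn : i < n
    · simp only [hn, if_true]; exact C.comp_id x hn
    · simp only [hn, if_false]
  assoc {i x y z} hi h h' := by
    by_cases hn : i < n
    · simp only [hn, if_true]; exact C.assoc hn h h'
    · simp only [hn, if_false]
  exchange {i j x y z w} hij hj h h' h'' := by
    have hi : i < n := by omega
    by_cases hn : j < n
    · simp only [hn, hi, if_true]; exact C.exchange hij hn h h' h''
    · simp only [hn, hi, if_true, if_false]

theorem s_of_isCell {n : ℕ} (C : NCat.{u} (n + 1)) {x : C.X} (h : C.s n x = x) (i : ℕ) :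
    C.s n (C.s i x) = C.s i x := by
  by_cases hi : i ≤ n
  · exact C.s_s_le x hi
  · rw [C.s_top x (by omega), h]

theorem t_of_isCell {n : ℕ} (C : NCat.{u} (n + 1)) {x : C.X} (h : C.s n x = x) (i : ℕ) :
    C.s n (C.t i x) = C.t i x := by
  by_cases hi : i ≤ n
  · exact C.s_t_le x hi
  · rw [C.t_top x (by omega), h]

/-- The `n`-category `Cₙ` of `n`-cells of an `(n + 1)`-category `C`. -/
def trunc {n : ℕ} (C : NCat.{u} (n + 1)) : NCat.{u} n where
  X := {x : C.X // C.s n x = x}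
  s i x := ⟨C.s i x.1, C.s_of_isCell x.2 i⟩
  t i x := ⟨C.t i x.1, C.t_of_isCell x.2 i⟩
  comp i x y := ⟨C.s n (C.comp i x.1 y.1), C.s_s_le _ le_rfl⟩
  s_s_lt x h := Subtype.ext (C.s_s_lt x.1 h)
  s_t_lt x h := Subtype.ext (C.s_t_lt x.1 h)
  t_s_lt x h := Subtype.ext (C.t_s_lt x.1 h)
  t_t_lt x h := Subtype.ext (C.t_t_lt x.1 h)
  s_s_le x h := Subtype.ext (C.s_s_le x.1 h)
  s_t_le x h := Subtype.ext (C.s_t_le x.1 h)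
  t_s_le x h := Subtype.ext (C.t_s_le x.1 h)
  t_t_le x h := Subtype.ext (C.t_t_le x.1 h)
  s_top {i} x h := Subtype.ext (by
    change C.s i x.1 = x.1
    rw [← x.2]; exact C.s_s_le _ h)
  t_top {i} x h := Subtype.ext (by
    change C.t i x.1 = x.1
    rw [← x.2]; exact C.t_s_le _ h)
  s_comp {i x y} hi h := Subtype.ext (by
    have h' : C.t i x.1 = C.s i y.1 := congrArg Subtype.val h
    change C.s i (C.s n (C.comp i x.1 y.1)) = C.s i x.1
    rw [C.s_s_lt _ hi, C.s_comp (by omega) h'])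
  t_comp {i x y} hi h := Subtype.ext (by
    have h' : C.t i x.1 = C.s i y.1 := congrArg Subtype.val h
    change C.t i (C.s n (C.comp i x.1 y.1)) = C.t i y.1
    rw [C.t_s_lt _ hi, C.t_comp (by omega) h'])
  s_comp_lt {i j x y} hi hij h := Subtype.ext (by
    have h' : C.t i x.1 = C.s i y.1 := congrArg Subtype.val h
    have h2 : C.t i (C.s j x.1) = C.s i (C.s j y.1) := by
      rw [C.t_s_lt _ hij, C.s_s_lt _ hij, h']
    change C.s j (C.s n (C.comp i x.1 y.1)) = C.s n (C.comp i (C.s j x.1) (C.s j y.1))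
    rw [C.s_comp_lt (by omega) hi h', C.s_comp_lt (by omega) hi h2, x.2, y.2,
      C.s_comp_lt (by omega) hij h', C.s_of_isCell x.2, C.s_of_isCell y.2])
  t_comp_lt {i j x y} hi hij h := Subtype.ext (by
    have h' : C.t i x.1 = C.s i y.1 := congrArg Subtype.val h
    have h2 : C.t i (C.t j x.1) = C.s i (C.t j y.1) := by
      rw [C.t_t_lt _ hij, C.s_t_lt _ hij, h']
    change C.t j (C.s n (C.comp i x.1 y.1)) = C.s n (C.comp i (C.t j x.1) (C.t j y.1))
    rw [C.s_comp_lt (by omega) hi h', C.s_comp_lt (by omega) hi h2, x.2, y.2,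
      C.t_comp_lt (by omega) hij h', C.t_of_isCell x.2, C.t_of_isCell y.2])
  id_comp {i} x hi := Subtype.ext (by
    change C.s n (C.comp i (C.s i x.1) x.1) = x.1
    rw [C.id_comp _ (by omega), x.2])
  comp_id {i} x hi := Subtype.ext (by
    change C.s n (C.comp i x.1 (C.t i x.1)) = x.1
    rw [C.comp_id _ (by omega), x.2])
  assoc {i x y z} hi h h' := Subtype.ext (by
    have h1 : C.t i x.1 = C.s i y.1 := congrArg Subtype.val h
    have h2 : C.t i y.1 = C.s i z.1 := congrArg Subtype.val h'
    change C.s n (C.comp i (C.s n (C.comp i x.1 y.1)) z.1) =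
      C.s n (C.comp i x.1 (C.s n (C.comp i y.1 z.1)))
    rw [C.s_comp_lt (by omega) hi h1, C.s_comp_lt (by omega) hi h2, x.2, y.2, z.2,
      C.assoc (by omega) h1 h2])
  exchange {i j x y z w} hij hj h h' h'' := Subtype.ext (by
    have h1 : C.t j x.1 = C.s j y.1 := congrArg Subtype.val h
    have h2 : C.t j z.1 = C.s j w.1 := congrArg Subtype.val h'
    have h3 : C.t i x.1 = C.s i z.1 := congrArg Subtype.val h''
    have h4 : C.t i y.1 = C.s i w.1 := by
      rw [← C.t_s_lt y.1 hij, ← C.s_s_lt w.1 hij, ← h1, ← h2, C.t_t_lt _ hij, C.s_t_lt _ hij, h3]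
    change C.s n (C.comp i (C.s n (C.comp j x.1 y.1)) (C.s n (C.comp j z.1 w.1))) =
      C.s n (C.comp j (C.s n (C.comp i x.1 z.1)) (C.s n (C.comp i y.1 w.1)))
    rw [C.s_comp_lt (by omega) hj h1, C.s_comp_lt (by omega) hj h2,
      C.s_comp_lt (by omega) (by omega) h3, C.s_comp_lt (by omega) (by omega) h4,
      x.2, y.2, z.2, w.2, C.exchange hij (by omega) h1 h2 h3])

theorem s_comp_any {n : ℕ} (C : NCat.{u} n) {k : ℕ} {x y : C.X} (hk : k < n)
    (h : C.t k x = C.s k y) (i : ℕ) :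
    C.s i (C.comp k x y) = if k < i then C.comp k (C.s i x) (C.s i y) else C.s i x := by
  rcases lt_trichotomy i k with hi | rfl | hi
  · rw [if_neg (by omega), ← C.s_s_lt (C.comp k x y) hi, C.s_comp hk h, C.s_s_lt _ hi]
  · rw [if_neg (by omega), C.s_comp hk h]
  · rw [if_pos hi, C.s_comp_lt hk hi h]

theorem t_comp_any {n : ℕ} (C : NCat.{u} n) {k : ℕ} {x y : C.X} (hk : k < n)
    (h : C.t k x = C.s k y) (i : ℕ) :
    C.t i (C.comp k x y) = if k < i then C.comp k (C.t i x) (C.t i y) else C.t i y := by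
  rcases lt_trichotomy i k with hi | rfl | hi
  · rw [if_neg (by omega), ← C.t_t_lt (C.comp k x y) hi, C.t_comp hk h, C.t_t_lt _ hi]
  · rw [if_neg (by omega), C.t_comp hk h]
  · rw [if_pos hi, C.t_comp_lt hk hi h]

/-! ### Cellular extensions and quotients -/

/-- A cellular extension of an `n`-category `C`: a set `G` with a map to the set of `n`-spheres of
`C`, that is, of pairs of parallel `n`-cells (for `n = 0`, any two `0`-cells are parallel). -/
structure CellExt {n : ℕ} (C : NCat.{u} n) : Type (u + 1) where
  G : Type u
  src : G → C.X
  tgt : G → C.X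
  s_eq : ∀ (γ : G) {i : ℕ}, i < n → C.s i (src γ) = C.s i (tgt γ)
  t_eq : ∀ (γ : G) {i : ℕ}, i < n → C.t i (src γ) = C.t i (tgt γ)

/-- The congruence on the `n`-cells of `C` generated by the spheres of a cellular extension. -/
inductive CellExt.Cong {n : ℕ} {C : NCat.{u} n} (E : CellExt C) : C.X → C.X → Prop
  | of (γ : E.G) : E.Cong (E.src γ) (E.tgt γ)
  | refl (x : C.X) : E.Cong x x
  | symm {x y : C.X} : E.Cong x y → E.Cong y x
  | trans {x y z : C.X} : E.Cong x y → E.Cong y z → E.Cong x z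
  | comp {i : ℕ} {x y x' y' : C.X} : i < n → C.t i x = C.s i y → C.t i x' = C.s i y' →
      E.Cong x x' → E.Cong y y' → E.Cong (C.comp i x y) (C.comp i x' y')

theorem CellExt.Cong.bdry {n : ℕ} {C : NCat.{u} n} {E : CellExt C} {x y : C.X} (h : E.Cong x y) :
    ∀ i < n, C.s i x = C.s i y ∧ C.t i x = C.t i y := by
  induction h with
  | of γ => exact fun i hi => ⟨E.s_eq γ hi, E.t_eq γ hi⟩
  | refl x => exact fun i hi => ⟨rfl, rfl⟩
  | symm _ ih => exact fun i hi => ⟨(ih i hi).1.symm, (ih i hi).2.symm⟩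
  | trans _ _ ih ih' =>
    exact fun i hi => ⟨(ih i hi).1.trans (ih' i hi).1, (ih i hi).2.trans (ih' i hi).2⟩
  | @comp j x y x' y' hj h h' _ _ ih ih' =>
    intro i hi
    rcases lt_trichotomy i j with hij | rfl | hij
    · rw [← C.s_s_lt (C.comp j x y) hij, ← C.s_s_lt (C.comp j x' y') hij, C.s_comp hj h,
        C.s_comp hj h', (ih j hj).1, ← C.t_t_lt (C.comp j x y) hij,
        ← C.t_t_lt (C.comp j x' y') hij, C.t_comp hj h, C.t_comp hj h', (ih' j hj).2]
      exact ⟨rfl, rfl⟩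
    · rw [C.s_comp hj h, C.s_comp hj h', C.t_comp hj h, C.t_comp hj h']
      exact ⟨(ih i hi).1, (ih' i hi).2⟩
    · rw [C.s_comp_lt hj hij h, C.s_comp_lt hj hij h', C.t_comp_lt hj hij h,
        C.t_comp_lt hj hij h', (ih i hi).1, (ih i hi).2, (ih' i hi).1, (ih' i hi).2]
      exact ⟨rfl, rfl⟩

theorem CellExt.Cong.s {n : ℕ} {C : NCat.{u} n} {E : CellExt C} {x y : C.X} (h : E.Cong x y)
    (i : ℕ) : E.Cong (C.s i x) (C.s i y) := by
  by_cases hi : i < n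
  · rw [(h.bdry i hi).1]; exact .refl _
  · rwa [C.s_top x (by omega), C.s_top y (by omega)]

theorem CellExt.Cong.t {n : ℕ} {C : NCat.{u} n} {E : CellExt C} {x y : C.X} (h : E.Cong x y)
    (i : ℕ) : E.Cong (C.t i x) (C.t i y) := by
  by_cases hi : i < n
  · rw [(h.bdry i hi).2]; exact .refl _
  · rwa [C.t_top x (by omega), C.t_top y (by omega)]

/-- Cells that are composable up to the congruence are composable. -/
theorem CellExt.Cong.composable {n : ℕ} {C : NCat.{u} n} {E : CellExt C} {i : ℕ} {x y : C.X}
    (hi : i < n) (h : E.Cong (C.t i x) (C.s i y)) : C.t i x = C.s i y := by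
  have := (h.bdry i hi).1
  rwa [C.s_t_le _ le_rfl, C.s_s_le _ le_rfl] at this

/-- The congruence generated by a cellular extension, as a setoid. -/
def CellExt.setoid {n : ℕ} {C : NCat.{u} n} (E : CellExt C) : Setoid C.X :=
  ⟨E.Cong, .refl, .symm, .trans⟩

section quotient

variable {n : ℕ} {C : NCat.{u} n} (E : CellExt C)

/-- The composition of classes, computed on representatives. -/
noncomputable def quotComp (i : ℕ) (a b : Quotient E.setoid) : Quotient E.setoid :=
  Quotient.mk E.setoid (C.comp i a.out b.out)

theorem quot_composable {i : ℕ} (hi : i < n) {x y : C.X}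
    (h : Quotient.mk E.setoid (C.t i x) = Quotient.mk E.setoid (C.s i y)) :
    C.t i x = C.s i y :=
  CellExt.Cong.composable hi (Quotient.exact h)

theorem quotComp_mk {i : ℕ} (hi : i < n) {x y : C.X} (h : C.t i x = C.s i y) :
    quotComp E i (Quotient.mk E.setoid x) (Quotient.mk E.setoid y) =
      Quotient.mk E.setoid (C.comp i x y) := by
  have hx : E.Cong (Quotient.mk E.setoid x).out x := Quotient.mk_out (s := E.setoid) x
  have hy : E.Cong (Quotient.mk E.setoid y).out y := Quotient.mk_out (s := E.setoid) y
  refine Quotient.sound (CellExt.Cong.comp hi ?_ h hx hy)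
  rw [(hx.bdry i hi).2, (hy.bdry i hi).1, h]

/-- The quotient `C / E` of an `n`-category `C` by a cellular extension `E`: the `n`-category
obtained from `C` by identifying the source and the target of every sphere of `E`. -/
noncomputable def quot : NCat.{u} n where
  X := Quotient E.setoid
  s i := Quotient.map (C.s i) (fun _ _ h => CellExt.Cong.s h i)
  t i := Quotient.map (C.t i) (fun _ _ h => CellExt.Cong.t h i)
  comp := quotComp E
  s_s_lt a h := Quotient.inductionOn a fun x => congrArg (Quotient.mk _) (C.s_s_lt x h)
  s_t_lt a h := Quotient.inductionOn a fun x => congrArg (Quotient.mk _) (C.s_t_lt x h)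
  t_s_lt a h := Quotient.inductionOn a fun x => congrArg (Quotient.mk _) (C.t_s_lt x h)
  t_t_lt a h := Quotient.inductionOn a fun x => congrArg (Quotient.mk _) (C.t_t_lt x h)
  s_s_le a h := Quotient.inductionOn a fun x => congrArg (Quotient.mk _) (C.s_s_le x h)
  s_t_le a h := Quotient.inductionOn a fun x => congrArg (Quotient.mk _) (C.s_t_le x h)
  t_s_le a h := Quotient.inductionOn a fun x => congrArg (Quotient.mk _) (C.t_s_le x h)
  t_t_le a h := Quotient.inductionOn a fun x => congrArg (Quotient.mk _) (C.t_t_le x h)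
  s_top a h := Quotient.inductionOn a fun x => congrArg (Quotient.mk _) (C.s_top x h)
  t_top a h := Quotient.inductionOn a fun x => congrArg (Quotient.mk _) (C.t_top x h)
  s_comp {i a b} hi := Quotient.inductionOn₂ a b fun x y h => by
    have h := quot_composable E hi h
    rw [quotComp_mk E hi h]; exact congrArg (Quotient.mk _) (C.s_comp hi h)
  t_comp {i a b} hi := Quotient.inductionOn₂ a b fun x y h => by
    have h := quot_composable E hi h
    rw [quotComp_mk E hi h]; exact congrArg (Quotient.mk _) (C.t_comp hi h)
  s_comp_lt {i j a b} hi hij := Quotient.inductionOn₂ a b fun x y h => by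
    have h := quot_composable E hi h
    rw [quotComp_mk E hi h]
    refine (congrArg (Quotient.mk _) (C.s_comp_lt hi hij h)).trans (quotComp_mk E hi ?_).symm
    rw [C.t_s_lt _ hij, C.s_s_lt _ hij, h]
  t_comp_lt {i j a b} hi hij := Quotient.inductionOn₂ a b fun x y h => by
    have h := quot_composable E hi h
    rw [quotComp_mk E hi h]
    refine (congrArg (Quotient.mk _) (C.t_comp_lt hi hij h)).trans (quotComp_mk E hi ?_).symm
    rw [C.t_t_lt _ hij, C.s_t_lt _ hij, h]
  id_comp {i} a hi := Quotient.inductionOn a fun x =>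
    (quotComp_mk E hi (C.t_s_le _ le_rfl)).trans (congrArg (Quotient.mk _) (C.id_comp x hi))
  comp_id {i} a hi := Quotient.inductionOn a fun x =>
    (quotComp_mk E hi (C.s_t_le _ le_rfl).symm).trans (congrArg (Quotient.mk _) (C.comp_id x hi))
  assoc {i a b c} hi := Quotient.inductionOn₃ a b c fun x y z h h' => by
    have h := quot_composable E hi h
    have h' := quot_composable E hi h'
    rw [quotComp_mk E hi h, quotComp_mk E hi h', quotComp_mk E hi, quotComp_mk E hi,
      C.assoc hi h h']
    · rw [C.s_comp hi h', h]
    · rw [C.t_comp hi h, h']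
  exchange {i j a b c d} hij hj := by
    have hi := hij.trans hj
    refine Quotient.inductionOn₂ a b fun x y => Quotient.inductionOn₂ c d fun z w h h' h'' => ?_
    have h := quot_composable E hj h
    have h' := quot_composable E hj h'
    have h'' := quot_composable E hi h''
    have h3 : C.t i y = C.s i w := by
      rw [← C.t_s_lt y hij, ← C.s_s_lt w hij, ← h, ← h', C.t_t_lt _ hij, C.s_t_lt _ hij, h'']
    rw [quotComp_mk E hj h, quotComp_mk E hj h', quotComp_mk E hi h'', quotComp_mk E hi h3,
      quotComp_mk E hi, quotComp_mk E hj, C.exchange hij hj h h' h'']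
    · rw [C.t_comp_lt hi hij h'', C.s_comp_lt hi hij h3, h, h']
    · rw [← C.t_t_lt _ hij, C.t_comp hj h, ← C.s_s_lt (C.comp j z w) hij, C.s_comp hj h',
        C.t_t_lt _ hij, C.s_s_lt _ hij, ← h'', ← C.t_s_lt y hij, ← h, C.t_t_lt _ hij]

/-- The projection of `C` onto `C / E`. -/
def quotMk (x : C.X) : (quot E).X := Quotient.mk E.setoid x

end quotient

/-! ### Freely adjoining cells of top dimension -/

/-- A family `G` of formal `n`-cells to be adjoined to an `n`-category `C`, given with their
`i`-sources `bs i` and `i`-targets `bt i` in `C` for `i < n`, subject to the globular relations.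
(The values for `i ≥ n` play no role.) -/
structure Bdry {n : ℕ} (C : NCat.{u} n) : Type (u + 1) where
  G : Type u
  bs : ℕ → G → C.X
  bt : ℕ → G → C.X
  s_bs_lt : ∀ {i j : ℕ} (γ : G), i < j → j < n → C.s i (bs j γ) = bs i γ
  s_bt_lt : ∀ {i j : ℕ} (γ : G), i < j → j < n → C.s i (bt j γ) = bs i γ
  t_bs_lt : ∀ {i j : ℕ} (γ : G), i < j → j < n → C.t i (bs j γ) = bt i γ
  t_bt_lt : ∀ {i j : ℕ} (γ : G), i < j → j < n → C.t i (bt j γ) = bt i γ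
  s_bs_le : ∀ {i j : ℕ} (γ : G), j ≤ i → j < n → C.s i (bs j γ) = bs j γ
  s_bt_le : ∀ {i j : ℕ} (γ : G), j ≤ i → j < n → C.s i (bt j γ) = bt j γ
  t_bs_le : ∀ {i j : ℕ} (γ : G), j ≤ i → j < n → C.t i (bs j γ) = bs j γ
  t_bt_le : ∀ {i j : ℕ} (γ : G), j ≤ i → j < n → C.t i (bt j γ) = bt j γ

/-- Formal composites of cells (elements of `A`) and generators (elements of `G`). -/
inductive Raw (A : Type u) (G : Type v) : Type (max u v)
  | cell (x : A) : Raw A G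
  | gen (γ : G) : Raw A G
  | comp (i : ℕ) (a b : Raw A G) : Raw A G

/-- Evaluation of a formal composite, given values for the cells and the generators. -/
def Raw.eval {n : ℕ} (D : NCat.{u} n) {A : Type*} {G : Type*} (φ : A → D.X) (ψ : G → D.X) :
    Raw A G → D.X
  | .cell x => φ x
  | .gen γ => ψ γ
  | .comp i a b => D.comp i (a.eval D φ ψ) (b.eval D φ ψ)

/-- Substitution of formal composites for the generators. -/
def Raw.bind {A : Type*} {G H : Type*} (ψ : G → Raw A H) : Raw A G → Raw A H
  | .cell x => .cell x
  | .gen γ => ψ γ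
  | .comp i a b => .comp i (a.bind ψ) (b.bind ψ)

/-- The number of occurrences of generators in a formal composite. -/
def Raw.count {A : Type*} {G : Type*} : Raw A G → ℕ
  | .cell _ => 0
  | .gen _ => 1
  | .comp _ a b => a.count + b.count

theorem Raw.eval_bind {n : ℕ} (D : NCat.{u} n) {A G H : Type*} (φ : A → D.X) (ψ : H → D.X)
    (θ : G → Raw A H) (a : Raw A G) :
    (a.bind θ).eval D φ ψ = a.eval D φ (fun γ => (θ γ).eval D φ ψ) := by
  induction a with
  | cell x => rfl
  | gen γ => rfl
  | comp i a b iha ihb => simp only [Raw.bind, Raw.eval, iha, ihb]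

namespace Bdry

variable {n : ℕ} {C : NCat.{u} n} (B : Bdry C)

/-- The `i`-source of a formal composite (for `i < n`). -/
def rs (i : ℕ) : Raw C.X B.G → C.X
  | .cell x => C.s i x
  | .gen γ => B.bs i γ
  | .comp j a b => if j < i then C.comp j (rs i a) (rs i b) else rs i a

/-- The `i`-target of a formal composite (for `i < n`). -/
def rt (i : ℕ) : Raw C.X B.G → C.X
  | .cell x => C.t i x
  | .gen γ => B.bt i γ
  | .comp j a b => if j < i then C.comp j (rt i a) (rt i b) else rt i b

/-- A formal composite is well formed when all its compositions are between composable cells. -/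
def WF : Raw C.X B.G → Prop
  | .cell _ => True
  | .gen _ => True
  | .comp i a b => WF a ∧ WF b ∧ i < n ∧ B.rt i a = B.rs i b

/-- Equality of well-formed composites in the free `n`-category: the congruence generated by the
compositions of `C` and by the axioms of `n`-categories. -/
inductive Rel : Raw C.X B.G → Raw C.X B.G → Prop
  | refl {a} : B.WF a → Rel a a
  | symm {a b} : Rel a b → Rel b a
  | trans {a b c} : Rel a b → Rel b c → Rel a c
  | congr {i a b a' b'} : B.WF (.comp i a b) → Rel a a' → Rel b b' →
      Rel (.comp i a b) (.comp i a' b')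
  | cell {i x y} : i < n → C.t i x = C.s i y →
      Rel (.comp i (.cell x) (.cell y)) (.cell (C.comp i x y))
  | id_comp {i a} : i < n → B.WF a → Rel (.comp i (.cell (B.rs i a)) a) a
  | comp_id {i a} : i < n → B.WF a → Rel (.comp i a (.cell (B.rt i a))) a
  | assoc {i a b c} : B.WF (.comp i (.comp i a b) c) →
      Rel (.comp i (.comp i a b) c) (.comp i a (.comp i b c))
  | exchange {i j a b c d} : i < j → B.WF (.comp i (.comp j a b) (.comp j c d)) →
      Rel (.comp i (.comp j a b) (.comp j c d)) (.comp j (.comp i a c) (.comp i b d))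

/-- The globular relations, for well-formed composites. -/
structure Glob (a : Raw C.X B.G) : Prop where
  s_rs_lt : ∀ {i j : ℕ}, i < j → j < n → C.s i (B.rs j a) = B.rs i a
  s_rt_lt : ∀ {i j : ℕ}, i < j → j < n → C.s i (B.rt j a) = B.rs i a
  t_rs_lt : ∀ {i j : ℕ}, i < j → j < n → C.t i (B.rs j a) = B.rt i a
  t_rt_lt : ∀ {i j : ℕ}, i < j → j < n → C.t i (B.rt j a) = B.rt i a
  s_rs_le : ∀ {i j : ℕ}, j ≤ i → j < n → C.s i (B.rs j a) = B.rs j a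
  s_rt_le : ∀ {i j : ℕ}, j ≤ i → j < n → C.s i (B.rt j a) = B.rt j a
  t_rs_le : ∀ {i j : ℕ}, j ≤ i → j < n → C.t i (B.rs j a) = B.rs j a
  t_rt_le : ∀ {i j : ℕ}, j ≤ i → j < n → C.t i (B.rt j a) = B.rt j a

theorem glob {a : Raw C.X B.G} (ha : B.WF a) : B.Glob a := by
  induction a with
  | cell x =>
    exact ⟨fun h _ => C.s_s_lt x h, fun h _ => C.s_t_lt x h, fun h _ => C.t_s_lt x h,
      fun h _ => C.t_t_lt x h, fun h _ => C.s_s_le x h, fun h _ => C.s_t_le x h,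
      fun h _ => C.t_s_le x h, fun h _ => C.t_t_le x h⟩
  | gen γ =>
    exact ⟨B.s_bs_lt γ, B.s_bt_lt γ, B.t_bs_lt γ, B.t_bt_lt γ, B.s_bs_le γ, B.s_bt_le γ,
      B.t_bs_le γ, B.t_bt_le γ⟩
  | comp k a b iha ihb =>
    obtain ⟨wa, wb, hk, h⟩ := ha
    have ga := iha wa
    have gb := ihb wb
    have hs : ∀ {j}, k < j → j < n → C.t k (B.rs j a) = C.s k (B.rs j b) := fun h1 h2 => by
      rw [ga.t_rs_lt h1 h2, gb.s_rs_lt h1 h2, h]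
    have ht : ∀ {j}, k < j → j < n → C.t k (B.rt j a) = C.s k (B.rt j b) := fun h1 h2 => by
      rw [ga.t_rt_lt h1 h2, gb.s_rt_lt h1 h2, h]
    have es : ∀ {i}, i < k → B.rs i a = B.rs i b := fun h1 => by
      rw [← gb.s_rs_lt h1 hk, ← h, ga.s_rt_lt h1 hk]
    have et : ∀ {i}, i < k → B.rt i a = B.rt i b := fun h1 => by
      rw [← gb.t_rs_lt h1 hk, ← h, ga.t_rt_lt h1 hk]
    constructor <;> intro i j hij hj <;> simp only [rs, rt] <;> by_cases hkj : k < j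
    · rw [if_pos hkj, C.s_comp_any hk (hs hkj hj), ga.s_rs_lt hij hj, gb.s_rs_lt hij hj]
    · rw [if_neg hkj, if_neg (by omega), ga.s_rs_lt hij hj]
    · rw [if_pos hkj, C.s_comp_any hk (ht hkj hj), ga.s_rt_lt hij hj, gb.s_rt_lt hij hj]
    · rw [if_neg hkj, if_neg (by omega), gb.s_rt_lt hij hj, es (by omega)]
    · rw [if_pos hkj, C.t_comp_any hk (hs hkj hj), ga.t_rs_lt hij hj, gb.t_rs_lt hij hj]
    · rw [if_neg hkj, if_neg (by omega), ga.t_rs_lt hij hj, et (by omega)]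
    · rw [if_pos hkj, C.t_comp_any hk (ht hkj hj), ga.t_rt_lt hij hj, gb.t_rt_lt hij hj]
    · rw [if_neg hkj, if_neg (by omega), gb.t_rt_lt hij hj]
    · rw [if_pos hkj, C.s_comp_any hk (hs hkj hj), if_pos (by omega), ga.s_rs_le hij hj,
        gb.s_rs_le hij hj]
    · rw [if_neg hkj, ga.s_rs_le hij hj]
    · rw [if_pos hkj, C.s_comp_any hk (ht hkj hj), if_pos (by omega), ga.s_rt_le hij hj,
        gb.s_rt_le hij hj]
    · rw [if_neg hkj, gb.s_rt_le hij hj]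
    · rw [if_pos hkj, C.t_comp_any hk (hs hkj hj), if_pos (by omega), ga.t_rs_le hij hj,
        gb.t_rs_le hij hj]
    · rw [if_neg hkj, ga.t_rs_le hij hj]
    · rw [if_pos hkj, C.t_comp_any hk (ht hkj hj), if_pos (by omega), ga.t_rt_le hij hj,
        gb.t_rt_le hij hj]
    · rw [if_neg hkj, gb.t_rt_le hij hj]

/-- Composability can be transported along equalities of boundaries. -/
theorem rs_eq_of_comp {i k : ℕ} {a b : Raw C.X B.G} (h : B.WF (.comp k a b)) (hi : i < k) :
    B.rs i a = B.rs i b := by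
  obtain ⟨wa, wb, hk, h⟩ := h
  rw [← (B.glob wb).s_rs_lt hi hk, ← h, (B.glob wa).s_rt_lt hi hk]

theorem rt_eq_of_comp {i k : ℕ} {a b : Raw C.X B.G} (h : B.WF (.comp k a b)) (hi : i < k) :
    B.rt i a = B.rt i b := by
  obtain ⟨wa, wb, hk, h⟩ := h
  rw [← (B.glob wb).t_rs_lt hi hk, ← h, (B.glob wa).t_rt_lt hi hk]

theorem Rel.spec {a b : Raw C.X B.G} (h : B.Rel a b) :
    B.WF a ∧ B.WF b ∧ ∀ i < n, B.rs i a = B.rs i b ∧ B.rt i a = B.rt i b := by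
  induction h with
  | refl h => exact ⟨h, h, fun i hi => ⟨rfl, rfl⟩⟩
  | symm _ ih => exact ⟨ih.2.1, ih.1, fun i hi => ⟨(ih.2.2 i hi).1.symm, (ih.2.2 i hi).2.symm⟩⟩
  | trans _ _ ih ih' =>
    exact ⟨ih.1, ih'.2.1, fun i hi => ⟨(ih.2.2 i hi).1.trans (ih'.2.2 i hi).1,
      (ih.2.2 i hi).2.trans (ih'.2.2 i hi).2⟩⟩
  | @congr k a b a' b' h _ _ ih ih' =>
    have hk := h.2.2.1
    refine ⟨h, ⟨ih.2.1, ih'.2.1, hk, ?_⟩, fun i hi => ?_⟩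
    · rw [← (ih.2.2 k hk).2, ← (ih'.2.2 k hk).1, h.2.2.2]
    · simp only [rs, rt, (ih.2.2 i hi).1, (ih.2.2 i hi).2, (ih'.2.2 i hi).1, (ih'.2.2 i hi).2]
      exact ⟨trivial, trivial⟩
  | @cell k x y hk h =>
    exact ⟨⟨trivial, trivial, hk, h⟩, trivial, fun i hi =>
      ⟨(C.s_comp_any hk h i).symm, (C.t_comp_any hk h i).symm⟩⟩
  | @id_comp k a hk wa =>
    have ga := B.glob wa
    refine ⟨⟨trivial, wa, hk, ga.t_rs_le le_rfl hk⟩, wa, fun i hi => ?_⟩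
    simp only [rs, rt]
    by_cases hki : k < i
    · simp only [if_pos hki, ga.s_rs_le hki.le hk, ga.t_rs_le hki.le hk]
      constructor
      · rw [← ga.s_rs_lt hki hi]; exact C.id_comp _ hk
      · rw [← ga.s_rt_lt hki hi]; exact C.id_comp _ hk
    · simp only [if_neg hki, and_true]
      rcases (not_lt.1 hki).lt_or_eq with h | rfl
      · exact ga.s_rs_lt h hk
      · exact ga.s_rs_le le_rfl hk
  | @comp_id k a hk wa =>
    have ga := B.glob wa
    refine ⟨⟨wa, trivial, hk, (ga.s_rt_le le_rfl hk).symm⟩, wa, fun i hi => ?_⟩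
    simp only [rs, rt]
    by_cases hki : k < i
    · simp only [if_pos hki, ga.s_rt_le hki.le hk, ga.t_rt_le hki.le hk]
      constructor
      · rw [← ga.t_rs_lt hki hi]; exact C.comp_id _ hk
      · rw [← ga.t_rt_lt hki hi]; exact C.comp_id _ hk
    · simp only [if_neg hki, true_and]
      rcases (not_lt.1 hki).lt_or_eq with h | rfl
      · exact ga.t_rt_lt h hk
      · exact ga.t_rt_le le_rfl hk
  | @assoc k a b c h =>
    obtain ⟨⟨wa, wb, hk, h1⟩, wc, -, h2⟩ := h
    simp only [rt, lt_irrefl, if_false] at h2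
    have ga := B.glob wa
    have gb := B.glob wb
    have gc := B.glob wc
    refine ⟨⟨⟨wa, wb, hk, h1⟩, wc, hk, by simpa [rt] using h2⟩,
      ⟨wa, ⟨wb, wc, hk, h2⟩, hk, by simpa [rs] using h1⟩, fun i hi => ?_⟩
    simp only [rs, rt]
    by_cases hki : k < i
    · simp only [if_pos hki]
      constructor
      · exact C.assoc hk (by rw [ga.t_rs_lt hki hi, gb.s_rs_lt hki hi, h1])
          (by rw [gb.t_rs_lt hki hi, gc.s_rs_lt hki hi, h2])
      · exact C.assoc hk (by rw [ga.t_rt_lt hki hi, gb.s_rt_lt hki hi, h1])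
          (by rw [gb.t_rt_lt hki hi, gc.s_rt_lt hki hi, h2])
    · simp only [if_neg hki, and_self]
  | @exchange k j a b c d hkj h =>
    have hw := h
    obtain ⟨⟨wa, wb, hj, h1⟩, ⟨wc, wd, -, h2⟩, hk, h3⟩ := h
    have ga := B.glob wa
    have gb := B.glob wb
    have gc := B.glob wc
    have gd := B.glob wd
    have hab : B.rt k a = B.rt k b := B.rt_eq_of_comp ⟨wa, wb, hj, h1⟩ hkj
    have hcd : B.rs k c = B.rs k d := B.rs_eq_of_comp ⟨wc, wd, hj, h2⟩ hkj
    have hkj' : ¬ j < k := by omega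
    simp only [rt, rs, if_neg hkj'] at h3
    have hac : B.rt k a = B.rs k c := by rw [hab, h3]
    have hbd : B.rt k b = B.rs k d := by rw [h3, hcd]
    refine ⟨hw, ⟨⟨wa, wc, hk, hac⟩, ⟨wb, wd, hk, hbd⟩, hj, ?_⟩, fun i hi => ?_⟩
    · simp only [rt, rs, if_pos hkj, h1, h2]
    simp only [rs, rt]
    by_cases hji : j < i
    · have hki : k < i := by omega
      simp only [if_pos hki, if_pos hji]
      constructor
      · exact C.exchange hkj hj (by rw [ga.t_rs_lt hji hi, gb.s_rs_lt hji hi, h1])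
          (by rw [gc.t_rs_lt hji hi, gd.s_rs_lt hji hi, h2])
          (by rw [ga.t_rs_lt hki hi, gc.s_rs_lt hki hi, hac])
      · exact C.exchange hkj hj (by rw [ga.t_rt_lt hji hi, gb.s_rt_lt hji hi, h1])
          (by rw [gc.t_rt_lt hji hi, gd.s_rt_lt hji hi, h2])
          (by rw [ga.t_rt_lt hki hi, gc.s_rt_lt hki hi, hac])
    · simp only [if_neg hji, and_self]

/-- The well-formed formal composites, up to equality. -/
def setoid : Setoid {a : Raw C.X B.G // B.WF a} where
  r a b := B.Rel a.1 b.1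
  iseqv := ⟨fun a => .refl a.2, .symm, .trans⟩

/-- The set of `n`-cells of the `n`-category freely obtained from `C` by adjoining `B`. -/
def Free : Type u := Quotient B.setoid

theorem wf_cell (x : C.X) : B.WF (.cell x) := trivial

theorem wf_gen (γ : B.G) : B.WF (.gen γ) := trivial

/-- The `n`-cell given by a well-formed formal composite. -/
def cls (a : Raw C.X B.G) (h : B.WF a) : B.Free := Quotient.mk B.setoid ⟨a, h⟩

variable {B}

theorem cls_eq_iff {a b : Raw C.X B.G} {ha : B.WF a} {hb : B.WF b} :
    B.cls a ha = B.cls b hb ↔ B.Rel a b :=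
  ⟨fun h => Quotient.exact h, fun h => Quotient.sound (s := B.setoid) (show B.setoid.r _ _ from h)⟩

@[elab_as_elim]
theorem ind {p : B.Free → Prop} (h : ∀ a ha, p (B.cls a ha)) (x : B.Free) : p x :=
  Quotient.inductionOn x fun a => h a.1 a.2

variable (B)

/-- A formal composite that represents a given `n`-cell. -/
noncomputable def rep (x : B.Free) : Raw C.X B.G := (Quotient.out x).1

theorem rep_wf (x : B.Free) : B.WF (B.rep x) := (Quotient.out x).2

theorem cls_rep (x : B.Free) : B.cls (B.rep x) (B.rep_wf x) = x := Quotient.out_eq x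

theorem rep_rel {a : Raw C.X B.G} (h : B.WF a) : B.Rel (B.rep (B.cls a h)) a :=
  cls_eq_iff.1 (B.cls_rep (B.cls a h))

/-- The `i`-source of an `n`-cell of the free `n`-category. -/
noncomputable def freeS (i : ℕ) (x : B.Free) : B.Free :=
  if i < n then B.cls (.cell (B.rs i (B.rep x))) (B.wf_cell _) else x

/-- The `i`-target of an `n`-cell of the free `n`-category. -/
noncomputable def freeT (i : ℕ) (x : B.Free) : B.Free :=
  if i < n then B.cls (.cell (B.rt i (B.rep x))) (B.wf_cell _) else x

open Classical in
/-- The composition of `n`-cells of the free `n`-category. -/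
noncomputable def freeComp (i : ℕ) (x y : B.Free) : B.Free :=
  if h : B.WF (.comp i (B.rep x) (B.rep y)) then B.cls _ h else x

theorem freeS_mk {i : ℕ} {a : Raw C.X B.G} (h : B.WF a) :
    B.freeS i (B.cls a h) = if i < n then B.cls (.cell (B.rs i a)) (B.wf_cell _) else B.cls a h := by
  unfold freeS
  by_cases hi : i < n
  · simp only [if_pos hi, ((B.rep_rel h).spec.2.2 i hi).1]
  · simp only [if_neg hi]

theorem freeT_mk {i : ℕ} {a : Raw C.X B.G} (h : B.WF a) :
    B.freeT i (B.cls a h) = if i < n then B.cls (.cell (B.rt i a)) (B.wf_cell _) else B.cls a h := by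
  unfold freeT
  by_cases hi : i < n
  · simp only [if_pos hi, ((B.rep_rel h).spec.2.2 i hi).2]
  · simp only [if_neg hi]

theorem freeComp_mk {i : ℕ} {a b : Raw C.X B.G} (h : B.WF (.comp i a b)) :
    B.freeComp i (B.cls a h.1) (B.cls b h.2.1) = B.cls (.comp i a b) h := by
  have r := Rel.congr h (B.rep_rel h.1).symm (B.rep_rel h.2.1).symm
  unfold freeComp
  rw [dif_pos r.spec.2.1]
  exact cls_eq_iff.2 r.symm

theorem free_composable {i : ℕ} (hi : i < n) {a b : Raw C.X B.G} {ha : B.WF a} {hb : B.WF b}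
    (h : B.freeT i (B.cls a ha) = B.freeS i (B.cls b hb)) : B.WF (.comp i a b) := by
  rw [freeT_mk, freeS_mk, if_pos hi, if_pos hi, cls_eq_iff] at h
  have := (h.spec.2.2 i hi).1
  simp only [rs] at this
  rw [(B.glob ha).s_rt_le le_rfl hi, (B.glob hb).s_rs_le le_rfl hi] at this
  exact ⟨ha, hb, hi, this⟩

theorem wf_congr {i : ℕ} {a b a' b' : Raw C.X B.G} (h : B.WF (.comp i a b)) (ha : B.Rel a a')
    (hb : B.Rel b b') : B.WF (.comp i a' b') :=
  (Rel.congr h ha hb).spec.2.1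

end Bdry

/-- The `n`-category obtained from `C` by freely adjoining the `n`-cells of `B`. -/
noncomputable def adjoin {n : ℕ} (C : NCat.{u} n) (B : Bdry C) : NCat.{u} n where
  X := B.Free
  s := B.freeS
  t := B.freeT
  comp := B.freeComp
  s_s_lt {i j} x h := by
    induction x using Bdry.ind with | _ a ha
    by_cases hj : j < n
    · have hi := h.trans hj
      simp only [Bdry.freeS_mk, if_pos hi, if_pos hj, Bdry.rs, (B.glob ha).s_rs_lt h hj]
    · rw [Bdry.freeS_mk, if_neg hj]
  s_t_lt {i j} x h := by
    induction x using Bdry.ind with | _ a ha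
    by_cases hj : j < n
    · have hi := h.trans hj
      simp only [Bdry.freeS_mk, Bdry.freeT_mk, if_pos hi, if_pos hj, Bdry.rs,
        (B.glob ha).s_rt_lt h hj]
    · rw [Bdry.freeT_mk, if_neg hj]
  t_s_lt {i j} x h := by
    induction x using Bdry.ind with | _ a ha
    by_cases hj : j < n
    · have hi := h.trans hj
      simp only [Bdry.freeS_mk, Bdry.freeT_mk, if_pos hi, if_pos hj, Bdry.rt,
        (B.glob ha).t_rs_lt h hj]
    · rw [Bdry.freeS_mk, if_neg hj]
  t_t_lt {i j} x h := by
    induction x using Bdry.ind with | _ a ha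
    by_cases hj : j < n
    · have hi := h.trans hj
      simp only [Bdry.freeT_mk, if_pos hi, if_pos hj, Bdry.rt, (B.glob ha).t_rt_lt h hj]
    · rw [Bdry.freeT_mk, if_neg hj]
  s_s_le {i j} x h := by
    induction x using Bdry.ind with | _ a ha
    by_cases hi : i < n
    · have hj : j < n := by omega
      simp only [Bdry.freeS_mk, if_pos hi, if_pos hj, Bdry.rs, (B.glob ha).s_rs_le h hj]
    · simp only [Bdry.freeS, if_neg hi]
  s_t_le {i j} x h := by
    induction x using Bdry.ind with | _ a ha
    by_cases hi : i < n
    · have hj : j < n := by omega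
      simp only [Bdry.freeS_mk, Bdry.freeT_mk, if_pos hi, if_pos hj, Bdry.rs,
        (B.glob ha).s_rt_le h hj]
    · simp only [Bdry.freeS, if_neg hi]
  t_s_le {i j} x h := by
    induction x using Bdry.ind with | _ a ha
    by_cases hi : i < n
    · have hj : j < n := by omega
      simp only [Bdry.freeS_mk, Bdry.freeT_mk, if_pos hi, if_pos hj, Bdry.rt,
        (B.glob ha).t_rs_le h hj]
    · simp only [Bdry.freeT, if_neg hi]
  t_t_le {i j} x h := by
    induction x using Bdry.ind with | _ a ha
    by_cases hi : i < n
    · have hj : j < n := by omega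
      simp only [Bdry.freeT_mk, if_pos hi, if_pos hj, Bdry.rt, (B.glob ha).t_rt_le h hj]
    · simp only [Bdry.freeT, if_neg hi]
  s_top x h := by simp only [Bdry.freeS, if_neg (not_lt.2 h)]
  t_top x h := by simp only [Bdry.freeT, if_neg (not_lt.2 h)]
  s_comp {i x y} hi := by
    induction x using Bdry.ind with | _ a ha
    induction y using Bdry.ind with | _ b hb
    intro h
    have h := B.free_composable hi h
    rw [B.freeComp_mk h]
    simp only [Bdry.freeS_mk, Bdry.rs, lt_irrefl, if_false]
    simp only [if_pos hi]
  t_comp {i x y} hi := by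
    induction x using Bdry.ind with | _ a ha
    induction y using Bdry.ind with | _ b hb
    intro h
    have h := B.free_composable hi h
    rw [B.freeComp_mk h]
    simp only [Bdry.freeT_mk, Bdry.rt, lt_irrefl, if_false]
    simp only [if_pos hi]
  s_comp_lt {i j x y} hi hij := by
    induction x using Bdry.ind with | _ a ha
    induction y using Bdry.ind with | _ b hb
    intro h
    have h := B.free_composable hi h
    rw [B.freeComp_mk h]
    by_cases hj : j < n
    · have e : C.t i (B.rs j a) = C.s i (B.rs j b) := by
        rw [(B.glob ha).t_rs_lt hij hj, (B.glob hb).s_rs_lt hij hj, h.2.2.2]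
      simp only [Bdry.freeS_mk, Bdry.rs, if_pos hj, if_pos hij]
      refine Eq.trans ?_ (B.freeComp_mk ⟨B.wf_cell (B.rs j a), B.wf_cell (B.rs j b), hi, e⟩).symm
      exact Bdry.cls_eq_iff.2 (Bdry.Rel.cell hi e).symm
    · simp only [Bdry.freeS, if_neg hj, B.freeComp_mk h]
  t_comp_lt {i j x y} hi hij := by
    induction x using Bdry.ind with | _ a ha
    induction y using Bdry.ind with | _ b hb
    intro h
    have h := B.free_composable hi h
    rw [B.freeComp_mk h]
    by_cases hj : j < n
    · have e : C.t i (B.rt j a) = C.s i (B.rt j b) := by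
        rw [(B.glob ha).t_rt_lt hij hj, (B.glob hb).s_rt_lt hij hj, h.2.2.2]
      simp only [Bdry.freeT_mk, Bdry.rt, if_pos hj, if_pos hij]
      refine Eq.trans ?_ (B.freeComp_mk ⟨B.wf_cell (B.rt j a), B.wf_cell (B.rt j b), hi, e⟩).symm
      exact Bdry.cls_eq_iff.2 (Bdry.Rel.cell hi e).symm
    · simp only [Bdry.freeT, if_neg hj, B.freeComp_mk h]
  id_comp {i} x hi := by
    induction x using Bdry.ind with | _ a ha
    have r := Bdry.Rel.id_comp hi ha
    rw [Bdry.freeS_mk, if_pos hi, B.freeComp_mk r.spec.1]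
    exact Bdry.cls_eq_iff.2 r
  comp_id {i} x hi := by
    induction x using Bdry.ind with | _ a ha
    have r := Bdry.Rel.comp_id hi ha
    rw [Bdry.freeT_mk, if_pos hi, B.freeComp_mk r.spec.1]
    exact Bdry.cls_eq_iff.2 r
  assoc {i x y z} hi := by
    induction x using Bdry.ind with | _ a ha
    induction y using Bdry.ind with | _ b hb
    induction z using Bdry.ind with | _ c hc
    intro h h'
    have h := B.free_composable hi h
    have h' := B.free_composable hi h'
    have w : B.WF (.comp i (.comp i a b) c) :=
      ⟨h, hc, hi, by simpa only [Bdry.rt, lt_irrefl, if_false] using h'.2.2.2⟩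
    have r := Bdry.Rel.assoc w
    rw [B.freeComp_mk h, B.freeComp_mk h', B.freeComp_mk w, B.freeComp_mk r.spec.2.1]
    exact Bdry.cls_eq_iff.2 r
  exchange {i j x y z w} hij hj :=
    by
    induction x using Bdry.ind with | _ a ha
    induction y using Bdry.ind with | _ b hb
    induction z using Bdry.ind with | _ c hc
    induction w using Bdry.ind with | _ d hd
    intro h h' h''
    have hi := hij.trans hj
    have h := B.free_composable hj h
    have h' := B.free_composable hj h'
    have h'' := B.free_composable hi h''
    have hji : ¬ j < i := by omega
    have w : B.WF (.comp i (.comp j a b) (.comp j c d)) :=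
      ⟨h, h', hi, by
        simp only [Bdry.rt, Bdry.rs, if_neg hji]
        rw [← B.rt_eq_of_comp h hij, h''.2.2.2]⟩
    have r := Bdry.Rel.exchange hij w
    have w' := r.spec.2.1
    rw [B.freeComp_mk h, B.freeComp_mk h', B.freeComp_mk w, B.freeComp_mk h'',
      B.freeComp_mk w'.2.1, B.freeComp_mk w']
    exact Bdry.cls_eq_iff.2 r

/-- The inclusion of `C` into the `n`-category obtained by adjoining cells. -/
noncomputable def incl {n : ℕ} (C : NCat.{u} n) (B : Bdry C) : NFunctor C (C.adjoin B) where
  map x := B.cls (.cell x) (B.wf_cell x)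
  map_s i x := by
    refine Eq.trans ?_ (B.freeS_mk (B.wf_cell x)).symm
    by_cases hi : i < n
    · rw [if_pos hi]; rfl
    · rw [if_neg hi, C.s_top x (by omega)]
  map_t i x := by
    refine Eq.trans ?_ (B.freeT_mk (B.wf_cell x)).symm
    by_cases hi : i < n
    · rw [if_pos hi]; rfl
    · rw [if_neg hi, C.t_top x (by omega)]
  map_comp {i x y} hi h :=
    (Bdry.cls_eq_iff.2 (Bdry.Rel.cell hi h).symm).trans
      (B.freeComp_mk ⟨B.wf_cell x, B.wf_cell y, hi, h⟩).symm

/-- The generating cells of the `n`-category obtained by adjoining cells to `C`. -/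
def gen {n : ℕ} {C : NCat.{u} n} {B : Bdry C} (γ : B.G) : (C.adjoin B).X :=
  B.cls (.gen γ) (B.wf_gen γ)

section lift

variable {n : ℕ} {C : NCat.{u} n} {B : Bdry C} {D : NCat.{u} n}

theorem eval_bdry (φ : NFunctor C D) (ψ : B.G → D.X)
    (hs : ∀ i < n, ∀ γ, D.s i (ψ γ) = φ.map (B.bs i γ))
    (ht : ∀ i < n, ∀ γ, D.t i (ψ γ) = φ.map (B.bt i γ)) {a : Raw C.X B.G} (ha : B.WF a) :
    ∀ i < n, D.s i (a.eval D φ.map ψ) = φ.map (B.rs i a) ∧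
      D.t i (a.eval D φ.map ψ) = φ.map (B.rt i a) := by
  induction a with
  | cell x => exact fun i _ => ⟨(φ.map_s i x).symm, (φ.map_t i x).symm⟩
  | gen γ => exact fun i hi => ⟨hs i hi γ, ht i hi γ⟩
  | comp k a b iha ihb =>
    obtain ⟨wa, wb, hk, h⟩ := ha
    have e : D.t k (a.eval D φ.map ψ) = D.s k (b.eval D φ.map ψ) := by
      rw [(iha wa k hk).2, (ihb wb k hk).1, h]
    intro i hi
    simp only [Raw.eval, Bdry.rs, Bdry.rt]
    rw [D.s_comp_any hk e, D.t_comp_any hk e]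
    by_cases hki : k < i
    · simp only [if_pos hki]
      rw [(iha wa i hi).1, (iha wa i hi).2, (ihb wb i hi).1, (ihb wb i hi).2, φ.map_comp hk,
        φ.map_comp hk]
      · exact ⟨rfl, rfl⟩
      · rw [(B.glob wa).t_rt_lt hki hi, (B.glob wb).s_rt_lt hki hi, h]
      · rw [(B.glob wa).t_rs_lt hki hi, (B.glob wb).s_rs_lt hki hi, h]
    · simp only [if_neg hki]
      exact ⟨(iha wa i hi).1, (ihb wb i hi).2⟩

theorem eval_composable (φ : NFunctor C D) (ψ : B.G → D.X)
    (hs : ∀ i < n, ∀ γ, D.s i (ψ γ) = φ.map (B.bs i γ))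
    (ht : ∀ i < n, ∀ γ, D.t i (ψ γ) = φ.map (B.bt i γ)) {i : ℕ} {a b : Raw C.X B.G}
    (h : B.WF (.comp i a b)) : D.t i (a.eval D φ.map ψ) = D.s i (b.eval D φ.map ψ) := by
  obtain ⟨wa, wb, hi, h⟩ := h
  rw [(eval_bdry φ ψ hs ht wa i hi).2, (eval_bdry φ ψ hs ht wb i hi).1, h]

theorem eval_rel (φ : NFunctor C D) (ψ : B.G → D.X)
    (hs : ∀ i < n, ∀ γ, D.s i (ψ γ) = φ.map (B.bs i γ))
    (ht : ∀ i < n, ∀ γ, D.t i (ψ γ) = φ.map (B.bt i γ)) {a b : Raw C.X B.G} (h : B.Rel a b) :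
    a.eval D φ.map ψ = b.eval D φ.map ψ := by
  induction h with
  | refl _ => rfl
  | symm _ ih => exact ih.symm
  | trans _ _ ih ih' => exact ih.trans ih'
  | congr _ _ _ ih ih' => simp only [Raw.eval, ih, ih']
  | cell hi h => exact (φ.map_comp hi h).symm
  | id_comp hi h =>
    simp only [Raw.eval]
    rw [← (eval_bdry φ ψ hs ht h _ hi).1, D.id_comp _ hi]
  | comp_id hi h =>
    simp only [Raw.eval]
    rw [← (eval_bdry φ ψ hs ht h _ hi).2, D.comp_id _ hi]
  | assoc h =>
    have h' := (Bdry.Rel.assoc h).spec.2.1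
    exact D.assoc h.2.2.1 (eval_composable φ ψ hs ht h.1) (eval_composable φ ψ hs ht h'.2.1)
  | exchange hij h =>
    have h' := (Bdry.Rel.exchange hij h).spec.2.1
    exact D.exchange hij h.1.2.2.1 (eval_composable φ ψ hs ht h.1)
      (eval_composable φ ψ hs ht h.2.1) (eval_composable φ ψ hs ht h'.1)

/-- The universal property of `C.adjoin B`: an `n`-functor on `C` together with values on the
generators, with the right boundaries, extends to an `n`-functor on `C.adjoin B`. -/
noncomputable def lift (φ : NFunctor C D) (ψ : B.G → D.X)
    (hs : ∀ i < n, ∀ γ, D.s i (ψ γ) = φ.map (B.bs i γ))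
    (ht : ∀ i < n, ∀ γ, D.t i (ψ γ) = φ.map (B.bt i γ)) : NFunctor (C.adjoin B) D where
  map := Quotient.lift (fun a => a.1.eval D φ.map ψ) (fun _ _ h => eval_rel φ ψ hs ht h)
  map_s i x := by
    induction x using Bdry.ind with | _ a ha
    refine (congrArg _ (B.freeS_mk ha)).trans ?_
    by_cases hi : i < n
    · rw [if_pos hi]; exact (eval_bdry φ ψ hs ht ha i hi).1.symm
    · rw [if_neg hi, D.s_top _ (by omega)]
  map_t i x := by
    induction x using Bdry.ind with | _ a ha
    refine (congrArg _ (B.freeT_mk ha)).trans ?_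
    by_cases hi : i < n
    · rw [if_pos hi]; exact (eval_bdry φ ψ hs ht ha i hi).2.symm
    · rw [if_neg hi, D.t_top _ (by omega)]
  map_comp {i x y} hi := by
    induction x using Bdry.ind with | _ a ha
    induction y using Bdry.ind with | _ b hb
    intro h
    have h := B.free_composable hi h
    exact congrArg _ (B.freeComp_mk h)

end lift

/-- The boundary of a cellular extension of an `n`-category `C`, whose elements are seen as
`(n + 1)`-cells. -/
def CellExt.bdry {n : ℕ} {C : NCat.{u} n} (E : CellExt C) : Bdry C.promote where
  G := E.G
  bs i γ := C.s i (E.src γ)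
  bt i γ := C.t i (E.tgt γ)
  s_bs_lt γ h _ := C.s_s_lt _ h
  s_bt_lt γ h hj := (C.s_t_lt _ h).trans (E.s_eq γ (by omega)).symm
  t_bs_lt γ h hj := (C.t_s_lt _ h).trans (E.t_eq γ (by omega))
  t_bt_lt γ h _ := C.t_t_lt _ h
  s_bs_le γ h _ := C.s_s_le _ h
  s_bt_le γ h _ := C.s_t_le _ h
  t_bs_le γ h _ := C.t_s_le _ h
  t_bt_le γ h _ := C.t_t_le _ h

/-- The free `(n + 1)`-category `C[E]` generated by a cellular extension `E` of `C`. -/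
noncomputable def freeExt {n : ℕ} (C : NCat.{u} n) (E : CellExt C) : NCat.{u} (n + 1) :=
  C.promote.adjoin E.bdry

/-- An `n`-cell of `C` (with its identity) in `C[E]`. -/
noncomputable def freeExtCell {n : ℕ} {C : NCat.{u} n} (E : CellExt C) (x : C.X) :
    (C.freeExt E).X :=
  (C.promote.incl E.bdry).map x

/-- A generating `(n + 1)`-cell of `C[E]`. -/
def freeExtGen {n : ℕ} {C : NCat.{u} n} (E : CellExt C) (γ : E.G) : (C.freeExt E).X :=
  gen (C := C.promote) (B := E.bdry) γ

/-! ### Track categories -/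

/-- `g` is inverse to `f` for the composition `⋆ₙ` of an `(n + 1)`-category. -/
structure IsInv {n : ℕ} (T : NCat.{u} (n + 1)) (f g : T.X) : Prop where
  s_eq : T.s n g = T.t n f
  t_eq : T.t n g = T.s n f
  right_inv : T.comp n f g = T.s n f
  left_inv : T.comp n g f = T.t n f

/-- A track `(n + 1)`-category: an `(n + 1)`-category whose `(n + 1)`-cells are invertible. -/
def IsTrack {n : ℕ} (T : NCat.{u} (n + 1)) : Prop :=
  ∀ f : T.X, ∃ g : T.X, T.IsInv f g

theorem IsInv.comp_lt {n : ℕ} {T : NCat.{u} (n + 1)} {f g f' g' : T.X} (h : T.IsInv f g)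
    (h' : T.IsInv f' g') {i : ℕ} (hi : i < n) (c : T.t i f = T.s i f') :
    T.IsInv (T.comp i f f') (T.comp i g g') := by
  have hi' : i < n + 1 := by omega
  have c' : T.t i g = T.s i g' := by
    rw [← T.t_s_lt g hi, ← T.s_s_lt g' hi, h.s_eq, h'.s_eq, T.t_t_lt _ hi, T.s_t_lt _ hi, c]
  constructor
  · rw [T.s_comp_lt hi' hi c', T.t_comp_lt hi' hi c, h.s_eq, h'.s_eq]
  · rw [T.t_comp_lt hi' hi c', T.s_comp_lt hi' hi c, h.t_eq, h'.t_eq]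
  · rw [← T.exchange hi (by omega) h.s_eq.symm h'.s_eq.symm c, h.right_inv, h'.right_inv,
      T.s_comp_lt hi' hi c]
  · rw [← T.exchange hi (by omega) h.t_eq h'.t_eq c', h.left_inv, h'.left_inv,
      T.t_comp_lt hi' hi c]

theorem IsInv.comp_top {n : ℕ} {T : NCat.{u} (n + 1)} {f g f' g' : T.X} (h : T.IsInv f g)
    (h' : T.IsInv f' g') (c : T.t n f = T.s n f') :
    T.IsInv (T.comp n f f') (T.comp n g' g) := by
  have hn : n < n + 1 := by omega
  have c' : T.t n g' = T.s n g := by rw [h'.t_eq, h.s_eq, c]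
  constructor
  · rw [T.s_comp hn c', T.t_comp hn c, h'.s_eq]
  · rw [T.t_comp hn c', T.s_comp hn c, h.t_eq]
  · rw [T.assoc hn c (by rw [T.s_comp hn c', h'.s_eq]), ← T.assoc hn h'.s_eq.symm c',
      h'.right_inv, ← c, ← h.s_eq, T.id_comp _ hn, h.right_inv, T.s_comp hn c]
  · rw [T.assoc hn c' (by rw [T.s_comp hn c, h.t_eq]), ← T.assoc hn h.t_eq c,
      h.left_inv, c, T.id_comp _ hn, h'.left_inv, T.t_comp hn c]

theorem isInv_cell {n : ℕ} (T : NCat.{u} (n + 1)) {x : T.X} (h : T.s n x = x) : T.IsInv x x := by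
  have ht : T.t n x = x := by rw [← h]; exact T.t_s_le _ le_rfl
  have hc : T.comp n x x = x := by
    have := T.id_comp (i := n) x (by omega)
    rwa [h] at this
  exact ⟨h.trans ht.symm, ht.trans h.symm, hc.trans h.symm, hc.trans ht.symm⟩

theorem IsInv.quot {n : ℕ} {T : NCat.{u} (n + 1)} (E : CellExt T) {f g : T.X} (h : T.IsInv f g) :
    (T.quot E).IsInv (quotMk E f) (quotMk E g) :=
  ⟨congrArg (quotMk E) h.s_eq, congrArg (quotMk E) h.t_eq,
    (quotComp_mk E (by omega) h.s_eq.symm).trans (congrArg (quotMk E) h.right_inv),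
    (quotComp_mk E (by omega) h.t_eq).trans (congrArg (quotMk E) h.left_inv)⟩

theorem IsTrack.quot {n : ℕ} {T : NCat.{u} (n + 1)} (h : T.IsTrack) (E : CellExt T) :
    (T.quot E).IsTrack := fun a => Quotient.inductionOn a fun f => by
  obtain ⟨g, hg⟩ := h f
  exact ⟨_, hg.quot E⟩

/-- Induction on the cells of `C.adjoin B`. -/
theorem adjoin_ind {n : ℕ} {C : NCat.{u} n} {B : Bdry C} {p : (C.adjoin B).X → Prop}
    (cell : ∀ x, p ((C.incl B).map x)) (gen : ∀ γ, p (gen γ))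
    (comp : ∀ (i : ℕ) (x y : (C.adjoin B).X), i < n → (C.adjoin B).t i x = (C.adjoin B).s i y →
      p x → p y → p ((C.adjoin B).comp i x y)) (x : (C.adjoin B).X) : p x := by
  induction x using Bdry.ind with | _ a ha
  induction a with
  | cell x => exact cell x
  | gen γ => exact gen γ
  | comp i a b iha ihb =>
    have e : (C.adjoin B).comp i (B.cls a ha.1) (B.cls b ha.2.1) = B.cls (.comp i a b) ha :=
      B.freeComp_mk ha
    rw [← e]
    have hi := ha.2.2.1
    refine comp i _ _ hi ?_ (iha _) (ihb _)
    change B.freeT i _ = B.freeS i _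
    rw [B.freeT_mk, B.freeS_mk, if_pos hi, if_pos hi]
    simp only [ha.2.2.2]

/-- The cellular extension made of `E` and of a copy of `E` with sources and targets reversed. -/
def CellExt.double {n : ℕ} {C : NCat.{u} n} (E : CellExt C) : CellExt C where
  G := E.G ⊕ E.G
  src := Sum.elim E.src E.tgt
  tgt := Sum.elim E.tgt E.src
  s_eq γ _ hi := by
    cases γ with
    | inl γ => exact E.s_eq γ hi
    | inr γ => exact (E.s_eq γ hi).symm
  t_eq γ _ hi := by
    cases γ with
    | inl γ => exact E.t_eq γ hi
    | inr γ => exact (E.t_eq γ hi).symm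

theorem freeExt_s_gen {n : ℕ} {C : NCat.{u} n} (E : CellExt C) (γ : E.G) {i : ℕ} (hi : i < n + 1) :
    (C.freeExt E).s i (freeExtGen E γ) = freeExtCell E (C.s i (E.src γ)) :=
  (E.bdry.freeS_mk (E.bdry.wf_gen γ)).trans (if_pos hi)

theorem freeExt_t_gen {n : ℕ} {C : NCat.{u} n} (E : CellExt C) (γ : E.G) {i : ℕ} (hi : i < n + 1) :
    (C.freeExt E).t i (freeExtGen E γ) = freeExtCell E (C.t i (E.tgt γ)) :=
  (E.bdry.freeT_mk (E.bdry.wf_gen γ)).trans (if_pos hi)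

theorem freeExt_s_cell {n : ℕ} {C : NCat.{u} n} (E : CellExt C) (x : C.X) (i : ℕ) :
    (C.freeExt E).s i (freeExtCell E x) = freeExtCell E (C.s i x) :=
  ((C.promote.incl E.bdry).map_s i x).symm

theorem freeExt_t_cell {n : ℕ} {C : NCat.{u} n} (E : CellExt C) (x : C.X) (i : ℕ) :
    (C.freeExt E).t i (freeExtCell E x) = freeExtCell E (C.t i x) :=
  ((C.promote.incl E.bdry).map_t i x).symm

theorem freeExt_composable {n : ℕ} {C : NCat.{u} n} (E : CellExt C) {γ δ : E.G}
    (h : E.tgt γ = E.src δ) :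
    (C.freeExt E).t n (freeExtGen E γ) = (C.freeExt E).s n (freeExtGen E δ) := by
  rw [freeExt_t_gen E γ (by omega), freeExt_s_gen E δ (by omega), h, C.t_top _ le_rfl,
    C.s_top _ le_rfl]

theorem freeExt_sphere {n : ℕ} {C : NCat.{u} n} (E : CellExt C) {γ δ : E.G} {x : C.X}
    (h : E.tgt γ = E.src δ) (hx : E.src γ = x) (hx' : E.tgt δ = x) {i : ℕ} (hi : i < n + 1) :
    (C.freeExt E).s i ((C.freeExt E).comp n (freeExtGen E γ) (freeExtGen E δ)) =
        (C.freeExt E).s i (freeExtCell E x) ∧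
      (C.freeExt E).t i ((C.freeExt E).comp n (freeExtGen E γ) (freeExtGen E δ)) =
        (C.freeExt E).t i (freeExtCell E x) := by
  have hc := freeExt_composable E h
  rw [(C.freeExt E).s_comp_any (by omega) hc, (C.freeExt E).t_comp_any (by omega) hc,
    if_neg (by omega), if_neg (by omega), freeExt_s_cell, freeExt_t_cell, freeExt_s_gen E γ hi,
    freeExt_t_gen E δ hi, hx, hx']
  exact ⟨rfl, rfl⟩

/-- The spheres `(γ ⋆ₙ γ⁻, 1_{s γ})` (indexed by `Sum.inl γ`) and `(γ⁻ ⋆ₙ γ, 1_{t γ})` (indexed by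
`Sum.inr γ`), for `γ` in `E`. -/
noncomputable def CellExt.inv {n : ℕ} {C : NCat.{u} n} (E : CellExt C) :
    CellExt (C.freeExt E.double) where
  G := E.G ⊕ E.G
  src γ := (C.freeExt E.double).comp n (freeExtGen E.double γ) (freeExtGen E.double γ.swap)
  tgt γ := freeExtCell E.double (E.double.src γ)
  s_eq γ _ hi := (freeExt_sphere E.double (by cases γ <;> rfl) rfl (by cases γ <;> rfl) hi).1
  t_eq γ _ hi := (freeExt_sphere E.double (by cases γ <;> rfl) rfl (by cases γ <;> rfl) hi).2

/-- The track `(n + 1)`-category `C(E)` generated by a cellular extension `E` of an `n`-category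
`C`: the quotient of the free `(n + 1)`-category on `E` and formal inverses by the relations that
make the latter inverse to the elements of `E`. -/
noncomputable def track {n : ℕ} (C : NCat.{u} n) (E : CellExt C) : NCat.{u} (n + 1) :=
  (C.freeExt E.double).quot E.inv

theorem isTrack_track {n : ℕ} (C : NCat.{u} n) (E : CellExt C) : (C.track E).IsTrack := by
  intro a
  induction a using Quotient.inductionOn with | _ x
  change ∃ g, (C.track E).IsInv (quotMk E.inv x) g
  refine adjoin_ind (C := C.promote) (B := E.double.bdry)
    (p := fun x => ∃ g, (C.track E).IsInv (quotMk E.inv x) g) ?_ ?_ ?_ x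
  · intro x
    refine ⟨_, IsInv.quot E.inv (isInv_cell _ ?_)⟩
    refine (freeExt_s_cell E.double x n).trans ?_
    rw [C.s_top x le_rfl]; rfl
  · intro γ
    have key : ∀ γ : E.G ⊕ E.G,
        (C.track E).comp n (quotMk E.inv (freeExtGen E.double γ))
          (quotMk E.inv (freeExtGen E.double γ.swap)) =
        (C.track E).s n (quotMk E.inv (freeExtGen E.double γ)) := by
      intro γ
      refine (quotComp_mk E.inv (by omega) (freeExt_composable E.double
        (by cases γ <;> rfl))).trans ?_
      refine (Quotient.sound (s := E.inv.setoid) (CellExt.Cong.of (E := E.inv) γ)).trans ?_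
      refine congrArg (quotMk E.inv) (Eq.symm ?_)
      refine (freeExt_s_gen E.double γ (by omega)).trans ?_
      rw [C.s_top _ le_rfl]; rfl
    have hst : ∀ γ : E.G ⊕ E.G,
        (C.track E).s n (quotMk E.inv (freeExtGen E.double γ.swap)) =
        (C.track E).t n (quotMk E.inv (freeExtGen E.double γ)) := fun γ =>
      congrArg (quotMk E.inv) (freeExt_composable E.double (by cases γ <;> rfl)).symm
    have hts : ∀ γ : E.G ⊕ E.G,
        (C.track E).t n (quotMk E.inv (freeExtGen E.double γ.swap)) =
        (C.track E).s n (quotMk E.inv (freeExtGen E.double γ)) := fun γ =>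
      congrArg (quotMk E.inv) (freeExt_composable E.double (by cases γ <;> rfl))
    have key' : ∀ γ : E.G ⊕ E.G,
        (C.track E).comp n (quotMk E.inv (freeExtGen E.double γ.swap))
          (quotMk E.inv (freeExtGen E.double γ)) =
        (C.track E).s n (quotMk E.inv (freeExtGen E.double γ.swap)) := fun γ => by
      have := key γ.swap
      rwa [Sum.swap_swap] at this
    exact ⟨quotMk E.inv (freeExtGen E.double γ.swap), hst γ, hts γ, key γ,
      (key' γ).trans (hst γ)⟩
  · rintro i x y hi h ⟨x', hx⟩ ⟨y', hy⟩
    have e : quotMk E.inv ((C.freeExt E.double).comp i x y) =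
        (C.track E).comp i (quotMk E.inv x) (quotMk E.inv y) := (quotComp_mk E.inv hi h).symm
    have h' : (C.track E).t i (quotMk E.inv x) = (C.track E).s i (quotMk E.inv y) :=
      congrArg (quotMk E.inv) h
    change ∃ g, (C.track E).IsInv (quotMk E.inv ((C.freeExt E.double).comp i x y)) g
    rw [e]
    rcases (Nat.lt_succ_iff.1 hi).lt_or_eq with hi | rfl
    · exact ⟨_, hx.comp_lt hy hi h'⟩
    · exact ⟨_, hx.comp_top hy h'⟩

/-- The pairs of closed `(n + 1)`-cells of `T` with the same base point. -/
def ClosedPair {n : ℕ} (T : NCat.{u} (n + 1)) : Type u :=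
  {p : T.X × T.X // T.s n p.1 = T.t n p.1 ∧ T.s n p.2 = T.t n p.2 ∧ T.s n p.1 = T.s n p.2}

/-- The spheres `(f ⋆ₙ g, g ⋆ₙ f)`, for closed `(n + 1)`-cells `f` and `g` with the same base. -/
def commSpheres {n : ℕ} (T : NCat.{u} (n + 1)) : CellExt T where
  G := T.ClosedPair
  src p := T.comp n p.1.1 p.1.2
  tgt p := T.comp n p.1.2 p.1.1
  s_eq := by
    rintro ⟨⟨f, g⟩, hf, hg, h⟩ i hi
    simp only at hf hg h ⊢
    have h1 : T.t n f = T.s n g := by rw [← hf, h]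
    have h2 : T.t n g = T.s n f := by rw [← hg, h]
    rw [T.s_comp_any (by omega) h1, T.s_comp_any (by omega) h2, if_neg (by omega),
      if_neg (by omega)]
    rcases (Nat.lt_succ_iff.1 hi).lt_or_eq with hi | rfl
    · rw [← T.s_s_lt f hi, ← T.s_s_lt g hi, h]
    · exact h
  t_eq := by
    rintro ⟨⟨f, g⟩, hf, hg, h⟩ i hi
    simp only at hf hg h ⊢
    have h1 : T.t n f = T.s n g := by rw [← hf, h]
    have h2 : T.t n g = T.s n f := by rw [← hg, h]
    rw [T.t_comp_any (by omega) h1, T.t_comp_any (by omega) h2, if_neg (by omega),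
      if_neg (by omega)]
    rcases (Nat.lt_succ_iff.1 hi).lt_or_eq with hi | rfl
    · rw [← T.t_s_lt f hi, ← T.t_s_lt g hi, h]
    · rw [← hf, ← hg, h]

/-- The abelianized of a track `(n + 1)`-category. -/
noncomputable def abelianized {n : ℕ} (T : NCat.{u} (n + 1)) : NCat.{u} (n + 1) :=
  T.quot T.commSpheres

/-- The `(n + 1)`-cells of `T`, seen as a cellular extension of the `n`-category `Tₙ`. -/
def topCells {n : ℕ} (T : NCat.{u} (n + 1)) : CellExt T.trunc where
  G := T.X
  src f := ⟨T.s n f, T.s_s_le f le_rfl⟩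
  tgt f := ⟨T.t n f, T.s_t_le f le_rfl⟩
  s_eq f _ hi := Subtype.ext ((T.s_s_lt f hi).trans (T.s_t_lt f hi).symm)
  t_eq f _ hi := Subtype.ext ((T.t_s_lt f hi).trans (T.t_t_lt f hi).symm)

/-- The `n`-category presented by a track `(n + 1)`-category. -/
noncomputable def presented {n : ℕ} (T : NCat.{u} (n + 1)) : NCat.{u} n :=
  T.trunc.quot T.topCells

/-! ### Contexts and natural systems -/

/-- The identity `n`-functor. -/
def idFunctor {n : ℕ} (C : NCat.{u} n) : NFunctor C C where
  map x := x
  map_s _ _ := rfl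
  map_t _ _ := rfl
  map_comp _ _ := rfl

theorem map_composable {n : ℕ} {C D : NCat.{u} n} (F : NFunctor C D) {i : ℕ} {x y : C.X}
    (h : C.t i x = C.s i y) : D.t i (F.map x) = D.s i (F.map y) := by
  rw [← F.map_t, ← F.map_s, h]

/-- The boundary of an `n`-cell `f` of `C`, as the boundary of one formal `n`-cell. -/
abbrev cellBdry {n : ℕ} (C : NCat.{u} n) (f : C.X) : Bdry C where
  G := PUnit
  bs i _ := C.s i f
  bt i _ := C.t i f
  s_bs_lt _ h _ := C.s_s_lt _ h
  s_bt_lt _ h _ := C.s_t_lt _ h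
  t_bs_lt _ h _ := C.t_s_lt _ h
  t_bt_lt _ h _ := C.t_t_lt _ h
  s_bs_le _ h _ := C.s_s_le _ h
  s_bt_le _ h _ := C.s_t_le _ h
  t_bs_le _ h _ := C.t_s_le _ h
  t_bt_le _ h _ := C.t_t_le _ h

theorem Bdry.Rel.count_eq {n : ℕ} {C : NCat.{u} n} {B : Bdry C} {a b : Raw C.X B.G}
    (h : B.Rel a b) : a.count = b.count := by
  induction h with
  | refl _ => rfl
  | symm _ ih => exact ih.symm
  | trans _ _ ih ih' => exact ih.trans ih'
  | congr _ _ _ ih ih' => simp only [Raw.count, ih, ih']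
  | cell _ _ => rfl
  | id_comp _ _ => simp only [Raw.count, zero_add]
  | comp_id _ _ => simp only [Raw.count, add_zero]
  | assoc _ => simp only [Raw.count, add_assoc]
  | exchange _ _ => simp only [Raw.count, add_add_add_comm]

/-- The number of occurrences of generators in an `n`-cell of `C.adjoin B`. -/
def occ {n : ℕ} {C : NCat.{u} n} {B : Bdry C} : (C.adjoin B).X → ℕ :=
  Quotient.lift (fun a => a.1.count) (fun _ _ h => Bdry.Rel.count_eq h)

theorem occ_comp {n : ℕ} {C : NCat.{u} n} {B : Bdry C} {i : ℕ} {x y : (C.adjoin B).X} (hi : i < n)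
    (h : (C.adjoin B).t i x = (C.adjoin B).s i y) :
    occ ((C.adjoin B).comp i x y) = occ x + occ y := by
  induction x using Bdry.ind with | _ a ha
  induction y using Bdry.ind with | _ b hb
  exact congrArg occ (B.freeComp_mk (B.free_composable hi h))

/-- Two `n`-functors on `C.adjoin B` are equal if they agree on `C` and on the generators. -/
theorem adjoin_ext {n : ℕ} {C D : NCat.{u} n} {B : Bdry C} (F G : NFunctor (C.adjoin B) D)
    (h : ∀ x, F.map ((C.incl B).map x) = G.map ((C.incl B).map x))
    (h' : ∀ γ, F.map (gen γ) = G.map (gen γ)) (x : (C.adjoin B).X) : F.map x = G.map x :=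
  adjoin_ind (p := fun x => F.map x = G.map x) h h'
    (fun i x y hi c hx hy => by rw [F.map_comp hi c, G.map_comp hi c, hx, hy]) x

/-- Composition of `n`-functors. -/
def compFunctor {n : ℕ} {C D E : NCat.{u} n} (F : NFunctor C D) (G : NFunctor D E) :
    NFunctor C E where
  map x := G.map (F.map x)
  map_s i x := by rw [F.map_s, G.map_s]
  map_t i x := by rw [F.map_t, G.map_t]
  map_comp hi h := by rw [F.map_comp hi h, G.map_comp hi (map_composable F h)]

/-- For an `n`-cell `C[x]` of the `n`-category obtained from `C` by adjoining a formal `n`-cell `x`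
parallel to `f`, this is the `n`-cell `C[f]`, obtained by replacing `x` by `f`. -/
noncomputable def plug {n : ℕ} (C : NCat.{u} n) (f : C.X) :
    NFunctor (C.adjoin (C.cellBdry f)) C :=
  lift C.idFunctor (fun _ => f) (fun _ _ _ => rfl) (fun _ _ _ => rfl)

theorem adjoin_s {n : ℕ} {C : NCat.{u} n} {f : C.X} (c : (C.adjoin (C.cellBdry f)).X) {i : ℕ}
    (hi : i < n) : (C.adjoin (C.cellBdry f)).s i c =
      (C.incl (C.cellBdry f)).map (C.s i ((C.plug f).map c)) := by
  induction c using Bdry.ind with | _ a ha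
  refine ((C.cellBdry f).freeS_mk ha).trans ((if_pos hi).trans ?_)
  exact congrArg (C.incl (C.cellBdry f)).map
    (eval_bdry C.idFunctor (fun _ => f) (fun _ _ _ => rfl) (fun _ _ _ => rfl) ha i hi).1.symm

theorem adjoin_t {n : ℕ} {C : NCat.{u} n} {f : C.X} (c : (C.adjoin (C.cellBdry f)).X) {i : ℕ}
    (hi : i < n) : (C.adjoin (C.cellBdry f)).t i c =
      (C.incl (C.cellBdry f)).map (C.t i ((C.plug f).map c)) := by
  induction c using Bdry.ind with | _ a ha
  refine ((C.cellBdry f).freeT_mk ha).trans ((if_pos hi).trans ?_)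
  exact congrArg (C.incl (C.cellBdry f)).map
    (eval_bdry C.idFunctor (fun _ => f) (fun _ _ _ => rfl) (fun _ _ _ => rfl) ha i hi).2.symm

/-- If `c` is a context on `f` with `c[f] = g`, this maps a context `d` on `g` to the context
`d[c]` on `f`, obtained by replacing the formal cell in `d` by `c`. -/
noncomputable def graft {n : ℕ} {C : NCat.{u} n} {f g : C.X} (c : (C.adjoin (C.cellBdry f)).X)
    (h : (C.plug f).map c = g) :
    NFunctor (C.adjoin (C.cellBdry g)) (C.adjoin (C.cellBdry f)) :=
  lift (C.incl (C.cellBdry f)) (fun _ => c)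
    (fun _ hi _ => (adjoin_s c hi).trans (by rw [h]))
    (fun _ hi _ => (adjoin_t c hi).trans (by rw [h]))

theorem plug_graft {n : ℕ} {C : NCat.{u} n} {f g : C.X} (c : (C.adjoin (C.cellBdry f)).X)
    (h : (C.plug f).map c = g) (d : (C.adjoin (C.cellBdry g)).X) :
    (C.plug f).map ((graft c h).map d) = (C.plug g).map d :=
  adjoin_ext (compFunctor (graft c h) (C.plug f)) (C.plug g) (fun _ => rfl) (fun _ => h) d

theorem occ_graft {n : ℕ} {C : NCat.{u} n} {f g : C.X} (c : (C.adjoin (C.cellBdry f)).X)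
    (h : (C.plug f).map c = g) (d : (C.adjoin (C.cellBdry g)).X) :
    occ ((graft c h).map d) = occ d * occ c := by
  refine adjoin_ind (p := fun d => occ ((graft c h).map d) = occ d * occ c) ?_ ?_ ?_ d
  · intro x
    exact (zero_mul _).symm
  · intro γ
    exact (one_mul _).symm
  · intro i x y hi e hx hy
    rw [(graft c h).map_comp hi e, occ_comp hi (map_composable _ e), occ_comp hi e, hx, hy,
      add_mul]

/-- The objects of the category of contexts of an `n`-category `C`: the `n`-cells of `C`. -/
structure Ct {n : ℕ} (C : NCat.{u} n) : Type u where
  cell : C.X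

/-- A context of `C` from the `n`-cell `f` to the `n`-cell `g`: an `n`-cell `c` of the `n`-category
obtained from `C` by freely adjoining an `n`-cell `x` parallel to `f`, which contains exactly one
occurrence of `x` and such that `c[f] = g`. -/
structure Context {n : ℕ} (C : NCat.{u} n) (f g : C.X) : Type u where
  cell : (C.adjoin (C.cellBdry f)).X
  occ_eq : occ cell = 1
  plug_eq : (C.plug f).map cell = g

theorem Context.ext' {n : ℕ} {C : NCat.{u} n} {f g : C.X} {c d : C.Context f g}
    (h : c.cell = d.cell) : c = d := by
  cases c; cases d; cases h; rfl

/-- The category of contexts of an `n`-category. -/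
noncomputable instance {n : ℕ} (C : NCat.{u} n) : Category.{u} C.Ct where
  Hom f g := C.Context f.cell g.cell
  id f := ⟨gen PUnit.unit, rfl, rfl⟩
  comp c d := ⟨(graft c.cell c.plug_eq).map d.cell,
    by rw [occ_graft, c.occ_eq, d.occ_eq], (plug_graft _ _ _).trans d.plug_eq⟩
  id_comp {f g} d := Context.ext'
    (adjoin_ext (graft (gen PUnit.unit) rfl) (idFunctor _) (fun _ => rfl) (fun _ => rfl) d.cell)
  comp_id c := rfl
  assoc {f g h k} c d e := Context.ext'
    (adjoin_ext (graft ((graft c.cell c.plug_eq).map d.cell) ((plug_graft _ _ _).trans d.plug_eq))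
      (compFunctor (graft d.cell d.plug_eq) (graft c.cell c.plug_eq))
      (fun _ => rfl) (fun _ => rfl) e.cell)

/-- An abelian natural system on an `n`-category `C`: a functor from the category of contexts of
`C` to abelian groups. -/
abbrev AbNatSystem {n : ℕ} (C : NCat.{u} n) := C.Ct ⥤ AddCommGrpCat.{u}

/-- A family of elements of an abelian natural system `D` generates `D` when every element of `D`
is a linear combination, with integer coefficients, of images of elements of the family under
contexts. -/
def Generates {n : ℕ} {C : NCat.{u} n} (D : C.AbNatSystem) (S : Set (Σ f : C.Ct, D.obj f)) : Prop :=
  ∀ (g : C.Ct) (x : D.obj g), x ∈ AddSubgroup.closure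
    {y : D.obj g | ∃ a ∈ S, ∃ c : a.1 ⟶ g, y = (D.map c).hom a.2}

/-- An abelian natural system is finitely generated when some finite family generates it. -/
def FinitelyGenerated {n : ℕ} {C : NCat.{u} n} (D : C.AbNatSystem) : Prop :=
  ∃ S : Set (Σ f : C.Ct, D.obj f), S.Finite ∧ Generates D S

/-! ### The natural system of a track category -/

section identities

variable {n : ℕ} (T : NCat.{u} (n + 1))

/-- The class, in the presented `n`-category, of the `n`-source of an `(n + 1)`-cell of `T` (which
is also the class of its `n`-target). -/
noncomputable def proj (f : T.X) : T.presented.X :=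
  quotMk T.topCells ⟨T.s n f, T.s_s_le f le_rfl⟩

/-- A chosen `n`-cell of `T` in each class. -/
noncomputable def sec (x : T.presented.X) : T.X := (Quotient.out x).1

theorem s_sec (x : T.presented.X) : T.s n (T.sec x) = T.sec x := (Quotient.out x).2

theorem t_sec (x : T.presented.X) : T.t n (T.sec x) = T.sec x := by
  rw [← T.s_sec x]; exact T.t_s_le _ le_rfl

theorem proj_sec (x : T.presented.X) : T.proj (T.sec x) = x := by
  refine Eq.trans ?_ (Quotient.out_eq x)
  exact congrArg (quotMk T.topCells) (Subtype.ext (T.s_sec x))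

theorem proj_s_top (f : T.X) : T.proj (T.s n f) = T.proj f :=
  congrArg (quotMk T.topCells) (Subtype.ext (T.s_s_le f le_rfl))

theorem proj_t_top (f : T.X) : T.proj (T.t n f) = T.proj f := by
  have : T.topCells.Cong (T.topCells.src f) (T.topCells.tgt f) := .of (E := T.topCells) f
  refine Eq.trans ?_ (Quotient.sound (s := T.topCells.setoid) this).symm
  exact congrArg (quotMk T.topCells) (Subtype.ext (T.s_t_le f le_rfl))

theorem proj_s (f : T.X) {i : ℕ} (hi : i < n) : T.presented.s i (T.proj f) = T.proj (T.s i f) :=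
  congrArg (quotMk T.topCells)
    (Subtype.ext ((T.s_s_lt f hi).trans (T.s_s_le f hi.le).symm))

theorem proj_t (f : T.X) {i : ℕ} (hi : i < n) : T.presented.t i (T.proj f) = T.proj (T.t i f) :=
  congrArg (quotMk T.topCells)
    (Subtype.ext ((T.t_s_lt f hi).trans (T.s_t_le f hi.le).symm))

theorem composable_of_proj {f g : T.X} {i : ℕ} (hi : i < n)
    (h : T.presented.t i (T.proj f) = T.presented.s i (T.proj g)) : T.t i f = T.s i g := by
  have := congrArg Subtype.val (quot_composable T.topCells hi h)
  exact (T.t_s_lt f hi).symm.trans (this.trans (T.s_s_lt g hi))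

theorem proj_comp {f g : T.X} {i : ℕ} (hi : i < n) (h : T.t i f = T.s i g) :
    T.proj (T.comp i f g) = T.presented.comp i (T.proj f) (T.proj g) := by
  have h' : T.t i (T.s n f) = T.s i (T.s n g) := by rw [T.t_s_lt _ hi, T.s_s_lt _ hi, h]
  refine Eq.trans ?_ (quotComp_mk T.topCells (x := ⟨T.s n f, T.s_s_le f le_rfl⟩)
    (y := ⟨T.s n g, T.s_s_le g le_rfl⟩) hi (Subtype.ext h')).symm
  refine congrArg (quotMk T.topCells) (Subtype.ext ?_)
  change T.s n (T.comp i f g) = T.s n (T.comp i (T.s n f) (T.s n g))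
  rw [T.s_comp_lt (by omega) hi h, T.s_comp_lt (by omega) hi h', T.s_s_le _ le_rfl,
    T.s_s_le _ le_rfl]

/-- A closed `(n + 1)`-cell of `T` whose base point is a representative of `u`. -/
structure Loop (u : T.presented.X) : Type u where
  cell : T.X
  closed : T.s n cell = T.t n cell
  proj_eq : T.proj cell = u

theorem Loop.ext' {T : NCat.{u} (n + 1)} {u : T.presented.X} {f g : T.Loop u}
    (h : f.cell = g.cell) : f = g := by
  cases f; cases g; cases h; rfl

/-- The defining relations of the group of identities among relations associated to `u`:
`⌊f ⋆ g⌋ = ⌊f⌋ + ⌊g⌋` for closed cells `f`, `g` with the same base point, and `⌊f ⋆ g⌋ = ⌊g ⋆ f⌋`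
for cells `f : a → b` and `g : b → a`. -/
inductive IdRel (u : T.presented.X) : FreeAbelianGroup (T.Loop u) → Prop
  | add (a b c : T.Loop u) : T.s n a.cell = T.s n b.cell → c.cell = T.comp n a.cell b.cell →
      IdRel u (.of c - (.of a + .of b))
  | comm (f g : T.X) (c d : T.Loop u) : T.t n f = T.s n g → T.t n g = T.s n f →
      c.cell = T.comp n f g → d.cell = T.comp n g f → IdRel u (.of c - .of d)

/-- The group of identities among relations associated to `u`. -/
abbrev IdGroup (u : T.presented.X) : Type u :=
  FreeAbelianGroup (T.Loop u) ⧸ AddSubgroup.closure {r | IdRel T u r}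

variable {T}

/-- The identity among relations `⌊f⌋` given by a closed cell `f`. -/
def Loop.cls {u : T.presented.X} (f : T.Loop u) : T.IdGroup u :=
  QuotientAddGroup.mk (FreeAbelianGroup.of f)

theorem IdRel.mk_eq_zero {u : T.presented.X} {r : FreeAbelianGroup (T.Loop u)} (h : IdRel T u r) :
    (QuotientAddGroup.mk r : T.IdGroup u) = 0 :=
  (QuotientAddGroup.eq_zero_iff r).2 (AddSubgroup.subset_closure h)

theorem Loop.cls_add {u : T.presented.X} (a b c : T.Loop u) (h : T.s n a.cell = T.s n b.cell)
    (hc : c.cell = T.comp n a.cell b.cell) : c.cls = a.cls + b.cls :=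
  sub_eq_zero.1 (IdRel.add a b c h hc).mk_eq_zero

theorem Loop.cls_comm {u : T.presented.X} (f g : T.X) (c d : T.Loop u) (h : T.t n f = T.s n g)
    (h' : T.t n g = T.s n f) (hc : c.cell = T.comp n f g) (hd : d.cell = T.comp n g f) :
    c.cls = d.cls :=
  sub_eq_zero.1 (IdRel.comm f g c d h h' hc hd).mk_eq_zero

/-- Two cells `p` and `q` are conjugate when `p ⋆ g = g ⋆ q` for some `g` from the source of `p` to
the source of `q`. -/
def Conj (p q : T.X) : Prop :=
  ∃ g : T.X, T.s n g = T.t n p ∧ T.t n g = T.s n q ∧ T.comp n p g = T.comp n g q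

theorem conj_refl {p : T.X} (h : T.s n p = T.t n p) : Conj p p := by
  refine ⟨T.s n p, ?_, T.t_s_le _ le_rfl, ?_⟩
  · rw [T.s_s_le _ le_rfl, h]
  · rw [T.id_comp _ (by omega), h, T.comp_id _ (by omega)]

theorem conj_symm (hT : T.IsTrack) {p q : T.X} (hp : T.s n p = T.t n p) (hq : T.s n q = T.t n q)
    (h : Conj p q) : Conj q p := by
  obtain ⟨g, h1, h2, h3⟩ := h
  obtain ⟨k, i1, i2, i3, i4⟩ := hT g
  have hn : n < n + 1 := by omega
  refine ⟨k, by rw [i1, h2, hq], by rw [i2, h1, hp], ?_⟩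
  have e1 : T.comp n (T.comp n k (T.comp n p g)) k = T.comp n k p := by
    rw [T.assoc hn (by rw [i2, T.s_comp hn h1.symm, h1, hp]) (by rw [T.t_comp hn h1.symm, i1]),
      T.assoc hn h1.symm i1.symm, i3, h1, T.comp_id _ hn]
  have e2 : T.comp n (T.comp n k (T.comp n g q)) k = T.comp n q k := by
    rw [← T.assoc hn i2 h2, i4, h2, T.id_comp _ hn]
  rw [← e1, ← e2, h3]

theorem conj_trans {p q r : T.X} (hq : T.s n q = T.t n q) (h : Conj p q) (h' : Conj q r) :
    Conj p r := by
  obtain ⟨g, h1, h2, h3⟩ := h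
  obtain ⟨k, i1, i2, i3⟩ := h'
  have hn : n < n + 1 := by omega
  have c : T.t n g = T.s n k := by rw [h2, i1, hq]
  refine ⟨T.comp n g k, by rw [T.s_comp hn c, h1], by rw [T.t_comp hn c, i2], ?_⟩
  rw [← T.assoc hn h1.symm c, h3, T.assoc hn h2 i1.symm, i3, T.assoc hn c i2]

theorem conj_comp {p q p' q' : T.X} {i : ℕ} (hi : i < n) (c : T.t i p = T.s i q)
    (c' : T.t i p' = T.s i q') (h : Conj p p') (h' : Conj q q') :
    Conj (T.comp i p q) (T.comp i p' q') := by
  obtain ⟨g, h1, h2, h3⟩ := h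
  obtain ⟨k, i1, i2, i3⟩ := h'
  have hi' : i < n + 1 := by omega
  have e : T.t i g = T.s i k := by
    rw [← T.t_s_lt g hi, ← T.s_s_lt k hi, h1, i1, T.t_t_lt _ hi, T.s_t_lt _ hi, c]
  refine ⟨T.comp i g k, ?_, ?_, ?_⟩
  · rw [T.s_comp_lt hi' hi e, T.t_comp_lt hi' hi c, h1, i1]
  · rw [T.t_comp_lt hi' hi e, T.s_comp_lt hi' hi c', h2, i2]
  · rw [← T.exchange hi (by omega) h1.symm i1.symm c, ← T.exchange hi (by omega) h2 i2 e, h3, i3]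

theorem Loop.cls_of_conj (hT : T.IsTrack) {u : T.presented.X} {a b : T.Loop u}
    (h : Conj a.cell b.cell) : a.cls = b.cls := by
  obtain ⟨g, h1, h2, h3⟩ := h
  obtain ⟨k, i1, i2, i3, i4⟩ := hT g
  have hn : n < n + 1 := by omega
  refine Loop.cls_comm (T.comp n a.cell g) k a b ?_ ?_ ?_ ?_
  · rw [T.t_comp hn h1.symm, i1]
  · rw [T.s_comp hn h1.symm, i2, h1, a.closed]
  · rw [T.assoc hn h1.symm i1.symm, i3, h1, T.comp_id _ hn]
  · rw [h3, ← T.assoc hn i2 h2, i4, h2, T.id_comp _ hn]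

/-- In a track category, congruent `n`-cells are linked by an `(n + 1)`-cell. -/
theorem exists_of_cong (hT : T.IsTrack) {x y : T.trunc.X} (h : T.topCells.Cong x y) :
    ∃ g : T.X, T.s n g = x.1 ∧ T.t n g = y.1 := by
  induction h with
  | of γ => exact ⟨γ, rfl, rfl⟩
  | refl x => exact ⟨x.1, x.2, by rw [← x.2]; exact T.t_s_le _ le_rfl⟩
  | symm _ ih =>
    obtain ⟨g, h1, h2⟩ := ih
    obtain ⟨k, hk⟩ := hT g
    exact ⟨k, hk.s_eq.trans h2, hk.t_eq.trans h1⟩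
  | trans _ _ ih ih' =>
    obtain ⟨g, h1, h2⟩ := ih
    obtain ⟨k, h3, h4⟩ := ih'
    have c : T.t n g = T.s n k := h2.trans h3.symm
    exact ⟨T.comp n g k, by rw [T.s_comp (by omega) c, h1], by rw [T.t_comp (by omega) c, h4]⟩
  | @comp i x y x' y' hi c c' _ _ ih ih' =>
    obtain ⟨g, h1, h2⟩ := ih
    obtain ⟨k, h3, h4⟩ := ih'
    have d : T.t i x.1 = T.s i y.1 := congrArg Subtype.val c
    have d' : T.t i x'.1 = T.s i y'.1 := congrArg Subtype.val c'
    have e : T.t i g = T.s i k := by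
      rw [← T.t_s_lt g hi, ← T.s_s_lt k hi, h1, h3, d]
    refine ⟨T.comp i g k, ?_, ?_⟩
    · change _ = T.s n (T.comp i x.1 y.1)
      rw [T.s_comp_lt (by omega) hi e, T.s_comp_lt (by omega) hi d, h1, h3, x.2, y.2]
    · change _ = T.s n (T.comp i x'.1 y'.1)
      rw [T.t_comp_lt (by omega) hi e, T.s_comp_lt (by omega) hi d', h2, h4, x'.2, y'.2]

theorem conj_of_proj (hT : T.IsTrack) {x y : T.X} (hx : T.s n x = x) (hy : T.s n y = y)
    (h : T.proj x = T.proj y) : Conj x y := by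
  obtain ⟨g, h1, h2⟩ := exists_of_cong hT (Quotient.exact h)
  simp only [hx, hy] at h1 h2
  have hx' : T.t n x = x := by rw [← hx]; exact T.t_s_le _ le_rfl
  refine ⟨g, h1.trans hx'.symm, h2.trans hy.symm, ?_⟩
  have e1 := T.id_comp (i := n) g (by omega)
  have e2 := T.comp_id (i := n) g (by omega)
  rw [h1] at e1
  rw [h2] at e2
  rw [e1, e2]

variable (T)

/-- For a formal composite `a` of cells of the presented `n`-category and of a formal `n`-cell `x`,
this lifts `a` to `T` (by choosing representatives) and replaces `x` by `f`. -/
noncomputable def evalLift (f : T.X) (a : Raw T.presented.X PUnit.{u + 1}) : T.X :=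
  a.eval T T.sec (fun _ => f)

theorem eval_proj (f : T.X) {a : Raw T.presented.X (T.presented.cellBdry (T.proj f)).G}
    (ha : (T.presented.cellBdry (T.proj f)).WF a) :
    T.proj (T.evalLift f a) =
      a.eval T.presented T.presented.idFunctor.map (fun _ => T.proj f) := by
  induction a with
  | cell x => exact T.proj_sec x
  | gen γ => rfl
  | comp i a b iha ihb =>
    have hi := ha.2.2.1
    have c := eval_composable T.presented.idFunctor (fun _ => T.proj f) (fun _ _ _ => rfl)
      (fun _ _ _ => rfl) ha
    simp only [← iha ha.1, ← ihb ha.2.1] at c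
    simp only [evalLift, Raw.eval] at iha ihb c ⊢
    rw [T.proj_comp hi (T.composable_of_proj hi c), iha ha.1, ihb ha.2.1]

theorem evalLift_composable (f : T.X) {i : ℕ}
    {a b : Raw T.presented.X (T.presented.cellBdry (T.proj f)).G}
    (h : (T.presented.cellBdry (T.proj f)).WF (.comp i a b)) :
    T.t i (T.evalLift f a) = T.s i (T.evalLift f b) := by
  have c := eval_composable T.presented.idFunctor (fun _ => T.proj f) (fun _ _ _ => rfl)
      (fun _ _ _ => rfl) h
  rw [← T.eval_proj f h.1, ← T.eval_proj f h.2.1] at c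
  exact T.composable_of_proj h.2.2.1 c

theorem evalLift_s (f : T.X) {a : Raw T.presented.X (T.presented.cellBdry (T.proj f)).G}
    (ha : (T.presented.cellBdry (T.proj f)).WF a) :
    T.s n (T.evalLift f a) = T.evalLift (T.s n f) a := by
  induction a with
  | cell x => exact T.s_sec x
  | gen γ => rfl
  | comp i a b iha ihb =>
    have hi := ha.2.2.1
    have c := T.evalLift_composable f ha
    simp only [evalLift, Raw.eval] at iha ihb c ⊢
    rw [T.s_comp_lt (by omega) hi c, iha ha.1, ihb ha.2.1]

theorem evalLift_t (f : T.X) {a : Raw T.presented.X (T.presented.cellBdry (T.proj f)).G}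
    (ha : (T.presented.cellBdry (T.proj f)).WF a) :
    T.t n (T.evalLift f a) = T.evalLift (T.t n f) a := by
  induction a with
  | cell x => exact T.t_sec x
  | gen γ => rfl
  | comp i a b iha ihb =>
    have hi := ha.2.2.1
    have c := T.evalLift_composable f ha
    simp only [evalLift, Raw.eval] at iha ihb c ⊢
    rw [T.t_comp_lt (by omega) hi c, iha ha.1, ihb ha.2.1]

theorem proj_comp_top {f g : T.X} (h : T.t n f = T.s n g) :
    T.proj (T.comp n f g) = T.proj f ∧ T.proj g = T.proj f := by
  constructor
  · rw [← T.proj_s_top, T.s_comp (by omega) h, T.proj_s_top]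
  · rw [← T.proj_s_top, ← h, T.proj_t_top]

theorem evalLift_comp {f g : T.X} (h : T.t n f = T.s n g)
    {a : Raw T.presented.X (T.presented.cellBdry (T.proj f)).G}
    (ha : (T.presented.cellBdry (T.proj f)).WF a) :
    T.evalLift (T.comp n f g) a = T.comp n (T.evalLift f a) (T.evalLift g a) := by
  induction a with
  | cell x =>
    have := T.comp_id (i := n) (T.sec x) (by omega)
    rw [T.t_sec] at this
    exact this.symm
  | gen γ => rfl
  | comp i a b iha ihb =>
    have hi := ha.2.2.1
    have c := T.evalLift_composable f ha
    have ga : T.t n (T.evalLift f a) = T.s n (T.evalLift g a) := by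
      have e := T.evalLift_s g (a := a) (by rw [(T.proj_comp_top h).2]; exact ha.1)
      rw [T.evalLift_t f ha.1, e, h]
    have gb : T.t n (T.evalLift f b) = T.s n (T.evalLift g b) := by
      have e := T.evalLift_s g (a := b) (by rw [(T.proj_comp_top h).2]; exact ha.2.1)
      rw [T.evalLift_t f ha.2.1, e, h]
    have iha := iha ha.1
    have ihb := ihb ha.2.1
    simp only [evalLift, Raw.eval] at iha ihb c ga gb ⊢
    rw [iha, ihb, T.exchange hi (by omega) ga gb c]

theorem evalLift_closed {f : T.X} (hf : T.s n f = T.t n f)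
    {a : Raw T.presented.X (T.presented.cellBdry (T.proj f)).G}
    (ha : (T.presented.cellBdry (T.proj f)).WF a) :
    T.s n (T.evalLift f a) = T.t n (T.evalLift f a) := by
  rw [T.evalLift_s f ha, T.evalLift_t f ha, hf]

variable {T}

theorem conj_of_rel (hT : T.IsTrack) {f : T.X} (hf : T.s n f = T.t n f)
    {a b : Raw T.presented.X (T.presented.cellBdry (T.proj f)).G}
    (h : (T.presented.cellBdry (T.proj f)).Rel a b) :
    Conj (T.evalLift f a) (T.evalLift f b) := by
  induction h with
  | refl h => exact conj_refl (T.evalLift_closed hf h)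
  | symm h ih =>
    exact conj_symm hT (T.evalLift_closed hf h.spec.1) (T.evalLift_closed hf h.spec.2.1) ih
  | trans h _ ih ih' => exact conj_trans (T.evalLift_closed hf h.spec.2.1) ih ih'
  | congr h ha hb ih ih' =>
    exact conj_comp h.2.2.1 (T.evalLift_composable f h)
      (T.evalLift_composable f (Bdry.wf_congr _ h ha hb)) ih ih'
  | @cell i x y hi h =>
    have c : T.t i (T.sec x) = T.s i (T.sec y) :=
      T.composable_of_proj hi (by rw [T.proj_sec, T.proj_sec, h])
    refine conj_of_proj hT ?_ (T.s_sec _) ?_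
    · change T.s n (T.comp i (T.sec x) (T.sec y)) = T.comp i (T.sec x) (T.sec y)
      rw [T.s_comp_lt (by omega) hi c, T.s_sec, T.s_sec]
    · change T.proj (T.comp i (T.sec x) (T.sec y)) = T.proj (T.sec _)
      rw [T.proj_comp hi c, T.proj_sec, T.proj_sec, T.proj_sec]
  | @id_comp i a hi h =>
    have w := (Bdry.Rel.id_comp hi h).spec.1
    have e : T.comp i (T.s i (T.evalLift f a)) (T.evalLift f a) = T.evalLift f a :=
      T.id_comp _ (by omega)
    have c : T.t i (T.s i (T.evalLift f a)) = T.s i (T.evalLift f a) := T.t_s_le _ le_rfl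
    have := conj_comp hi (T.evalLift_composable f w) c
      (conj_of_proj hT (T.s_sec _) (T.s_s_le _ hi.le) ?_) (conj_refl (T.evalLift_closed hf h))
    · rw [e] at this; exact this
    · refine (T.proj_sec _).trans ?_
      rw [← T.proj_s _ hi, T.eval_proj f h]
      exact ((eval_bdry T.presented.idFunctor (fun _ => T.proj f) (fun _ _ _ => rfl)
        (fun _ _ _ => rfl) h i hi).1).symm
  | @comp_id i a hi h =>
    have w := (Bdry.Rel.comp_id hi h).spec.1
    have e : T.comp i (T.evalLift f a) (T.t i (T.evalLift f a)) = T.evalLift f a :=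
      T.comp_id _ (by omega)
    have c : T.t i (T.evalLift f a) = T.s i (T.t i (T.evalLift f a)) := (T.s_t_le _ le_rfl).symm
    have := conj_comp hi (T.evalLift_composable f w) c
      (conj_refl (T.evalLift_closed hf h)) (conj_of_proj hT (T.s_sec _) (T.s_t_le _ hi.le) ?_)
    · rw [e] at this; exact this
    · refine (T.proj_sec _).trans ?_
      rw [← T.proj_t _ hi, T.eval_proj f h]
      exact ((eval_bdry T.presented.idFunctor (fun _ => T.proj f) (fun _ _ _ => rfl)
        (fun _ _ _ => rfl) h i hi).2).symm
  | @assoc i a b c h =>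
    have h' := (Bdry.Rel.assoc h).spec.2.1
    have e : T.evalLift f (.comp i (.comp i a b) c) = T.evalLift f (.comp i a (.comp i b c)) :=
      T.assoc (by have := h.2.2.1; omega) (T.evalLift_composable f h.1)
        (T.evalLift_composable f h'.2.1)
    exact (congrArg (Conj · _) e).mpr (conj_refl (T.evalLift_closed hf h'))
  | @exchange i j a b c d hij h =>
    have h' := (Bdry.Rel.exchange hij h).spec.2.1
    have e : T.evalLift f (.comp i (.comp j a b) (.comp j c d)) =
        T.evalLift f (.comp j (.comp i a c) (.comp i b d)) :=
      T.exchange hij (by have := h.1.2.2.1; omega) (T.evalLift_composable f h.1)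
        (T.evalLift_composable f h.2.1) (T.evalLift_composable f h'.1)
    exact (congrArg (Conj · _) e).mpr (conj_refl (T.evalLift_closed hf h'))

/-- The closed cell `B[f]`, where `f` is a closed cell and `B` is the context of `Tₙ` obtained from
a formal composite over the presented `n`-category by choosing representatives. -/
noncomputable def Loop.act {u v : T.presented.X} (f : T.Loop u)
    (a : Raw T.presented.X (T.presented.cellBdry u).G) (ha : (T.presented.cellBdry u).WF a)
    (h : a.eval T.presented T.presented.idFunctor.map (fun _ => u) = v) : T.Loop v where
  cell := T.evalLift f.cell a
  closed := by
    obtain ⟨f, hf, rfl⟩ := f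
    exact T.evalLift_closed hf ha
  proj_eq := by
    obtain ⟨f, hf, rfl⟩ := f
    exact (T.eval_proj f ha).trans h

theorem Loop.act_cls_eq (hT : T.IsTrack) {u v : T.presented.X} (f : T.Loop u)
    {a b : Raw T.presented.X (T.presented.cellBdry u).G} {ha : (T.presented.cellBdry u).WF a}
    {hb : (T.presented.cellBdry u).WF b}
    {h : a.eval T.presented T.presented.idFunctor.map (fun _ => u) = v}
    {h' : b.eval T.presented T.presented.idFunctor.map (fun _ => u) = v}
    (r : (T.presented.cellBdry u).Rel a b) : (f.act a ha h).cls = (f.act b hb h').cls := by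
  obtain ⟨f, hf, rfl⟩ := f
  exact Loop.cls_of_conj hT (conj_of_rel hT hf r)

/-- A formal composite that represents a context. -/
noncomputable def Context.rep {C : NCat.{u} n} {f g : C.X} (c : C.Context f g) :
    Raw C.X (C.cellBdry f).G :=
  (C.cellBdry f).rep c.cell

theorem Context.rep_wf {C : NCat.{u} n} {f g : C.X} (c : C.Context f g) :
    (C.cellBdry f).WF c.rep := (C.cellBdry f).rep_wf c.cell

theorem Context.eval_rep {C : NCat.{u} n} {f g : C.X} (c : C.Context f g) :
    c.rep.eval C C.idFunctor.map (fun _ => f) = g :=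
  (congrArg (C.plug f).map ((C.cellBdry f).cls_rep c.cell)).trans c.plug_eq

/-- The action of a context `C` from `u` to `v` on identities among relations: it maps `⌊f⌋` to
`⌊B[f]⌋`, where `B` is a context of `Tₙ` that represents `C`. -/
noncomputable def idMap {u v : T.presented.X} (c : T.presented.Context u v) :
    T.IdGroup u →+ T.IdGroup v :=
  QuotientAddGroup.lift _
    (FreeAbelianGroup.lift fun f : T.Loop u => (f.act c.rep c.rep_wf c.eval_rep).cls) (by
      rw [AddSubgroup.closure_le]
      rintro r (⟨a, b, d, h, hd⟩ | ⟨f, g, a, b, h, h', ha, hb⟩)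
      · change FreeAbelianGroup.lift _ _ = _
        rw [map_sub, map_add, sub_eq_zero]
        simp only [FreeAbelianGroup.lift_apply_of]
        obtain ⟨a, h1, rfl⟩ := a
        obtain ⟨b, h2, h3⟩ := b
        obtain ⟨d, h4, h5⟩ := d
        dsimp only at h hd
        subst hd
        refine Loop.cls_add _ _ _ ?_ (T.evalLift_comp (h1.symm.trans h) c.rep_wf)
        have := T.evalLift_s b (a := c.rep) (by rw [h3]; exact c.rep_wf)
        exact (T.evalLift_s a c.rep_wf).trans ((congrArg (T.evalLift · c.rep) h).trans this.symm)
      · change FreeAbelianGroup.lift _ _ = _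
        rw [map_sub, sub_eq_zero]
        simp only [FreeAbelianGroup.lift_apply_of]
        obtain ⟨a, h1, h2⟩ := a
        obtain ⟨b, h3, h4⟩ := b
        dsimp only at ha hb
        subst ha hb
        have h5 : T.proj f = u := (T.proj_comp_top h).1.symm.trans h2
        subst h5
        have wg : (T.presented.cellBdry (T.proj g)).WF c.rep := by
          rw [(T.proj_comp_top h).2]; exact c.rep_wf
        refine Loop.cls_comm (T.evalLift f c.rep) (T.evalLift g c.rep) _ _ ?_ ?_
          (T.evalLift_comp h c.rep_wf) (T.evalLift_comp h' wg)
        · rw [T.evalLift_t f c.rep_wf, T.evalLift_s g wg, h]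
        · rw [T.evalLift_t g wg, T.evalLift_s f c.rep_wf, h'])

theorem idMap_cls {u v : T.presented.X} (c : T.presented.Context u v) (f : T.Loop u) :
    idMap c f.cls = (f.act c.rep c.rep_wf c.eval_rep).cls := by
  change FreeAbelianGroup.lift _ _ = _
  rw [FreeAbelianGroup.lift_apply_of]

theorem idGroup_ext {u : T.presented.X} {A : Type*} [AddCommGroup A] {F G : T.IdGroup u →+ A}
    (h : ∀ f : T.Loop u, F f.cls = G f.cls) : F = G := by
  refine QuotientAddGroup.addMonoidHom_ext _ (FreeAbelianGroup.lift_ext _ _ fun f => ?_)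
  exact h f

theorem bind_spec {C : NCat.{u} n} {f g : C.X} (r : Raw C.X (C.cellBdry f).G)
    (hr : (C.cellBdry f).WF r) (h : (C.plug f).map ((C.cellBdry f).cls r hr) = g)
    {a : Raw C.X (C.cellBdry g).G} (ha : (C.cellBdry g).WF a) :
    ∃ w : (C.cellBdry f).WF (a.bind fun _ => r),
      (C.cellBdry f).cls _ w = (graft _ h).map ((C.cellBdry g).cls a ha) := by
  induction a with
  | cell x => exact ⟨trivial, rfl⟩
  | gen γ => exact ⟨hr, rfl⟩
  | comp i a b iha ihb =>
    obtain ⟨wa, ea⟩ := iha ha.1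
    obtain ⟨wb, eb⟩ := ihb ha.2.1
    have hi := ha.2.2.1
    have e : (C.adjoin (C.cellBdry g)).comp i ((C.cellBdry g).cls a ha.1)
        ((C.cellBdry g).cls b ha.2.1) = (C.cellBdry g).cls (.comp i a b) ha :=
      (C.cellBdry g).freeComp_mk ha
    have c : (C.adjoin (C.cellBdry g)).t i ((C.cellBdry g).cls a ha.1) =
        (C.adjoin (C.cellBdry g)).s i ((C.cellBdry g).cls b ha.2.1) := by
      change (C.cellBdry g).freeT i _ = (C.cellBdry g).freeS i _
      rw [Bdry.freeT_mk, Bdry.freeS_mk, if_pos hi, if_pos hi]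
      simp only [ha.2.2.2]
    have c' := map_composable (graft _ h) c
    rw [← ea, ← eb] at c'
    have w := (C.cellBdry f).free_composable hi c'
    refine ⟨w, ?_⟩
    rw [← e, (graft _ h).map_comp hi c, ← ea, ← eb]
    exact ((C.cellBdry f).freeComp_mk w).symm

variable (T)

/-- The natural system `Π(T)` of identities among relations of a track `(n + 1)`-category `T`,
on the `n`-category that `T` presents. -/
noncomputable def identities (hT : T.IsTrack) : T.presented.AbNatSystem where
  obj u := AddCommGrpCat.of (T.IdGroup u.cell)
  map c := AddCommGrpCat.ofHom (idMap c)
  map_id u := by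
    ext1
    refine idGroup_ext fun f => ?_
    refine (idMap_cls _ f).trans ?_
    exact (Loop.act_cls_eq hT f (hb := (T.presented.cellBdry u.cell).wf_gen _) (h' := rfl)
      ((T.presented.cellBdry u.cell).rep_rel ((T.presented.cellBdry u.cell).wf_gen _)))
  map_comp {u v w} c d := by
    ext1
    refine idGroup_ext fun f => ?_
    refine (idMap_cls _ f).trans ?_
    change _ = idMap d (idMap c f.cls)
    rw [idMap_cls, idMap_cls]
    have hc : (T.presented.cellBdry u.cell).cls c.rep c.rep_wf = c.cell :=
      (T.presented.cellBdry u.cell).cls_rep c.cell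
    have hd : (T.presented.cellBdry v.cell).cls d.rep d.rep_wf = d.cell :=
      (T.presented.cellBdry v.cell).cls_rep d.cell
    obtain ⟨wf, e⟩ := bind_spec c.rep c.rep_wf c.eval_rep d.rep_wf
    have e' : (T.presented.cellBdry u.cell).cls _ wf = (c ≫ d).cell := by
      refine e.trans ?_
      change (graft _ _).map _ = (graft c.cell c.plug_eq).map d.cell
      rw [hd]
      congr 2
    have r : (T.presented.cellBdry u.cell).Rel (c ≫ d).rep (d.rep.bind fun _ => c.rep) :=
      Bdry.cls_eq_iff.1 (((T.presented.cellBdry u.cell).cls_rep _).trans e'.symm)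
    refine (Loop.act_cls_eq hT f (hb := wf) (h' := ?_) r).trans (congrArg Loop.cls ?_)
    · rw [Raw.eval_bind]
      exact (congrArg (fun z => d.rep.eval _ _ fun _ => z) c.eval_rep).trans d.eval_rep
    · exact Loop.ext' (Raw.eval_bind T T.sec (fun _ => f.cell) (fun _ => c.rep) d.rep)

end identities
end NCat

/-! ### Polygraphs -/

/-- The `n`-polygraphs, together with the free `n`-categories that they generate, by induction
on `n`. -/
noncomputable def polygraphAux : (n : ℕ) → (P : Type (u + 1)) × (P → NCat.{u} n)
  | 0 => ⟨Type u, NCat.discrete⟩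
  | n + 1 => ⟨(P : (polygraphAux n).1) × NCat.CellExt ((polygraphAux n).2 P),
      fun S => ((polygraphAux n).2 S.1).freeExt S.2⟩

/-- An `n`-polygraph. A `0`-polygraph is a set; an `(n + 1)`-polygraph is an `n`-polygraph together
with a cellular extension of the free `n`-category that it generates. In particular, a
`1`-polygraph is a graph. -/
def Polygraph (n : ℕ) : Type (u + 1) := (polygraphAux.{u} n).1

namespace Polygraph

/-- The free `n`-category `Σ*` generated by an `n`-polygraph `Σ`. -/
noncomputable def free {n : ℕ} (S : Polygraph.{u} n) : NCat.{u} n := (polygraphAux n).2 S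

/-- The underlying `n`-polygraph of an `(n + 1)`-polygraph. -/
def under {n : ℕ} (S : Polygraph.{u} (n + 1)) : Polygraph.{u} n := Sigma.fst S

/-- The cellular extension that is part of an `(n + 1)`-polygraph. -/
def ext {n : ℕ} (S : Polygraph.{u} (n + 1)) : NCat.CellExt S.under.free := Sigma.snd S

/-- The set of generating `(n + 1)`-cells of an `(n + 1)`-polygraph. -/
def TopGen {n : ℕ} (S : Polygraph.{u} (n + 1)) : Type u := S.ext.G

theorem free_succ {n : ℕ} (S : Polygraph.{u} (n + 1)) : S.free = S.under.free.freeExt S.ext := rfl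

/-- The `n`-category presented by an `(n + 1)`-polygraph. -/
noncomputable def presented {n : ℕ} (S : Polygraph.{u} (n + 1)) : NCat.{u} n :=
  S.under.free.quot S.ext

/-- The track `(n + 1)`-category generated by an `(n + 1)`-polygraph. -/
noncomputable def track {n : ℕ} (S : Polygraph.{u} (n + 1)) : NCat.{u} (n + 1) :=
  S.under.free.track S.ext

theorem isTrack_abelianized {n : ℕ} (S : Polygraph.{u} (n + 1)) : S.track.abelianized.IsTrack :=
  (NCat.isTrack_track _ _).quot _

/-- The natural system `Π(Σ)` of identities among relations of a polygraph `Σ`. -/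
noncomputable def identities {n : ℕ} (S : Polygraph.{u} (n + 1)) :
    S.track.abelianized.presented.AbNatSystem :=
  S.track.abelianized.identities S.isTrack_abelianized

/-- Two `(n + 1)`-polygraphs are Tietze-equivalent when they present isomorphic `n`-categories. -/
def TietzeEquivalent {n : ℕ} (S U : Polygraph.{u} (n + 1)) : Prop :=
  S.presented.Isomorphic U.presented

end Polygraph

/-! Let `T` and `T'` be the abelianized track categories of the two polygraphs, whose generating
cells have dimension `n + 1`. Tietze equivalence is symmetric, so it suffices to carry a finite
generating family from `Π(T)` to `Π(T')`.

The two mutually inverse functors between the presented categories lift to functors between the free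
`n`-categories: congruent `n`-cells have the same boundary, so a lift is forced in lower dimensions
and is an arbitrary choice of representative on each generating `n`-cell
(`Polygraph.exists_functor_lift`). The lifted source and target of a relation are congruent, hence
linked by an `(n + 1)`-cell of the track category. The lifts therefore extend to `F : T → T'` and `G
: T' → T` (`Polygraph.exists_track_functor`); they descend to the abelianizations because closed
cells with the same base point commute there.

The composite `F G` (first `G`, then `F`) need not be the identity, but it sends each `n`-cell `x`
to a congruent one, so there is a cell `κ x : F G x → x`. By freeness these cells can be chosen
compatibly with the compositions of `n`-cells (`Polygraph.exists_transformation`). Nothing makes `κ`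
natural with respect to `(n + 1)`-cells. For `f : a → b`, the failure is measured by the closed cell
`l` on `b` such that `F G f ⋆ κ b ⋆ l = κ a ⋆ f`, its defect.

When `f` is closed, this equation gives `⌊f⌋ = ⌊F G f⌋ + ⌊l⌋`. The first term is the image under `F`
of an identity among relations of `T`, so it is controlled by the finite family given for `T`. For
the second, the defect behaves like a crossed derivation: it is trivial on `n`-cells, it commutes
with composition along lower dimensions (`ToId.Defect.comp_lt`), and the defect of `f ⋆ₙ g` is that
of `g` followed by the conjugate by `g` of that of `f` (`ToId.Defect.comp_top`). So all defects come
from those of the generating `(n + 1)`-cells and of their inverses, which are finite in number. This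
is `finitelyGenerated_of_toId`.

The argument is run on closed cells rather than on elements of the groups:
`finitelyGenerated_identities_iff` restates finite generation as a closure property of a finite set
of closed cells, which avoids transport between the groups attached to different classes. -/

namespace NCat

/-! ### Closed cells of a track category -/

section closed

variable {n : ℕ} {T : NCat.{u} (n + 1)}

/-- Division on the left in a track category. -/
theorem IsTrack.exists_comp_eq (hT : T.IsTrack) {a b : T.X} (h : T.s n a = T.s n b) :
    ∃ c, T.s n c = T.t n a ∧ T.t n c = T.t n b ∧ T.comp n a c = b := by
  obtain ⟨a', h1, h2, h3, h4⟩ := hT a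
  have hn : n < n + 1 := by omega
  have c : T.t n a' = T.s n b := h2.trans h
  refine ⟨T.comp n a' b, by rw [T.s_comp hn c, h1], T.t_comp hn c, ?_⟩
  rw [← T.assoc hn h1.symm c, h3, h, T.id_comp _ hn]

theorem IsTrack.comp_left_cancel (hT : T.IsTrack) {a b c : T.X} (hb : T.t n a = T.s n b)
    (hc : T.t n a = T.s n c) (h : T.comp n a b = T.comp n a c) : b = c := by
  obtain ⟨a', h1, h2, h3, h4⟩ := hT a
  have hn : n < n + 1 := by omega
  have key : ∀ x, T.t n a = T.s n x → T.comp n a' (T.comp n a x) = x := fun x hx => by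
    rw [← T.assoc hn h2 hx, h4, hx, T.id_comp _ hn]
  rw [← key b hb, h, key c hc]

/-- Conjugation of a closed cell by a cell that starts at its base point. -/
theorem IsTrack.exists_conj (hT : T.IsTrack) {f g : T.X} (hf : T.s n f = T.t n f)
    (h : T.s n g = T.t n f) :
    ∃ f', T.s n f' = T.t n g ∧ T.t n f' = T.t n g ∧ T.comp n f g = T.comp n g f' ∧
      Conj f f' := by
  have hn : n < n + 1 := by omega
  obtain ⟨f', h1, h2, h3⟩ := hT.exists_comp_eq (a := g) (b := T.comp n f g)
    (by rw [T.s_comp hn h.symm, h, hf])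
  rw [T.t_comp hn h.symm] at h2
  exact ⟨f', h1, h2, h3.symm, g, h, h1.symm, h3.symm⟩

/-- Since the `(n + 1)`-cells can be inverted and composed, a whole chain of elementary congruences
collapses to one cell. -/
theorem IsTrack.exists_link (hT : T.IsTrack) {f g : T.X} (h : T.proj f = T.proj g) :
    ∃ k, T.s n k = T.s n f ∧ T.t n k = T.s n g :=
  exists_of_cong hT (Quotient.exact h)

/-- Every identity among relations is the class of a closed cell. -/
theorem IsTrack.exists_loop (hT : T.IsTrack) {u : T.presented.X} (x : T.IdGroup u) :
    ∃ l : T.Loop u, l.cls = x := by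
  have hn : n < n + 1 := by omega
  induction x using QuotientAddGroup.induction_on with | H x
  -- The base points of `a` and `b` are only congruent. Conjugating `b` along a link to the base
  -- point of `a` keeps its class and makes the two cells composable.
  have add : ∀ a b : T.Loop u, ∃ c : T.Loop u, c.cls = a.cls + b.cls := by
    intro a b
    obtain ⟨k, h1, h2⟩ := hT.exists_link (b.proj_eq.trans a.proj_eq.symm)
    obtain ⟨b', i1, i2, -, i4⟩ := hT.exists_conj b.closed (h1.trans b.closed)
    have hb : T.proj b' = u := by
      rw [← T.proj_s_top, i1, h2, T.proj_s_top, a.proj_eq]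
    have hc : T.t n a.cell = T.s n b' := by rw [i1, h2, a.closed]
    have e : Loop.cls (⟨b', i1.trans i2.symm, hb⟩ : T.Loop u) = b.cls :=
      (Loop.cls_of_conj hT i4).symm
    refine ⟨⟨T.comp n a.cell b', ?_, ?_⟩, ?_⟩
    · rw [T.s_comp hn hc, T.t_comp hn hc, i2, h2]
    · rw [(T.proj_comp_top hc).1, a.proj_eq]
    · rw [← e]
      exact Loop.cls_add _ _ _ (by rw [i1, h2]) rfl
  -- An identity cell is idempotent, so its class satisfies `c = c + c`.
  have zero : ∀ (x : T.X) (hx : T.s n x = x) (hx' : T.t n x = x) (h : T.proj x = u),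
      Loop.cls (⟨x, hx.trans hx'.symm, h⟩ : T.Loop u) = 0 := by
    intro x hx hx' h
    have e : T.comp n x x = x := by
      have := T.id_comp (i := n) x hn
      rwa [hx] at this
    have := Loop.cls_add (⟨x, hx.trans hx'.symm, h⟩ : T.Loop u) ⟨x, hx.trans hx'.symm, h⟩
      ⟨x, hx.trans hx'.symm, h⟩ rfl e.symm
    simpa using this
  have neg : ∀ a : T.Loop u, ∃ c : T.Loop u, c.cls = -a.cls := by
    rintro ⟨a, ha, rfl⟩
    obtain ⟨b, h1, h2, h3, h4⟩ := hT a
    refine ⟨⟨b, by rw [h1, h2, ha], ?_⟩, ?_⟩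
    · rw [← T.proj_s_top, h1, T.proj_t_top]
    · rw [eq_neg_iff_add_eq_zero, add_comm]
      have z := zero (T.s n a) (T.s_s_le _ le_rfl) (T.t_s_le _ le_rfl) (T.proj_s_top a)
      rw [← z]
      exact (Loop.cls_add _ _ _ (by rw [h1, ha]) h3.symm).symm
  induction x using FreeAbelianGroup.induction_on with
  | zero =>
    have h := T.s_sec u
    exact ⟨_, zero (T.sec u) h (T.t_sec u) (T.proj_sec u)⟩
  | of a => exact ⟨a, rfl⟩
  | neg a => exact neg a
  | add x y ihx ihy =>
    obtain ⟨a, ha⟩ := ihx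
    obtain ⟨b, hb⟩ := ihy
    obtain ⟨c, hc⟩ := add a b
    exact ⟨c, by rw [hc, ha, hb]; rfl⟩

/-! ### Stable families of subgroups, seen on closed cells -/

/-- The closed cell `f` represents an element of the family `N` of subgroups. -/
def ClsMem (N : ∀ u, AddSubgroup (T.IdGroup u)) (f : T.X) : Prop :=
  ∃ h : T.s n f = T.t n f, Loop.cls (⟨f, h, rfl⟩ : T.Loop (T.proj f)) ∈ N (T.proj f)

/-- A family of subgroups that is stable under the action of contexts. -/
def IsStable (N : ∀ u, AddSubgroup (T.IdGroup u)) : Prop :=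
  ∀ (u v : T.presented.X) (c : T.presented.Context u v), ∀ x ∈ N u, idMap c x ∈ N v

variable {N : ∀ u, AddSubgroup (T.IdGroup u)}

/-- `ClsMem` does not mention the index `u`, so it can be rewritten along equalities of cells whose
classes agree only propositionally. This is the passage back to a prescribed index. -/
theorem clsMem_iff {u : T.presented.X} (l : T.Loop u) : ClsMem N l.cell ↔ l.cls ∈ N u := by
  obtain ⟨f, h, rfl⟩ := l
  exact ⟨fun ⟨_, h⟩ => h, fun h' => ⟨h, h'⟩⟩

theorem clsMem_cell {x : T.X} (hx : T.s n x = x) : ClsMem N x := by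
  have ht : T.t n x = x := by rw [← hx]; exact T.t_s_le _ le_rfl
  have e : T.comp n x x = x := by
    have := T.id_comp (i := n) x (by omega)
    rwa [hx] at this
  have hc := hx.trans ht.symm
  have := Loop.cls_add (⟨x, hc, rfl⟩ : T.Loop (T.proj x)) ⟨x, hc, rfl⟩ ⟨x, hc, rfl⟩ rfl e.symm
  rw [left_eq_add] at this
  exact ⟨hc, this ▸ zero_mem _⟩

theorem ClsMem.comp {f g : T.X} (hf : ClsMem N f) (hg : ClsMem N g) (h : T.t n f = T.s n g) :
    ClsMem N (T.comp n f g) := by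
  have hn : n < n + 1 := by omega
  obtain ⟨cf, hf⟩ := hf
  have e := T.proj_comp_top h
  have hg' := (clsMem_iff (⟨g, hg.1, e.2⟩ : T.Loop (T.proj f))).1 hg
  have hc : T.s n (T.comp n f g) = T.t n (T.comp n f g) := by
    rw [T.s_comp hn h, T.t_comp hn h, cf, h, hg.1]
  refine (clsMem_iff (⟨T.comp n f g, hc, e.1⟩ : T.Loop (T.proj f))).2 ?_
  rw [Loop.cls_add ⟨f, cf, rfl⟩ ⟨g, hg.1, e.2⟩ _ (cf.trans h) rfl]
  exact add_mem hf hg'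

theorem Conj.proj_eq {f g : T.X} (h : Conj f g) : T.proj f = T.proj g := by
  obtain ⟨k, h1, h2, -⟩ := h
  rw [← T.proj_t_top f, ← h1, T.proj_s_top, ← T.proj_t_top k, h2, T.proj_s_top]

theorem ClsMem.conj (hT : T.IsTrack) {f g : T.X} (hf : ClsMem N f) (hg : T.s n g = T.t n g)
    (h : Conj f g) : ClsMem N g := by
  refine (clsMem_iff (⟨g, hg, h.proj_eq.symm⟩ : T.Loop (T.proj f))).2 ?_
  rw [← Loop.cls_of_conj hT (a := ⟨f, hf.1, rfl⟩) h]
  exact hf.2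

/-- `idMap` acts through a chosen representative of the context. Any other formal composite for the
same context gives a conjugate closed cell, hence the same class, so stability can be applied with
whichever composite is convenient. -/
theorem ClsMem.act {u v : T.presented.X} (hT : T.IsTrack) (hN : IsStable N)
    (l : T.Loop u) (hl : l.cls ∈ N u) {a : Raw T.presented.X (T.presented.cellBdry u).G}
    (ha : (T.presented.cellBdry u).WF a) (h1 : a.count = 1)
    (h : a.eval T.presented T.presented.idFunctor.map (fun _ => u) = v) :
    (l.act a ha h).cls ∈ N v := by
  let c : T.presented.Context u v := ⟨(T.presented.cellBdry u).cls a ha, h1, h⟩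
  have e : (l.act c.rep c.rep_wf c.eval_rep).cls = (l.act a ha h).cls :=
    Loop.act_cls_eq hT l ((T.presented.cellBdry u).rep_rel ha)
  rw [← e, ← idMap_cls]
  exact hN _ _ c _ hl

/-- Stability is applied to the context `x ⋆ᵢ w̄`, where `w̄` is the class of `w`. Its action puts
the chosen representative of `w̄` in the place of `w`; the two `n`-cells are linked, so the two
whiskered cells are conjugate. -/
theorem ClsMem.whisker_right (hT : T.IsTrack) (hN : IsStable N)
    {f w : T.X} (hf : ClsMem N f) (hw : T.s n w = w) {i : ℕ} (hi : i < n)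
    (h : T.t i f = T.s i w) : ClsMem N (T.comp i f w) := by
  obtain ⟨cf, hf⟩ := hf
  have ht : T.t n w = w := by rw [← hw]; exact T.t_s_le _ le_rfl
  have wf : (T.presented.cellBdry (T.proj f)).WF
      (.comp i (.gen PUnit.unit) (.cell (T.proj w))) := by
    refine ⟨trivial, trivial, hi, ?_⟩
    change T.presented.t i (T.proj f) = T.presented.s i (T.proj w)
    rw [T.proj_t _ hi, T.proj_s _ hi, h]
  have key := ClsMem.act hT hN ⟨f, cf, rfl⟩ hf wf rfl rfl
  have c : T.t i f = T.s i (T.sec (T.proj w)) := by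
    refine T.composable_of_proj hi ?_
    rw [T.proj_sec]; exact wf.2.2.2
  refine ClsMem.conj hT ((clsMem_iff _).2 key) ?_
    (conj_comp hi c h (conj_refl cf) (conj_of_proj hT (T.s_sec _) hw (T.proj_sec _)))
  rw [T.s_comp_lt (by omega) hi h, T.t_comp_lt (by omega) hi h, cf, hw, ht]

theorem ClsMem.whisker_left (hT : T.IsTrack) (hN : IsStable N)
    {f w : T.X} (hf : ClsMem N f) (hw : T.s n w = w) {i : ℕ} (hi : i < n)
    (h : T.t i w = T.s i f) : ClsMem N (T.comp i w f) := by
  obtain ⟨cf, hf⟩ := hf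
  have ht : T.t n w = w := by rw [← hw]; exact T.t_s_le _ le_rfl
  have wf : (T.presented.cellBdry (T.proj f)).WF
      (.comp i (.cell (T.proj w)) (.gen PUnit.unit)) := by
    refine ⟨trivial, trivial, hi, ?_⟩
    change T.presented.t i (T.proj w) = T.presented.s i (T.proj f)
    rw [T.proj_t _ hi, T.proj_s _ hi, h]
  have key := ClsMem.act hT hN ⟨f, cf, rfl⟩ hf wf rfl rfl
  have c : T.t i (T.sec (T.proj w)) = T.s i f := by
    refine T.composable_of_proj hi ?_
    rw [T.proj_sec]; exact wf.2.2.2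
  refine ClsMem.conj hT ((clsMem_iff _).2 key) ?_
    (conj_comp hi c h (conj_of_proj hT (T.s_sec _) hw (T.proj_sec _)) (conj_refl cf))
  rw [T.s_comp_lt (by omega) hi h, T.t_comp_lt (by omega) hi h, cf, hw, ht]

/-- By the exchange law, `f ⋆ᵢ g = (f ⋆ᵢ s g) ⋆ₙ (t f ⋆ᵢ g)`. Both factors are whiskerings by
`n`-cells, and membership is closed under `⋆ₙ`. -/
theorem ClsMem.comp_lt (hT : T.IsTrack) (hN : IsStable N)
    {f g : T.X} (hf : ClsMem N f) (hg : ClsMem N g) {i : ℕ} (hi : i < n)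
    (h : T.t i f = T.s i g) : ClsMem N (T.comp i f g) := by
  have hn : n < n + 1 := by omega
  have c1 : T.t i f = T.s i (T.s n g) := by rw [h, T.s_s_lt _ hi]
  have c2 : T.t i (T.t n f) = T.s i g := by rw [T.t_t_lt _ hi, h]
  have e := T.exchange hi hn (x := f) (y := T.t n f) (z := T.s n g) (w := g)
    (T.s_t_le _ le_rfl).symm (T.t_s_le _ le_rfl) c1
  rw [T.comp_id _ hn, T.id_comp _ hn] at e
  rw [e]
  refine (hf.whisker_right hT hN (T.s_s_le _ le_rfl) hi c1).comp
    (hg.whisker_left hT hN (T.s_t_le _ le_rfl) hi c2) ?_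
  rw [T.t_comp_lt (by omega) hi c1, T.s_comp_lt (by omega) hi c2, T.t_s_le _ le_rfl,
    T.s_t_le _ le_rfl]

/-- The subgroups generated by a family of elements of a natural system are stable under the action
of contexts. -/
theorem map_mem_closure {C : NCat.{u} n} (D : C.AbNatSystem) (S : Set (Σ f : C.Ct, D.obj f))
    {f g : C.Ct} (c : f ⟶ g) {x : D.obj f}
    (hx : x ∈ AddSubgroup.closure {y : D.obj f | ∃ a ∈ S, ∃ d : a.1 ⟶ f, y = (D.map d).hom a.2}) :
    (D.map c).hom x ∈
      AddSubgroup.closure {y : D.obj g | ∃ a ∈ S, ∃ c : a.1 ⟶ g, y = (D.map c).hom a.2} := by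
  induction hx using AddSubgroup.closure_induction with
  | mem x hx =>
    obtain ⟨a, ha, d, rfl⟩ := hx
    refine AddSubgroup.subset_closure ⟨a, ha, d ≫ c, ?_⟩
    rw [D.map_comp]; rfl
  | zero => rw [map_zero]; exact zero_mem _
  | add x y _ _ ihx ihy => rw [map_add]; exact add_mem ihx ihy
  | neg x _ ih => rw [map_neg]; exact neg_mem ih

/-- Every element of every group is the class of one closed cell, so generators may be taken to be
closed cells. To generate then means that no stable family of subgroups contains them without
containing everything, the generated subgroups being the smallest stable family. -/
theorem finitelyGenerated_identities_iff (hT : T.IsTrack) :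
    FinitelyGenerated (T.identities hT) ↔ ∃ B : Set T.X, B.Finite ∧ (∀ b ∈ B, T.s n b = T.t n b) ∧
      ∀ N : ∀ u, AddSubgroup (T.IdGroup u), IsStable N → (∀ b ∈ B, ClsMem N b) →
        ∀ f, T.s n f = T.t n f → ClsMem N f := by
  constructor
  · rintro ⟨S, hS, gS⟩
    have exl : ∀ a : (Σ f : T.presented.Ct, (T.identities hT).obj f), ∃ l : T.Loop a.1.cell,
        l.cls = a.2 := fun a => hT.exists_loop (u := a.1.cell) a.2
    choose l hl using exl
    refine ⟨(fun a => (l a).cell) '' S, hS.image _, ?_, ?_⟩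
    · rintro _ ⟨a, -, rfl⟩
      exact (l a).closed
    · intro N hN hB f hf
      refine (clsMem_iff (⟨f, hf, rfl⟩ : T.Loop (T.proj f))).2 ?_
      let M : AddSubgroup ((T.identities hT).obj ⟨T.proj f⟩) := N (T.proj f)
      have key : AddSubgroup.closure {y : (T.identities hT).obj ⟨T.proj f⟩ | ∃ a ∈ S,
          ∃ c : a.1 ⟶ ⟨T.proj f⟩, y = ((T.identities hT).map c).hom a.2} ≤ M := by
        rw [AddSubgroup.closure_le]
        rintro _ ⟨a, ha, c, rfl⟩
        have ha' := (clsMem_iff (l a)).1 (hB _ ⟨a, ha, rfl⟩)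
        rw [hl] at ha'
        exact hN _ _ c _ ha'
      exact key (gS ⟨T.proj f⟩ _)
  · rintro ⟨B, hB, cB, gB⟩
    let D := T.identities hT
    let b (x : B) : Σ f : T.presented.Ct, D.obj f :=
      ⟨⟨T.proj x.1⟩, Loop.cls (⟨x.1, cB x.1 x.2, rfl⟩ : T.Loop (T.proj x.1))⟩
    have := hB.to_subtype
    refine ⟨Set.range b, Set.finite_range b, ?_⟩
    -- The universal property is tested on the family generated by `B` itself.
    let N : ∀ u, AddSubgroup (T.IdGroup u) := fun u =>
      AddSubgroup.closure {y : D.obj ⟨u⟩ | ∃ a ∈ Set.range b, ∃ c : a.1 ⟶ ⟨u⟩,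
        y = (D.map c).hom a.2}
    have hN : IsStable N := fun u v c x hx =>
      map_mem_closure D (Set.range b) (f := ⟨u⟩) (g := ⟨v⟩) c hx
    -- The elements of `B` belong to this family through the identity context.
    have hB' : ∀ x ∈ B, ClsMem N x := fun x hx =>
      ⟨cB x hx, AddSubgroup.subset_closure ⟨b ⟨x, hx⟩, ⟨_, rfl⟩, 𝟙 _, by rw [D.map_id]; rfl⟩⟩
    intro g x
    obtain ⟨l, rfl⟩ := hT.exists_loop (u := g.cell) x
    exact (clsMem_iff l).1 (gB N hN hB' l.cell l.closed)

end closed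

/-! ### Functoriality of identities among relations -/

section functoriality

variable {n : ℕ} {T T' : NCat.{u} (n + 1)} (F : NFunctor T T')

/-- The map induced by a functor on presented cells. -/
noncomputable def mapPresented (u : T.presented.X) : T'.presented.X :=
  T'.proj (F.map (T.sec u))

/-- The choice made by `sec` is immaterial: `F` sends a link between two representatives to a link
between their images. -/
theorem mapPresented_proj (hT : T.IsTrack) (f : T.X) :
    mapPresented F (T.proj f) = T'.proj (F.map f) := by
  obtain ⟨k, h1, h2⟩ := hT.exists_link (T.proj_sec (T.proj f))
  unfold mapPresented
  rw [← T'.proj_s_top, ← F.map_s, ← h1, F.map_s, T'.proj_s_top, ← T'.proj_t_top, ← F.map_t, h2,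
    F.map_s, T'.proj_s_top]

/-- The image of a closed cell under a functor. -/
noncomputable def Loop.map (hT : T.IsTrack) {u : T.presented.X} (l : T.Loop u) :
    T'.Loop (mapPresented F u) where
  cell := F.map l.cell
  closed := by rw [← F.map_s, l.closed, F.map_t]
  proj_eq := by rw [← mapPresented_proj F hT, l.proj_eq]

/-- The map induced by a functor on identities among relations. -/
noncomputable def mapIdGroup (hT : T.IsTrack) (u : T.presented.X) :
    T.IdGroup u →+ T'.IdGroup (mapPresented F u) :=
  QuotientAddGroup.lift _ (FreeAbelianGroup.lift fun l : T.Loop u => (l.map F hT).cls) (by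
    rw [AddSubgroup.closure_le]
    rintro r (⟨a, b, d, h, hd⟩ | ⟨f, g, a, b, h, h', ha, hb⟩)
    · change FreeAbelianGroup.lift _ _ = _
      rw [map_sub, map_add, sub_eq_zero]
      simp only [FreeAbelianGroup.lift_apply_of]
      refine Loop.cls_add _ _ _ ?_ ?_
      · change T'.s n (F.map _) = T'.s n (F.map _)
        rw [← F.map_s, h, F.map_s]
      · change F.map _ = _
        rw [hd, F.map_comp (by omega) (by rw [← a.closed, h])]
        rfl
    · change FreeAbelianGroup.lift _ _ = _
      rw [map_sub, sub_eq_zero]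
      simp only [FreeAbelianGroup.lift_apply_of]
      refine Loop.cls_comm (F.map f) (F.map g) _ _ (map_composable F h) (map_composable F h')
        ?_ ?_
      · exact (congrArg F.map ha).trans (F.map_comp (by omega) h)
      · exact (congrArg F.map hb).trans (F.map_comp (by omega) h'))

theorem mapIdGroup_cls (hT : T.IsTrack) {u : T.presented.X} (l : T.Loop u) :
    mapIdGroup F hT u l.cls = (l.map F hT).cls := by
  change FreeAbelianGroup.lift _ _ = _
  rw [FreeAbelianGroup.lift_apply_of]

variable {N : ∀ u, AddSubgroup (T'.IdGroup u)}

/-- The image under `F` of a cell `B[f]` is `F f` whiskered by images of `n`-cells, so it stays in a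
stable family. The induction must also carry the composites without occurrence of the formal cell,
since these supply the whiskering `n`-cells; at a composition with one occurrence, exactly one
factor contains it. -/
theorem clsMem_map_evalLift (hT' : T'.IsTrack) (hN : IsStable N)
    {f : T.X} (hf : ClsMem N (F.map f))
    {a : Raw T.presented.X (T.presented.cellBdry (T.proj f)).G}
    (ha : (T.presented.cellBdry (T.proj f)).WF a) :
    (a.count = 0 → T'.s n (F.map (T.evalLift f a)) = F.map (T.evalLift f a)) ∧
      (a.count = 1 → ClsMem N (F.map (T.evalLift f a))) := by
  induction a with
  | cell x =>
    refine ⟨fun _ => ?_, fun h => absurd h zero_ne_one⟩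
    change T'.s n (F.map (T.sec x)) = F.map (T.sec x)
    rw [← F.map_s, T.s_sec]
  | gen γ => exact ⟨fun h => absurd h one_ne_zero, fun _ => hf⟩
  | comp i a b iha ihb =>
    have hi := ha.2.2.1
    have c := T.evalLift_composable f ha
    have c' := map_composable F c
    have e : F.map (T.evalLift f (.comp i a b)) =
        T'.comp i (F.map (T.evalLift f a)) (F.map (T.evalLift f b)) :=
      F.map_comp (by omega) c
    rw [e]
    have iha := iha ha.1
    have ihb := ihb ha.2.1
    simp only [Raw.count]
    refine ⟨fun h => ?_, fun h => ?_⟩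
    · rw [T'.s_comp_lt (by omega) hi c', iha.1 (by omega), ihb.1 (by omega)]
    · by_cases h0 : a.count = 0
      · exact (ihb.2 (by omega)).whisker_left hT' hN (iha.1 h0) hi c'
      · exact (iha.2 (by omega)).whisker_right hT' hN (ihb.1 (by omega)) hi c'

/-- This says that the inverse image along `F` of a stable family on `T'` is a stable family on `T`.
It takes the place of naturality of `mapIdGroup`, without constructing the action of `F` on
contexts. -/
theorem mapIdGroup_idMap_mem (hT : T.IsTrack) (hT' : T'.IsTrack) (hN : IsStable N)
    {u v : T.presented.X} (c : T.presented.Context u v) {x : T.IdGroup u}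
    (hx : mapIdGroup F hT u x ∈ N _) : mapIdGroup F hT v (idMap c x) ∈ N _ := by
  obtain ⟨l, rfl⟩ := hT.exists_loop x
  rw [mapIdGroup_cls, ← clsMem_iff] at hx
  rw [idMap_cls, mapIdGroup_cls, ← clsMem_iff]
  obtain ⟨f, hf, rfl⟩ := l
  exact (clsMem_map_evalLift F hT' hN hx c.rep_wf).2
    ((congrArg occ ((T.presented.cellBdry _).cls_rep c.cell)).trans c.occ_eq)

theorem clsMem_comap (hT : T.IsTrack) (f : T.X) (hf : T.s n f = T.t n f) :
    ClsMem (fun u => (N (mapPresented F u)).comap (mapIdGroup F hT u)) f ↔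
      ClsMem N (F.map f) := by
  refine (clsMem_iff (⟨f, hf, rfl⟩ : T.Loop (T.proj f))).trans (Iff.trans ?_ (clsMem_iff
    ((⟨f, hf, rfl⟩ : T.Loop (T.proj f)).map F hT)).symm)
  rw [AddSubgroup.mem_comap, mapIdGroup_cls]

end functoriality

end NCat

namespace NCat

/-! ### Transformations to the identity -/

/-- A family of `(n + 1)`-cells `κ x : H x → x`, for the `n`-cells `x` of `T`, that is compatible
with the compositions of `n`-cells. -/
structure ToId {n : ℕ} {T : NCat.{u} (n + 1)} (H : NFunctor T T) where
  κ : T.X → T.X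
  s_κ : ∀ x, T.s n x = x → T.s n (κ x) = H.map x
  t_κ : ∀ x, T.s n x = x → T.t n (κ x) = x
  κ_comp : ∀ i x y, i < n → T.s n x = x → T.s n y = y → T.t i x = T.s i y →
      κ (T.comp i x y) = T.comp i (κ x) (κ y)

namespace ToId

variable {n : ℕ} {T : NCat.{u} (n + 1)} {H : NFunctor T T} (K : ToId H)

/-- The closed cell `l` measures the defect of naturality of `K` at `f`. -/
structure Defect (f l : T.X) : Prop where
  s_eq : T.s n l = T.t n f
  t_eq : T.t n l = T.t n f
  comp_eq : T.comp n (T.comp n (H.map f) (K.κ (T.t n f))) l = T.comp n (K.κ (T.s n f)) f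

theorem s_κ_s (f : T.X) : T.s n (K.κ (T.s n f)) = T.s n (H.map f) := by
  rw [K.s_κ _ (T.s_s_le f le_rfl), H.map_s]

theorem t_κ_s (f : T.X) : T.t n (K.κ (T.s n f)) = T.s n f := K.t_κ _ (T.s_s_le f le_rfl)

theorem s_κ_t (f : T.X) : T.t n (H.map f) = T.s n (K.κ (T.t n f)) := by
  rw [K.s_κ _ (T.s_t_le f le_rfl), H.map_t]

theorem t_κ_t (f : T.X) : T.t n (K.κ (T.t n f)) = T.t n f := K.t_κ _ (T.s_t_le f le_rfl)

theorem t_comp_κ (f : T.X) : T.t n (T.comp n (H.map f) (K.κ (T.t n f))) = T.t n f := by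
  rw [T.t_comp (by omega) (K.s_κ_t f), K.t_κ_t]

/-- The paths `H f ⋆ κ (t f)` and `κ (s f) ⋆ f` are parallel, so the second can be divided on the
left by the first. -/
theorem exists_defect (hT : T.IsTrack) (f : T.X) : ∃ l, K.Defect f l := by
  have hn : n < n + 1 := by omega
  obtain ⟨l, h1, h2, h3⟩ := hT.exists_comp_eq
    (a := T.comp n (H.map f) (K.κ (T.t n f))) (b := T.comp n (K.κ (T.s n f)) f)
    (by rw [T.s_comp hn (K.s_κ_t f), T.s_comp hn (K.t_κ_s f), K.s_κ_s])
  exact ⟨l, by rw [h1, K.t_comp_κ], by rw [h2, T.t_comp hn (K.t_κ_s f)], h3⟩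

theorem defect_cell {x : T.X} (hx : T.s n x = x) : K.Defect x x := by
  have ht : T.t n x = x := by rw [← hx]; exact T.t_s_le _ le_rfl
  refine ⟨hx.trans ht.symm, rfl, ?_⟩
  rw [ht, hx]
  congr 1
  have := T.id_comp (K.κ x) (i := n) (by omega)
  rwa [K.s_κ x hx] at this

variable {K}

/-- `H` and `κ` both respect `⋆ᵢ`, so repeated use of the exchange law composes the two defining
equations along dimension `i`. -/
theorem Defect.comp_lt {f g l m : T.X} (hl : K.Defect f l) (hm : K.Defect g m) {i : ℕ}
    (hi : i < n) (h : T.t i f = T.s i g) :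
    T.t i l = T.s i m ∧ K.Defect (T.comp i f g) (T.comp i l m) := by
  have hn : n < n + 1 := by omega
  have hi' : i < n + 1 := by omega
  have e1 : T.t i (T.s n f) = T.s i (T.s n g) := by rw [T.t_s_lt _ hi, T.s_s_lt _ hi, h]
  have e2 : T.t i (T.t n f) = T.s i (T.t n g) := by rw [T.t_t_lt _ hi, T.s_t_lt _ hi, h]
  have e3 : T.t i l = T.s i m := by
    rw [← T.t_s_lt l hi, ← T.s_s_lt m hi, hl.s_eq, hm.s_eq, e2]
  have e4 := map_composable H h
  have e5 : T.t i (K.κ (T.s n f)) = T.s i (K.κ (T.s n g)) := by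
    rw [← T.t_t_lt _ hi, K.t_κ_s, ← T.s_t_lt (K.κ (T.s n g)) hi, K.t_κ_s, e1]
  have e6 : T.t i (T.comp n (H.map f) (K.κ (T.t n f))) =
      T.s i (T.comp n (H.map g) (K.κ (T.t n g))) := by
    rw [← T.t_t_lt _ hi, K.t_comp_κ, ← T.s_t_lt _ hi, K.t_comp_κ, e2]
  refine ⟨e3, ?_, ?_, ?_⟩
  · rw [T.s_comp_lt hi' hi e3, T.t_comp_lt hi' hi h, hl.s_eq, hm.s_eq]
  · rw [T.t_comp_lt hi' hi e3, T.t_comp_lt hi' hi h, hl.t_eq, hm.t_eq]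
  · rw [T.t_comp_lt hi' hi h, T.s_comp_lt hi' hi h, H.map_comp hi' h,
      K.κ_comp i _ _ hi (T.s_t_le f le_rfl) (T.s_t_le g le_rfl) e2,
      K.κ_comp i _ _ hi (T.s_s_le f le_rfl) (T.s_s_le g le_rfl) e1,
      ← T.exchange hi hn (K.s_κ_t f) (K.s_κ_t g) e4,
      ← T.exchange hi hn ((K.t_comp_κ f).trans hl.s_eq.symm) ((K.t_comp_κ g).trans hm.s_eq.symm) e6,
      hl.comp_eq, hm.comp_eq, T.exchange hi hn (K.t_κ_s f) (K.t_κ_s g) e5]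

/-- With `l'` the conjugate of `l` by `g`, so that `l ⋆ g = g ⋆ l'`, and with `f : a → b`, `g : b →
c`, one computes `κ a ⋆ f ⋆ g = H f ⋆ κ b ⋆ l ⋆ g = H f ⋆ κ b ⋆ g ⋆ l' = H f ⋆ H g ⋆ κ c ⋆ m ⋆ l'`.
Hence the order `m ⋆ l'` in the result. -/
theorem Defect.comp_top (hT : T.IsTrack) {f g l m : T.X} (hl : K.Defect f l) (hm : K.Defect g m)
    (h : T.t n f = T.s n g) :
    ∃ l', T.s n l' = T.t n l' ∧ Conj l l' ∧ T.t n m = T.s n l' ∧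
      K.Defect (T.comp n f g) (T.comp n m l') := by
  have hn : n < n + 1 := by omega
  obtain ⟨l', i1, i2, i3, i4⟩ := hT.exists_conj (f := l) (g := g) (hl.s_eq.trans hl.t_eq.symm)
    (h.symm.trans hl.t_eq.symm)
  have ml : T.t n m = T.s n l' := by rw [hm.t_eq, i1]
  refine ⟨l', i1.trans i2.symm, i4, ml, ?_, ?_, ?_⟩
  · rw [T.s_comp hn ml, T.t_comp hn h, hm.s_eq]
  · rw [T.t_comp hn ml, T.t_comp hn h, i2]
  · have a1 := K.s_κ_t f
    have a2 := K.s_κ_t g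
    have a3 := map_composable H h
    have a4 := K.t_comp_κ f
    have a5 := K.t_comp_κ g
    have a6 : T.t n (K.κ (T.t n f)) = T.s n g := (K.t_κ_t f).trans h
    have a7 : T.s n (T.comp n (H.map g) (K.κ (T.t n g))) = T.s n (H.map g) := T.s_comp hn a2
    have a8 : T.comp n (K.κ (T.t n f)) g =
        T.comp n (T.comp n (H.map g) (K.κ (T.t n g))) m := by rw [h, hm.comp_eq]
    rw [T.t_comp hn h, T.s_comp hn h, H.map_comp hn h, ← T.assoc hn (K.t_κ_s f) h, ← hl.comp_eq,
      T.assoc hn (a4.trans hl.s_eq.symm) (hl.t_eq.trans h), i3,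
      ← T.assoc hn (a4.trans h) i1.symm, T.assoc hn a1 a6, a8,
      ← T.assoc hn (a3.trans a7.symm) (a5.trans hm.s_eq.symm), ← T.assoc hn a3 a2,
      T.assoc hn _ ml]
    rw [T.t_comp hn (by rw [T.t_comp hn a3, a2]), K.t_κ_t, hm.s_eq]

/-- For `f` closed on `b`, let `q` be the conjugate of `H f` by `κ b`. The defining equation becomes
`κ b ⋆ q ⋆ l = κ b ⋆ f`, and `κ b` cancels. This is the decomposition `⌊f⌋ = ⌊H f⌋ + ⌊l⌋` at the
level of cells. -/
theorem Defect.exists_conj (hT : T.IsTrack) {f l : T.X} (hl : K.Defect f l)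
    (hf : T.s n f = T.t n f) :
    ∃ q, T.s n q = T.t n q ∧ Conj (H.map f) q ∧ T.t n q = T.s n l ∧ T.comp n q l = f := by
  have hn : n < n + 1 := by omega
  obtain ⟨q, q1, q2, q3, q4⟩ := hT.exists_conj (f := H.map f) (g := K.κ (T.t n f))
    (by rw [← H.map_s, hf, H.map_t]) (K.s_κ_t f).symm
  rw [K.t_κ_t] at q1 q2
  have ql : T.t n q = T.s n l := q2.trans hl.s_eq.symm
  refine ⟨q, q1.trans q2.symm, q4, ql, ?_⟩
  have e := hl.comp_eq
  rw [hf, q3, T.assoc hn (by rw [K.t_κ_t, q1]) ql] at e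
  exact hT.comp_left_cancel (by rw [K.t_κ_t, T.s_comp hn ql, q1]) (by rw [K.t_κ_t, hf]) e

end ToId

/-! ### Transfer of finite generation along a transformation to the identity -/

section

variable {n : ℕ} {T T' : NCat.{u} (n + 1)}

/-- Let `F : T → T'` and `G : T' → T` be functors between track categories, with a transformation
from `F ∘ G` to the identity. If `T'` is generated by its `n`-cells and by finitely many
`(n + 1)`-cells, and if the identities among relations of `T` are finitely generated, then so are
those of `T'`. -/
theorem finitelyGenerated_of_toId (hT : T.IsTrack) (hT' : T'.IsTrack) (F : NFunctor T T')
    (G : NFunctor T' T) (K : ToId (compFunctor G F)) {Γ : Set T'.X} (hΓ : Γ.Finite)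
    (ind : ∀ p : T'.X → Prop, (∀ x, T'.s n x = x → p x) → (∀ γ ∈ Γ, p γ) →
      (∀ i x y, i < n + 1 → T'.t i x = T'.s i y → p x → p y → p (T'.comp i x y)) → ∀ x, p x)
    (h : FinitelyGenerated (T.identities hT)) : FinitelyGenerated (T'.identities hT') := by
  obtain ⟨B, hB, cB, gB⟩ := (finitelyGenerated_identities_iff hT).1 h
  choose L hL using K.exists_defect hT'
  refine (finitelyGenerated_identities_iff hT').2
    -- The generating family: the images of the generators of `Π(T)`, and one defect for each
    -- generating `(n + 1)`-cell of `T'`.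
    ⟨F.map '' B ∪ L '' Γ, (hB.image _).union (hΓ.image _), ?_, fun N hN hBN f hf => ?_⟩
  · rintro _ (⟨b, hb, rfl⟩ | ⟨γ, -, rfl⟩)
    · rw [← F.map_s, cB b hb, F.map_t]
    · exact (hL γ).s_eq.trans (hL γ).t_eq.symm
  -- Pulled back along `F`, the family `N` is stable and contains `B`, so it contains every closed
  -- cell of `T`.
  have memF : ∀ f : T.X, T.s n f = T.t n f → ClsMem N (F.map f) := fun f hf =>
    (clsMem_comap F hT f hf).1 (gB _
      (fun u v c x hx => mapIdGroup_idMap_mem F hT hT' hN c hx)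
      (fun b hb => (clsMem_comap F hT b (cB b hb)).2 (hBN _ (.inl ⟨b, hb, rfl⟩))) f hf)
  -- The induction ranges over all `(n + 1)`-cells, closed or not: a closed cell is in general a
  -- composite of cells that are not closed, but each of these has a closed defect.
  have good : ∀ f : T'.X, ∃ l, ClsMem N l ∧ K.Defect f l := by
    refine ind _ ?_ ?_ ?_
    · exact fun x hx => ⟨x, clsMem_cell hx, K.defect_cell hx⟩
    · exact fun γ hγ => ⟨L γ, hBN _ (.inr ⟨γ, hγ, rfl⟩), hL γ⟩
    · rintro i f g hi h ⟨l, hl, l'⟩ ⟨m, hm, m'⟩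
      rcases (Nat.lt_succ_iff.1 hi).lt_or_eq with hi | rfl
      · obtain ⟨c, d⟩ := l'.comp_lt m' hi h
        exact ⟨_, hl.comp_lt hT' hN hm hi c, d⟩
      · obtain ⟨k, k1, k2, k3, d⟩ := l'.comp_top hT' m' h
        exact ⟨_, hm.comp (hl.conj hT' k1 k2) k3, d⟩
  -- Here `f = q ⋆ l`, where `q` is conjugate to `F (G f)` and `l` is a defect lying in `N`.
  obtain ⟨l, hl, d⟩ := good f
  obtain ⟨q, q1, q2, q3, e⟩ := d.exists_conj hT' hf
  rw [← e]
  refine ClsMem.comp (ClsMem.conj hT' (memF (G.map f) ?_) q1 q2) hl q3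
  rw [← G.map_s, hf, G.map_t]

end

end NCat

namespace NCat

/-! ### Functors out of quotients and free track categories -/

theorem CellExt.Cong.map {n : ℕ} {C D : NCat.{u} n} (F : NFunctor C D) {E : CellExt C}
    {E' : CellExt D} (h : ∀ γ, E'.Cong (F.map (E.src γ)) (F.map (E.tgt γ))) {x y : C.X}
    (hxy : E.Cong x y) : E'.Cong (F.map x) (F.map y) := by
  induction hxy with
  | of γ => exact h γ
  | refl x => exact .refl _
  | symm _ ih => exact ih.symm
  | trans _ _ ih ih' => exact ih.trans ih'
  | comp hi c c' _ _ ih ih' =>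
    rw [F.map_comp hi c, F.map_comp hi c']
    exact .comp hi (map_composable F c) (map_composable F c') ih ih'

theorem quotMk_eq_iff {n : ℕ} {C : NCat.{u} n} {E : CellExt C} {x y : C.X} :
    quotMk E x = quotMk E y ↔ E.Cong x y :=
  ⟨fun h => Quotient.exact h, fun h => Quotient.sound (s := E.setoid) h⟩

/-- The projection onto a quotient, as a functor. -/
noncomputable def quotFunctor {n : ℕ} {C : NCat.{u} n} (E : CellExt C) :
    NFunctor C (C.quot E) where
  map := quotMk E
  map_s _ _ := rfl
  map_t _ _ := rfl
  map_comp hi h := (quotComp_mk E hi h).symm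

/-- The universal property of a quotient. -/
noncomputable def quotLift {n : ℕ} {C D : NCat.{u} n} (E : CellExt C) (F : NFunctor C D)
    (h : ∀ γ, F.map (E.src γ) = F.map (E.tgt γ)) : NFunctor (C.quot E) D where
  map := Quotient.lift F.map fun x y hxy => by
    induction (show E.Cong x y from hxy) with
    | of γ => exact h γ
    | refl x => rfl
    | symm h ih => exact (ih h).symm
    | trans h h' ih ih' => exact (ih h).trans (ih' h')
    | comp hi c c' h h' ih ih' => rw [F.map_comp hi c, F.map_comp hi c', ih h, ih' h']
  map_s i a := Quotient.inductionOn a fun x => F.map_s i x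
  map_t i a := Quotient.inductionOn a fun x => F.map_t i x
  map_comp {i a b} hi := Quotient.inductionOn₂ a b fun x y h => by
    have h := quot_composable E hi h
    exact (congrArg _ (quotComp_mk E hi h)).trans (F.map_comp hi h)

/-- A functor between `n`-categories, seen as a functor between `(n + 1)`-categories. -/
def promoteFunctor {n : ℕ} {C D : NCat.{u} n} (F : NFunctor C D) :
    NFunctor C.promote D.promote where
  map := F.map
  map_s := F.map_s
  map_t := F.map_t
  map_comp {i x y} _ h := by
    by_cases hi : i < n
    · simp only [promote, hi, if_true]; exact F.map_comp hi h
    · simp only [promote, hi]; rfl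

theorem map_promote_s {n : ℕ} {C : NCat.{u} n} {T : NCat.{u} (n + 1)}
    (F : NFunctor C.promote T) (x : C.X) : T.s n (F.map x) = F.map x :=
  (F.map_s n x).symm.trans (congrArg F.map (C.s_top x le_rfl))

theorem map_promote_comp {n : ℕ} {C : NCat.{u} n} {T : NCat.{u} (n + 1)}
    (F : NFunctor C.promote T) {i : ℕ} (hi : i < n) {x y : C.X} (h : C.t i x = C.s i y) :
    F.map (C.comp i x y) = T.comp i (F.map x) (F.map y) := by
  have := F.map_comp (i := i) (x := x) (y := y) (by omega) h
  simp only [promote, hi, if_true] at this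
  exact this

/-- A functor from an `n`-category to an `(n + 1)`-category takes its values in `n`-cells. -/
def truncFunctor {n : ℕ} {C : NCat.{u} n} {T : NCat.{u} (n + 1)} (F : NFunctor C.promote T) :
    NFunctor C T.trunc where
  map x := ⟨F.map x, map_promote_s F x⟩
  map_s i x := Subtype.ext (F.map_s i x)
  map_t i x := Subtype.ext (F.map_t i x)
  map_comp {i x y} hi h := Subtype.ext (by
    change F.map (C.comp i x y) = T.s n (T.comp i (F.map x) (F.map y))
    rw [← map_promote_comp F hi h, map_promote_s])

/-- The `n`-category whose `n`-cells are the `(n + 1)`-cells of `T`, with the compositions along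
cells of dimension less than `n`. -/
def forgetTop {n : ℕ} (T : NCat.{u} (n + 1)) : NCat.{u} n where
  X := T.X
  s i x := if i < n then T.s i x else x
  t i x := if i < n then T.t i x else x
  comp := T.comp
  s_s_lt {i j} x h := by
    by_cases hj : j < n
    · simp only [hj, h.trans hj, if_true, T.s_s_lt x h]
    · simp only [hj, if_false]
  s_t_lt {i j} x h := by
    by_cases hj : j < n
    · simp only [hj, h.trans hj, if_true, T.s_t_lt x h]
    · simp only [hj, if_false]
  t_s_lt {i j} x h := by
    by_cases hj : j < n
    · simp only [hj, h.trans hj, if_true, T.t_s_lt x h]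
    · simp only [hj, if_false]
  t_t_lt {i j} x h := by
    by_cases hj : j < n
    · simp only [hj, h.trans hj, if_true, T.t_t_lt x h]
    · simp only [hj, if_false]
  s_s_le {i j} x h := by
    by_cases hi : i < n
    · simp only [hi, h.trans_lt hi, if_true, T.s_s_le x h]
    · simp only [hi, if_false]
  s_t_le {i j} x h := by
    by_cases hi : i < n
    · simp only [hi, h.trans_lt hi, if_true, T.s_t_le x h]
    · simp only [hi, if_false]
  t_s_le {i j} x h := by
    by_cases hi : i < n
    · simp only [hi, h.trans_lt hi, if_true, T.t_s_le x h]
    · simp only [hi, if_false]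
  t_t_le {i j} x h := by
    by_cases hi : i < n
    · simp only [hi, h.trans_lt hi, if_true, T.t_t_le x h]
    · simp only [hi, if_false]
  s_top x h := if_neg (by omega)
  t_top x h := if_neg (by omega)
  s_comp {i x y} hi h := by
    simp only [hi, if_true] at h ⊢
    exact T.s_comp (by omega) h
  t_comp {i x y} hi h := by
    simp only [hi, if_true] at h ⊢
    exact T.t_comp (by omega) h
  s_comp_lt {i j x y} hi hij h := by
    simp only [hi, if_true] at h
    by_cases hj : j < n
    · simp only [hj, if_true]; exact T.s_comp_lt (by omega) hij h
    · simp only [hj, if_false]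
  t_comp_lt {i j x y} hi hij h := by
    simp only [hi, if_true] at h
    by_cases hj : j < n
    · simp only [hj, if_true]; exact T.t_comp_lt (by omega) hij h
    · simp only [hj, if_false]
  id_comp {i} x hi := by
    simp only [hi, if_true]; exact T.id_comp x (by omega)
  comp_id {i} x hi := by
    simp only [hi, if_true]; exact T.comp_id x (by omega)
  assoc {i x y z} hi h h' := by
    simp only [hi, if_true] at h h'
    exact T.assoc (by omega) h h'
  exchange {i j x y z w} hij hj h h' h'' := by
    simp only [hj, hij.trans hj, if_true] at h h' h''
    exact T.exchange hij (by omega) h h' h''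

/-- The commutation relations are imposed on closed cells of `T` only. They reach every closed cell
of the quotient because congruent `(n + 1)`-cells have equal boundaries, so representatives of
closed cells are already closed, and have a common base point in `T` when their classes do. -/
theorem abelianized_comm {n : ℕ} (T : NCat.{u} (n + 1)) (f g : T.abelianized.X)
    (hf : T.abelianized.s n f = T.abelianized.t n f)
    (hg : T.abelianized.s n g = T.abelianized.t n g)
    (h : T.abelianized.s n f = T.abelianized.s n g) :
    T.abelianized.comp n f g = T.abelianized.comp n g f := by
  have hn : n < n + 1 := by omega
  induction f using Quotient.inductionOn with | _ f
  induction g using Quotient.inductionOn with | _ g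
  have key : ∀ {a b : T.X}, Quotient.mk T.commSpheres.setoid (T.s n a) =
      Quotient.mk T.commSpheres.setoid (T.s n b) → T.s n a = T.s n b := fun {a b} hab => by
    rw [← T.t_s_le a le_rfl]
    exact quot_composable T.commSpheres hn
      (Eq.trans (congrArg _ (T.t_s_le a le_rfl)) hab)
  have hf : T.s n f = T.t n f := (quot_composable T.commSpheres hn hf.symm).symm
  have hg : T.s n g = T.t n g := (quot_composable T.commSpheres hn hg.symm).symm
  have h := key h
  refine (quotComp_mk T.commSpheres hn (hf.symm.trans h)).trans (Eq.trans ?_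
    (quotComp_mk T.commSpheres hn (hg.symm.trans h.symm)).symm)
  exact Quotient.sound (s := T.commSpheres.setoid)
    (CellExt.Cong.of (E := T.commSpheres) ⟨(f, g), hf, hg, h⟩)

/-! ### The abelianized free track category on a cellular extension -/

section abTrack

variable {n : ℕ} {C : NCat.{u} n} (E : CellExt C)

/-- The inclusion of `C` into the abelianized free track category on a cellular extension. -/
noncomputable def trackCell : NFunctor C.promote (C.track E).abelianized :=
  compFunctor (compFunctor (C.promote.incl E.double.bdry) (quotFunctor E.inv))
    (quotFunctor (C.track E).commSpheres)

/-- The generators of the abelianized free track category on a cellular extension, and their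
inverses. -/
noncomputable def trackGen (γ : E.G ⊕ E.G) : (C.track E).abelianized.X :=
  quotMk (C.track E).commSpheres (quotMk E.inv (freeExtGen E.double γ))

theorem s_trackGen (γ : E.G ⊕ E.G) :
    (C.track E).abelianized.s n (trackGen E γ) = (trackCell E).map (E.double.src γ) := by
  refine congrArg (fun z => quotMk (C.track E).commSpheres (quotMk E.inv z))
    ((freeExt_s_gen E.double γ (by omega)).trans ?_)
  rw [C.s_top _ le_rfl]; rfl

theorem t_trackGen (γ : E.G ⊕ E.G) :
    (C.track E).abelianized.t n (trackGen E γ) = (trackCell E).map (E.double.tgt γ) := by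
  refine congrArg (fun z => quotMk (C.track E).commSpheres (quotMk E.inv z))
    ((freeExt_t_gen E.double γ (by omega)).trans ?_)
  rw [C.t_top _ le_rfl]; rfl

/-- No step of the construction identifies distinct `n`-cells: adjoining `(n + 1)`-cells keeps the
`n`-sources of formal composites, and both quotients identify only cells with equal boundaries. An
`n`-cell is recovered as its own `n`-source. -/
theorem trackCell_injective : Function.Injective (trackCell E).map := by
  intro x y h
  have hn : n < n + 1 := by omega
  have key : ∀ {T : NCat.{u} (n + 1)} (E' : CellExt T) {a b : T.X}, T.s n a = a → T.s n b = b →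
      quotMk E' a = quotMk E' b → a = b := fun {T} E' {a b} ha hb hab => by
    rw [← ha, ← hb]
    exact ((quotMk_eq_iff.1 hab).bdry n hn).1
  have hc := map_promote_s (C.promote.incl E.double.bdry)
  have h2 := key E.inv (hc x) (hc y) (key _ (congrArg (quotMk E.inv) (hc x))
    (congrArg (quotMk E.inv) (hc y)) h)
  exact (C.s_top x le_rfl).symm.trans
    (((Bdry.cls_eq_iff.1 h2).spec.2.2 n hn).1.trans (C.s_top y le_rfl))

/-- The formal inverses count among the generators, so the induction has no case for inversion. With
`E` finite, the family `trackGen E` is still finite. -/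
theorem track_ind {p : (C.track E).abelianized.X → Prop}
    (cell : ∀ x, p ((trackCell E).map x)) (gen : ∀ γ, p (trackGen E γ))
    (comp : ∀ i x y, i < n + 1 →
      (C.track E).abelianized.t i x = (C.track E).abelianized.s i y →
      p x → p y → p ((C.track E).abelianized.comp i x y))
    (x : (C.track E).abelianized.X) : p x := by
  induction x using Quotient.inductionOn with | _ x
  induction x using Quotient.inductionOn with | _ x
  refine adjoin_ind (C := C.promote) (B := E.double.bdry)
    (p := fun x => p (quotMk (C.track E).commSpheres (quotMk E.inv x))) cell gen ?_ x
  intro i x y hi h hx hy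
  have e := (quotFunctor E.inv).map_comp hi h
  have e' := (quotFunctor (C.track E).commSpheres).map_comp hi
    (map_composable (quotFunctor E.inv) h)
  refine (congrArg p ((congrArg _ e).trans e')).mpr (comp i _ _ hi ?_ hx hy)
  exact map_composable (quotFunctor (C.track E).commSpheres)
    (map_composable (quotFunctor E.inv) h)

/-- The only new cells are in dimension `n + 1`. In the case of `⋆ᵢ` with `i < n`,
`trackCell_injective` is what makes the preimages of the two sources composable in `C`. -/
theorem exists_trackCell (f : (C.track E).abelianized.X) :
    ∃ x, (trackCell E).map x = (C.track E).abelianized.s n f := by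
  have hn : n < n + 1 := by omega
  refine track_ind E
    (p := fun f => ∃ x, (trackCell E).map x = (C.track E).abelianized.s n f)
    (fun x => ⟨x, (map_promote_s (C := C) (trackCell E) x).symm⟩)
    (fun γ => ⟨_, (s_trackGen E γ).symm⟩) ?_ f
  rintro i f g hi h ⟨x, hx⟩ ⟨y, hy⟩
  rcases (Nat.lt_succ_iff.1 hi).lt_or_eq with hi' | rfl
  · refine ⟨C.comp i x y, ?_⟩
    have e : C.t i x = C.s i y := by
      apply trackCell_injective E
      refine ((trackCell E).map_t i x).trans (Eq.trans ?_ ((trackCell E).map_s i y).symm)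
      rw [hx, hy, NCat.t_s_lt _ _ hi', NCat.s_s_lt _ _ hi', h]
    rw [map_promote_comp _ hi' e, hx, hy, NCat.s_comp_lt _ hi hi' h]
  · exact ⟨x, by rw [hx, NCat.s_comp _ hi h]⟩

/-- Each sphere of `E` is filled by its generator in the track category, so the congruence generated
by `E` maps into the one generated by all the `(n + 1)`-cells, where congruent cells are linked. -/
theorem exists_of_cong_trackCell {x y : C.X} (h : E.Cong x y) :
    ∃ f, (C.track E).abelianized.s n f = (trackCell E).map x ∧
      (C.track E).abelianized.t n f = (trackCell E).map y := by
  refine exists_of_cong ((isTrack_track C E).quot _)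
    (CellExt.Cong.map (truncFunctor (trackCell E)) (fun γ => ?_) h)
  have := CellExt.Cong.of (E := (C.track E).abelianized.topCells) (trackGen E (.inl γ))
  have hs : (C.track E).abelianized.topCells.src (trackGen E (.inl γ)) =
      (truncFunctor (trackCell E)).map (E.src γ) := Subtype.ext (s_trackGen E (.inl γ))
  have ht : (C.track E).abelianized.topCells.tgt (trackGen E (.inl γ)) =
      (truncFunctor (trackCell E)).map (E.tgt γ) := Subtype.ext (t_trackGen E (.inl γ))
  rwa [hs, ht] at this

/-- Extension of functors to the abelianized free track category on a cellular extension. -/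
theorem exists_trackLift {D : NCat.{u} (n + 1)} (hD : D.IsTrack)
    (comm : ∀ f g, D.s n f = D.t n f → D.s n g = D.t n g → D.s n f = D.s n g →
      D.comp n f g = D.comp n g f)
    (φ : NFunctor C.promote D)
    (h : ∀ γ, ∃ f, D.s n f = φ.map (E.src γ) ∧ D.t n f = φ.map (E.tgt γ)) :
    ∃ F : NFunctor (C.track E).abelianized D,
      ∀ x, F.map ((trackCell E).map x) = φ.map x := by
  have hn : n < n + 1 := by omega
  choose f hs ht using h
  choose inv hinv using hD
  -- A formal inverse goes to a chosen inverse of the image of its generator; this makes the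
  -- relations of `E.inv` hold in `D`.
  let ψ : E.G ⊕ E.G → D.X := Sum.elim f fun γ => inv (f γ)
  have ψs : ∀ γ, D.s n (ψ γ) = φ.map (E.double.src γ) := by
    rintro (γ | γ)
    · exact hs γ
    · exact (hinv _).s_eq.trans (ht γ)
  have ψt : ∀ γ, D.t n (ψ γ) = φ.map (E.double.tgt γ) := by
    rintro (γ | γ)
    · exact ht γ
    · exact (hinv _).t_eq.trans (hs γ)
  have ψc : ∀ γ, D.comp n (ψ γ) (ψ γ.swap) = φ.map (E.double.src γ) := by
    rintro (γ | γ)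
    · exact (hinv _).right_inv.trans (hs γ)
    · exact (hinv _).left_inv.trans (ht γ)
  let F₁ : NFunctor (C.freeExt E.double) D := lift (C := C.promote) (B := E.double.bdry) φ ψ
    (fun i hi γ => by
      refine Eq.trans ?_ (φ.map_s i (E.double.src γ)).symm
      refine Eq.trans ?_ (congrArg (D.s i) (ψs γ))
      rcases (Nat.lt_succ_iff.1 hi).lt_or_eq with hi | rfl
      · rw [D.s_s_lt _ hi]
      · rw [D.s_s_le _ le_rfl])
    (fun i hi γ => by
      refine Eq.trans ?_ (φ.map_t i (E.double.tgt γ)).symm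
      refine Eq.trans ?_ (congrArg (D.t i) (ψt γ))
      rcases (Nat.lt_succ_iff.1 hi).lt_or_eq with hi | rfl
      · rw [D.t_t_lt _ hi]
      · rw [D.t_t_le _ le_rfl])
  let F₂ : NFunctor (C.track E) D := quotLift E.inv F₁ fun γ => by
    refine (F₁.map_comp hn (freeExt_composable E.double (by cases γ <;> rfl))).trans ?_
    exact ψc γ
  refine ⟨quotLift (C.track E).commSpheres F₂ ?_, fun x => rfl⟩
  -- The images of `a` and `b` are again closed with a common base point, so `comm` applies to them.
  rintro ⟨⟨a, b⟩, ha, hb, hab⟩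
  dsimp only at ha hb hab
  refine (F₂.map_comp hn (ha.symm.trans hab)).trans
    (Eq.trans ?_ (F₂.map_comp hn (hb.symm.trans hab.symm)).symm)
  refine comm _ _ ?_ ?_ ?_
  · rw [← F₂.map_s, ha, F₂.map_t]
  · rw [← F₂.map_s, hb, F₂.map_t]
  · rw [← F₂.map_s, hab, F₂.map_s]

end abTrack

end NCat

/-! ### Functors and transformations out of free categories on polygraphs -/

namespace Polygraph

/-- Functors out of the free category on a polygraph can be chosen in a given relation, provided
that the relation is total, is compatible with the operations, and determines boundaries. -/
theorem exists_functor {n : ℕ} (S : Polygraph.{u} n) (D : NCat.{u} n)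
    (R : S.free.X → D.X → Prop) (tot : ∀ x, ∃ y, R x y)
    (hs : ∀ i x y, i < n → R x y → R (S.free.s i x) (D.s i y))
    (ht : ∀ i x y, i < n → R x y → R (S.free.t i x) (D.t i y))
    (hc : ∀ i x x' y y', i < n → S.free.t i x = S.free.s i x' → D.t i y = D.s i y' →
      R x y → R x' y' → R (S.free.comp i x x') (D.comp i y y'))
    (bdry : ∀ i x y y', i < n → R x y → R x y' → D.s i y = D.s i y') :
    ∃ F : NFunctor S.free D, ∀ x, R x (F.map x) := by
  choose r hr using tot
  cases n with
  | zero =>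
    -- In dimension `0` any choice function is a functor: boundaries are identities and nothing can
    -- be composed.
    exact ⟨⟨r, fun i x => (D.s_top _ (Nat.zero_le _)).symm,
      fun i x => (D.t_top _ (Nat.zero_le _)).symm, fun h => absurd h (Nat.not_lt_zero _)⟩, hr⟩
  | succ n =>
    have hn : n < n + 1 := by omega
    let C := S.under.free
    let E := S.ext
    let ι := C.promote.incl E.bdry
    -- By `bdry`, all values related to the same cell have the same `n`-source. So `R` determines a
    -- unique related `n`-cell over each cell of `S.under.free`, and there is no choice below the
    -- top dimension.
    have key : ∀ {x y}, R (ι.map x) y → D.s n (r (ι.map x)) = D.s n y := fun {x y} h =>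
      bdry n _ _ _ hn (hr _) h
    have ss : ∀ (y : D.X) {i}, i < n + 1 → D.s n (D.s i y) = D.s i y := fun y {i} hi =>
      D.s_s_le _ (by omega)
    have st : ∀ (y : D.X) {i}, i < n + 1 → D.s n (D.t i y) = D.t i y := fun y {i} hi =>
      D.s_t_le _ (by omega)
    have hιs : ∀ i x, S.free.s i (ι.map x) = ι.map (C.s i x) := fun i x => (ι.map_s i x).symm
    have hιt : ∀ i x, S.free.t i (ι.map x) = ι.map (C.t i x) := fun i x => (ι.map_t i x).symm
    have ks : ∀ {i x y}, i < n + 1 → R (ι.map x) y → D.s n (r (ι.map (C.s i x))) = D.s i y :=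
      fun {i x y} hi h => by
        have := hs i _ _ hi h
        rw [hιs] at this
        rw [key this, ss _ hi]
    have kt : ∀ {i x y}, i < n + 1 → R (ι.map x) y → D.s n (r (ι.map (C.t i x))) = D.t i y :=
      fun {i x y} hi h => by
        have := ht i _ _ hi h
        rw [hιt] at this
        rw [key this, st _ hi]
    have hR : ∀ x, R (ι.map x) (D.s n (r (ι.map x))) := fun x => by
      have := hs n _ _ hn (hr (ι.map x))
      rwa [hιs, C.s_top x le_rfl] at this
    -- The chosen value `r (ι x)` may be a genuine `(n + 1)`-cell; its `n`-source is the unique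
    -- related `n`-cell. Functoriality follows from this uniqueness, since the boundaries and
    -- composites of related cells are related.
    let φ : NFunctor C.promote D :=
      { map := fun x => D.s n (r (ι.map x))
        map_s := fun i x => by
          by_cases hi : i < n + 1
          · exact ks hi (hR x)
          · rw [D.s_top _ (not_lt.1 hi)]
            exact congrArg (fun z => D.s n (r (ι.map z))) (C.s_top x (by omega))
        map_t := fun i x => by
          by_cases hi : i < n + 1
          · exact kt hi (hR x)
          · rw [D.t_top _ (not_lt.1 hi)]
            exact congrArg (fun z => D.s n (r (ι.map z))) (C.t_top x (by omega))
        map_comp := fun {i x y} hi h => by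
          have e : D.t i (D.s n (r (ι.map x))) = D.s i (D.s n (r (ι.map y))) := by
            rw [← kt hi (hR x), ← ks hi (hR y)]
            exact congrArg (fun z => D.s n (r (ι.map z))) h
          have := hc i _ _ _ _ hi (NCat.map_composable ι h) e (hR x) (hR y)
          have e' : S.free.comp i (ι.map x) (ι.map y) = ι.map (C.promote.comp i x y) :=
            (ι.map_comp hi h).symm
          rw [e'] at this
          rw [key this]
          rcases (Nat.lt_succ_iff.1 hi).lt_or_eq with hi' | rfl
          · rw [D.s_comp_lt hi hi' e, ss _ hn, ss _ hn]
          -- In `C.promote`, composability along the top dimension of `C` forces equality, and the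
          -- composite is the cell itself.
          · have h : x = y := by
              have h : C.t i x = C.s i y := h
              rwa [C.t_top x le_rfl, C.s_top y le_rfl] at h
            subst h
            rw [D.s_comp hi e, ss _ hn]
            have := D.id_comp (i := i) (D.s i (r (ι.map x))) hi
            rw [ss _ hn] at this
            exact this.symm }
    -- Only here are the choices free. The boundaries fit because the boundary of a chosen value is
    -- related to that of the generator, where `φ` is the only possibility.
    let ψ : E.G → D.X := fun γ => r (NCat.freeExtGen E γ)
    have ψs : ∀ i < n + 1, ∀ γ, D.s i (ψ γ) = φ.map (C.s i (E.src γ)) := fun i hi γ => by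
      have := hs i _ _ hi (hr (NCat.freeExtGen E γ))
      rw [show S.free.s i _ = _ from NCat.freeExt_s_gen E γ hi] at this
      exact (ss _ hi).symm.trans (key this).symm
    have ψt : ∀ i < n + 1, ∀ γ, D.t i (ψ γ) = φ.map (C.t i (E.tgt γ)) := fun i hi γ => by
      have := ht i _ _ hi (hr (NCat.freeExtGen E γ))
      rw [show S.free.t i _ = _ from NCat.freeExt_t_gen E γ hi] at this
      exact (st _ hi).symm.trans (key this).symm
    let F : NFunctor S.free D := NCat.lift (C := C.promote) (B := E.bdry) φ ψ ψs ψt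
    refine ⟨F, fun x => ?_⟩
    refine NCat.adjoin_ind (C := C.promote) (B := E.bdry) (p := fun x => R x (F.map x))
      hR (fun γ => hr _) (fun i x y hi h hx hy => ?_) x
    have e : F.map (S.free.comp i x y) = D.comp i (F.map x) (F.map y) := F.map_comp hi h
    exact (congrArg (R _) e).mpr (hc i x y _ _ hi h (NCat.map_composable F h) hx hy)

/-- Two functors from a free category to an `(n + 1)`-category whose values are linked by
`(n + 1)`-cells are linked by a family of cells that is compatible with compositions. -/
theorem exists_transformation {n : ℕ} (S : Polygraph.{u} n) (T : NCat.{u} (n + 1))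
    (A B : NFunctor S.free.promote T) (h : ∀ x, ∃ f, T.s n f = A.map x ∧ T.t n f = B.map x) :
    ∃ k : S.free.X → T.X, (∀ x, T.s n (k x) = A.map x ∧ T.t n (k x) = B.map x) ∧
      ∀ i x y, i < n → S.free.t i x = S.free.s i y →
        k (S.free.comp i x y) = T.comp i (k x) (k y) := by
  -- A family of `(n + 1)`-cells compatible with the compositions along `i < n` is found as a
  -- functor to `T.forgetTop`, in which those cells have become `n`-cells. `exists_functor` then
  -- applies to the relation "`f` goes from `A x` to `B x`".
  suffices H : ∃ k : NFunctor S.free T.forgetTop, ∀ x : S.free.X,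
      T.s n (k.map x) = A.map x ∧ T.t n (k.map x) = B.map x by
    obtain ⟨k, hk⟩ := H
    exact ⟨k.map, hk, fun i x y hi c => k.map_comp hi c⟩
  refine exists_functor S T.forgetTop
    (fun x f => T.s n f = A.map x ∧ T.t n f = B.map x) h ?_ ?_ ?_ ?_
  · intro i x (f : T.X) hi ⟨h1, h2⟩
    have e : T.forgetTop.s i f = T.s i f := if_pos hi
    refine e.symm ▸ ⟨?_, ?_⟩
    · refine Eq.trans ?_ (A.map_s i x).symm
      rw [T.s_s_le _ hi.le, ← h1, T.s_s_lt _ hi]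
    · refine Eq.trans ?_ (B.map_s i x).symm
      rw [T.t_s_le _ hi.le, ← h2, T.s_t_lt _ hi]
  · intro i x (f : T.X) hi ⟨h1, h2⟩
    have e : T.forgetTop.t i f = T.t i f := if_pos hi
    refine e.symm ▸ ⟨?_, ?_⟩
    · refine Eq.trans ?_ (A.map_t i x).symm
      rw [T.s_t_le _ hi.le, ← h1, T.t_s_lt _ hi]
    · refine Eq.trans ?_ (B.map_t i x).symm
      rw [T.t_t_le _ hi.le, ← h2, T.t_t_lt _ hi]
  · intro i x y (f : T.X) (g : T.X) hi c c' ⟨h1, h2⟩ ⟨h3, h4⟩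
    have ef : T.forgetTop.t i f = T.t i f := if_pos hi
    have eg : T.forgetTop.s i g = T.s i g := if_pos hi
    have c' : T.t i f = T.s i g := ef.symm.trans (c'.trans eg)
    change T.s n (T.comp i f g) = _ ∧ T.t n (T.comp i f g) = _
    rw [T.s_comp_lt (by omega) hi c', T.t_comp_lt (by omega) hi c', h1, h2, h3, h4]
    exact ⟨(NCat.map_promote_comp A hi c).symm, (NCat.map_promote_comp B hi c).symm⟩
  -- Two cells with the same `n`-source have the same `i`-source for `i < n`.
  · intro i x (f : T.X) (g : T.X) hi ⟨h1, _⟩ ⟨h2, _⟩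
    have ef : T.forgetTop.s i f = T.s i f := if_pos hi
    have eg : T.forgetTop.s i g = T.s i g := if_pos hi
    rw [ef, eg]
    exact (T.s_s_lt f hi).symm.trans
      ((congrArg (T.s i) (h1.trans h2.symm)).trans (T.s_s_lt g hi))

/-! ### Lifting an equivalence of presentations to track categories -/

/-- A functor between presented categories lifts to the free categories. -/
theorem exists_functor_lift {n : ℕ} (S U : Polygraph.{u} (n + 1))
    (Φ : NFunctor S.presented U.presented) : ∃ F : NFunctor S.under.free U.under.free,
      ∀ x, Φ.map (NCat.quotMk S.ext x) = NCat.quotMk U.ext (F.map x) := by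
  refine exists_functor S.under U.under.free
    (fun x y => Φ.map (NCat.quotMk S.ext x) = NCat.quotMk U.ext y)
    (fun x => ⟨_, (Quotient.out_eq _).symm⟩) ?_ ?_ ?_ ?_
  · intro i x y _ h
    refine (Φ.map_s i (NCat.quotMk S.ext x)).trans ?_
    rw [h]; rfl
  · intro i x y _ h
    refine (Φ.map_t i (NCat.quotMk S.ext x)).trans ?_
    rw [h]; rfl
  · intro i x x' y y' hi c c' h h'
    refine (congrArg Φ.map (NCat.quotComp_mk S.ext hi c).symm).trans
      (Eq.trans ?_ (NCat.quotComp_mk U.ext hi c'))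
    refine (Φ.map_comp hi (NCat.map_composable (NCat.quotFunctor S.ext) c)).trans ?_
    exact congrArg₂ (U.presented.comp i) h h'
  · intro i x y y' hi h h'
    -- Two lifts of the same class are congruent, and congruence preserves the boundaries.
    have c : U.ext.Cong y y' := NCat.quotMk_eq_iff.1 (h.symm.trans h')
    exact (c.bdry i hi).1

/-- A lift of a functor between presented categories extends to track categories. -/
theorem exists_track_functor {n : ℕ} {S U : Polygraph.{u} (n + 1)}
    (Φ : NFunctor S.presented U.presented) (F : NFunctor S.under.free U.under.free)
    (hF : ∀ x, Φ.map (NCat.quotMk S.ext x) = NCat.quotMk U.ext (F.map x)) :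
    ∃ F' : NFunctor S.track.abelianized U.track.abelianized,
      ∀ x, F'.map ((NCat.trackCell S.ext).map x) = (NCat.trackCell U.ext).map (F.map x) := by
  refine NCat.exists_trackLift S.ext U.isTrack_abelianized (NCat.abelianized_comm _)
    (NCat.compFunctor (NCat.promoteFunctor F) (NCat.trackCell U.ext)) fun γ => ?_
  -- The two sides of a relation of `S` are equal in `S.presented`, so their images are equal in
  -- `U.presented`; a cell of the track category of `U` links them and can serve as the image of the
  -- relation.
  refine NCat.exists_of_cong_trackCell U.ext (NCat.quotMk_eq_iff.1 ?_)
  refine (hF _).symm.trans (Eq.trans ?_ (hF _))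
  exact congrArg Φ.map (NCat.quotMk_eq_iff.2 (NCat.CellExt.Cong.of (E := S.ext) γ))

/-- Lifting both functors of the equivalence reduces the statement to
`NCat.finitelyGenerated_of_toId`. What remains is a compatible family of links from `F' (G' x)` to
`x`, which exists because `Φ ∘ Ψ` is the identity and the `n`-cells form a free category. -/
theorem finitelyGenerated_of_tietzeEquivalent {n : ℕ} {S U : Polygraph.{u} (n + 1)}
    (h : S.TietzeEquivalent U) (hU : Finite U.TopGen) (hS : NCat.FinitelyGenerated S.identities) :
    NCat.FinitelyGenerated U.identities := by
  obtain ⟨Φ, Ψ, -, hΦΨ⟩ := h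
  obtain ⟨F, hF⟩ := exists_functor_lift S U Φ
  obtain ⟨G, hG⟩ := exists_functor_lift U S Ψ
  obtain ⟨F', hF'⟩ := exists_track_functor Φ F hF
  obtain ⟨G', hG'⟩ := exists_track_functor Ψ G hG
  let T := U.track.abelianized
  let C := U.under.free
  let ι : NFunctor C.promote T := NCat.trackCell U.ext
  have hH : ∀ x : C.X, F'.map (G'.map (ι.map x)) = ι.map (F.map (G.map x)) := fun x =>
    (congrArg F'.map (hG' x)).trans (hF' _)
  have inj : Function.Injective ι.map := NCat.trackCell_injective U.ext
  -- The links are chosen over the free category `C`, where freeness is available, and are moved to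
  -- the `n`-cells of `T` afterwards.
  obtain ⟨k, hk, kc⟩ := exists_transformation U.under T
    (NCat.compFunctor (NCat.promoteFunctor (NCat.compFunctor G F)) ι) ι fun x => by
      refine NCat.exists_of_cong_trackCell U.ext (NCat.quotMk_eq_iff.1 ?_)
      exact (hF _).symm.trans ((congrArg Φ.map (hG x)).symm.trans (hΦΨ _))
  -- `ι` is a bijection onto the `n`-cells of `T`; `r` is its inverse there, and on a general cell
  -- it returns the preimage of the `n`-source.
  have hr : ∀ z : T.X, ∃ x : C.X, ι.map x = T.s n z := NCat.exists_trackCell U.ext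
  choose r hr using hr
  have hr' : ∀ z : T.X, T.s n z = z → ι.map (r z) = z := fun z hz => (hr z).trans hz
  let K : NCat.ToId (T := T) (NCat.compFunctor G' F') :=
    { κ := fun z => k (r z)
      s_κ := fun z hz => (hk _).1.trans ((hH _).symm.trans
        (congrArg (fun z => F'.map (G'.map z)) (hr' z hz)))
      t_κ := fun z hz => (hk _).2.trans (hr' z hz)
      κ_comp := fun i x y hi hx hy h => by
        have c : C.t i (r x) = C.s i (r y) := by
          apply inj
          refine (ι.map_t i _).trans (Eq.trans ?_ (ι.map_s i _).symm)
          rw [hr' x hx, hr' y hy]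
          exact h
        -- Injectivity of `ι` makes `r` compatible with the compositions of `n`-cells, so `κ`
        -- inherits the compatibility of `k`.
        have e : r (T.comp i x y) = C.comp i (r x) (r y) := by
          apply inj
          rw [NCat.map_promote_comp ι hi c, hr' x hx, hr' y hy]
          refine hr' _ ?_
          rw [T.s_comp_lt (by omega) hi h, hx, hy]
        exact (congrArg k e).trans (kc i _ _ hi c) }
  have : Finite U.ext.G := hU
  refine NCat.finitelyGenerated_of_toId S.isTrack_abelianized U.isTrack_abelianized F' G' K
    (Set.finite_range (NCat.trackGen U.ext)) (fun p hc hg hcomp => ?_) hS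
  exact NCat.track_ind U.ext (fun x => hc _ (NCat.map_promote_s ι x))
    (fun γ => hg _ ⟨γ, rfl⟩) hcomp

end Polygraph

theorem mainTheorem4 (n : ℕ) (S U : Polygraph.{u} (n + 1)) (h : S.TietzeEquivalent U)
    (hS : Finite S.TopGen) (hU : Finite U.TopGen) :
    NCat.FinitelyGenerated S.identities ↔ NCat.FinitelyGenerated U.identities := by
  -- Each direction uses the finiteness of the generating cells of the polygraph whose identities
  -- are to be generated: their defects must be finite in number.
  refine ⟨Polygraph.finitelyGenerated_of_tietzeEquivalent h hU,
    Polygraph.finitelyGenerated_of_tietzeEquivalent ?_ hS⟩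
  obtain ⟨F, G, h1, h2⟩ := h
  exact ⟨G, F, h2, h1⟩
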